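/- Let $n\ge 3$, write points of $\mathbb R^n_+=\{x\in\mathbb R^n: x_n>0\}$ as $x=(x',x_n)$, let $N=-e_n$ be the outward unit normal, and for a vector $v\in\mathbb R^n$ let $v_T=v-(v\cdot N)N$ be its tangential part. Let $\omega_n$ be the area of the unit sphere of $\mathbb R^n$, let $$E(x)=-\frac{1}{(n-2)\,\omega_n\,|x|^{n-2}},\qquad \Gamma(x,t)=(4\pi t)^{-n/2}e^{-|x|^2/(4t)}\ (t>0),\qquad \Gamma(x,t)=0\ (t\le 0),$$ be the fundamental solutions of the Laplace equation ($\Delta E=\delta$) and of the heat equation, and set, for $x_n>0$ and $1\le i,j\le n$, $$L_{ij}(x,t)=D_{x_j}\int_0^{x_n}\!\int_{\mathbb R^{n-1}}D_{z_n}\Gamma(z,t)\,D_{x_i}E(x-z)\,dz'\,dz_n,\qquad \kappa(x,t)=\int_{\mathbb R^{n-1}}D_{x_n}\Gamma(x'-z',x_n,t)\,E(z',0)\,dz'.$$ For $c\in\mathbb R$ consider the kernel $$K_{ij}(x,t)=-2\delta_{ij}D_{x_n}\Gamma(x,t)+4L_{ij}(x,t)+c\,\delta_{jn}\,\delta(t)\,D_{x_i}E(x),$$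 which for $c=2$ is the Poisson kernel of the nonstationary Stokes system in $\mathbb R^n_+$ (unit viscosity, zero initial velocity). For boundary data $g=(g_1,\dots,g_n)$ on $\mathbb R^{n-1}\times(0,T)$ let $u$ be the velocity represented by $$u_i(x,t)=\sum_{j=1}^n\int_0^t\!\int_{\mathbb R^{n-1}}K_{ij}(x'-y',x_n,t-s)\,g_j(y',s)\,dy'\,ds,$$ where the Dirac mass contributes $c\int_{\mathbb R^{n-1}}D_{x_i}E(x'-y',x_n)\,g_n(y',t)\,dy'$, and let $$\mathbf S(g_n)(x,t)=\int_{\mathbb R^{n-1}}E(x'-y',x_n)\,g_n(y',t)\,dy',\qquad \mathbf T(g_n)(x,t)=4\int_0^t\!\int_{\mathbb R^{n-1}}\kappa(x'-y',x_n,t-s)\,g_n(y',s)\,dy'\,ds .$$ **Theorem.** For every $n\ge3$ and $c\in\mathbb R$ there is a constant $C>0$, depending only on $n$ and $c$, such that for all $T>0$ and all $g\in L^\infty(\mathbb R^{n-1}\times(0,T);\mathbb R^n)$ the following holds. (a) If $\int_0^T\!\int_{\mathbb R^{n-1}}|g_n(y',t)|\,(1+|y'|)^{2-n}\,dy'\,dt<\infty$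 (so that the potentials of $g_n$ are defined), then for almost every $t\in(0,T)$ and every $x\in\mathbb R^n_+$ the integrals defining $u(x,t)$, $\mathbf S(g_n)(x,t)$ and $\mathbf T(g_n)(x,t)$ converge absolutely, the two potentials have partial derivatives in the tangential directions, and $$\|u_T-c\,(\nabla\mathbf S(g_n))_T-(\nabla\mathbf T(g_n))_T\|_{L^\infty(\mathbb R^n_+\times(0,T))}\le C\,\|g\|_{L^\infty(\mathbb R^{n-1}\times(0,T))}.$$ (b) Without the condition in (a), for almost every $t\in(0,T)$ and every $x\in\mathbb R^n_+$ the integrals defining $u_n(x,t)$ converge absolutely and $$|u_n(x,t)|\le C\,\|g\|_{L^\infty(\mathbb R^{n-1}\times(0,T))}.$$ -/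

import Mathlib

open MeasureTheory Set

noncomputable section

namespace HalfSpaceStokes

/-- The boundary `ℝ^{n-1}` and the space `ℝ^n` are `Space d` and `Space (d + 1)`, with `n = d + 1`;
the coordinate `x_n` is the one with index `Fin.last d`. -/
abbrev Space (m : ℕ) : Type := EuclideanSpace ℝ (Fin m)

variable {d : ℕ}

/-- The point `(y', r)` of `ℝ^n`. -/
def pt (y : Space d) (r : ℝ) : Space (d + 1) :=
  WithLp.toLp 2 (Fin.snoc (α := fun _ => ℝ) (fun i => y i) r)

/-- The open half space `x_n > 0`. -/
def halfSpace (d : ℕ) : Set (Space (d + 1)) := {x | 0 < x (Fin.last d)}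

/-- The partial derivative `∂f/∂x_i` at `x`. -/
def pd {m : ℕ} (i : Fin m) (f : Space m → ℝ) (x : Space m) : ℝ :=
  lineDeriv ℝ f x (EuclideanSpace.single i 1)

/-- The gradient, as the vector of partial derivatives. -/
def grad {m : ℕ} (f : Space m → ℝ) (x : Space m) : Space m :=
  WithLp.toLp 2 fun i => pd i f x

/-- The outward unit normal `-e_n` of the half space. -/
def outwardNormal (d : ℕ) : Space (d + 1) := -EuclideanSpace.single (Fin.last d) (1 : ℝ)

/-- The tangential part `v - (v · N) N` of a vector. -/
def tangential (v : Space (d + 1)) : Space (d + 1) :=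
  v - (inner ℝ v (outwardNormal d)) • outwardNormal d

/-- The surface area `2 π^{m/2} / Γ(m/2)` of the unit sphere of `ℝ^m`. -/
def sphereArea (m : ℕ) : ℝ := 2 * Real.pi ^ ((m : ℝ) / 2) / Real.Gamma ((m : ℝ) / 2)

/-- The fundamental solution of the Laplace equation in `ℝ^n`, `n = d + 1 ≥ 3`, normalized by
`ΔE = δ`: `E(x) = -1 / ((n - 2) ω_n |x|^{n-2})`. -/
def laplaceKernel (x : Space (d + 1)) : ℝ :=
  -(1 / (((d : ℝ) - 1) * sphereArea (d + 1) * ‖x‖ ^ (d - 1)))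

/-- The fundamental solution of the heat equation with unit conductivity,
`Γ(x, t) = (4πt)^{-n/2} exp(-|x|^2 / (4t))` for `t > 0`, and `0` for `t ≤ 0`. -/
def heatKernel (x : Space (d + 1)) (t : ℝ) : ℝ :=
  if 0 < t then 1 / Real.sqrt (4 * Real.pi * t) ^ (d + 1) * Real.exp (-‖x‖ ^ 2 / (4 * t)) else 0

/-- `D_{x_n} Γ (x, t)`. -/
def heatKernelDn (x : Space (d + 1)) (t : ℝ) : ℝ :=
  pd (Fin.last d) (fun w => heatKernel w t) x

/-- `L_ij(x, t) = D_{x_j} ∫_0^{x_n} ∫_{ℝ^{n-1}} D_{z_n} Γ(z, t) D_{x_i} E(x - z) dz' dz_n`. -/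
def kernelL (i j : Fin (d + 1)) (x : Space (d + 1)) (t : ℝ) : ℝ :=
  pd j (fun w => ∫ r in Ioo 0 (w (Fin.last d)), ∫ z : Space d,
    heatKernelDn (pt z r) t * pd i laplaceKernel (w - pt z r)) x

/-- The part of the Poisson kernel that is a function, `-2 δ_ij D_{x_n} Γ + 4 L_ij`. -/
def kernelK (i j : Fin (d + 1)) (x : Space (d + 1)) (t : ℝ) : ℝ :=
  -2 * (if i = j then 1 else 0) * heatKernelDn x t + 4 * kernelL i j x t

/-- The velocity obtained from the boundary data `g` by the kernel
`K_ij(x, t) = -2 δ_ij D_{x_n} Γ(x, t) + 4 L_ij(x, t) + c δ_jn δ(t) D_{x_i} E(x)`, that is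
`u_i(x, t) = ∑_j ∫_0^t ∫ K_ij(x' - y', x_n, t - s) g_j(y', s) dy' ds`, where the Dirac mass in
time produces the value at `s = t`. For `c = 2` this is the Poisson kernel of the Stokes system. -/
def velocity (c : ℝ) (g : Space d × ℝ → Space (d + 1)) (x : Space (d + 1)) (t : ℝ) :
    Space (d + 1) :=
  WithLp.toLp 2 fun i =>
    (∑ j, ∫ s in Ioo 0 t, ∫ y : Space d, kernelK i j (x - pt y 0) (t - s) * g (y, s) j)
      + c * ∫ y : Space d, pd i laplaceKernel (x - pt y 0) * g (y, t) (Fin.last d)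

/-- All integrals in the definition of `u_i(x, t)` converge absolutely. -/
def VelocityConverges (g : Space d × ℝ → Space (d + 1)) (i : Fin (d + 1)) (x : Space (d + 1))
    (t : ℝ) : Prop :=
  (∀ j, IntegrableOn (fun q : Space d × ℝ => kernelK i j (x - pt q.1 0) (t - q.2) * g q j)
    (univ ×ˢ Ioo 0 t)) ∧
  Integrable (fun y : Space d => pd i laplaceKernel (x - pt y 0) * g (y, t) (Fin.last d))

/-- The single layer potential `S(f)(x) = ∫ E(x - y) f(y) dσ(y)`. -/
def potentialS (f : Space d → ℝ) (x : Space (d + 1)) : ℝ :=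
  ∫ y : Space d, laplaceKernel (x - pt y 0) * f y

/-- The composite kernel `κ(x, t) = ∫ D_{x_n} Γ(x' - z', x_n, t) E(z', 0) dz'`. -/
def kappa (x : Space (d + 1)) (t : ℝ) : ℝ :=
  ∫ z : Space d, heatKernelDn (x - pt z 0) t * laplaceKernel (pt z 0)

/-- `T(f)(x, t) = 4 ∫_0^t ∫ κ(x' - y', x_n, t - s) f(y', s) dy' ds`. -/
def potentialT (f : Space d × ℝ → ℝ) (x : Space (d + 1)) (t : ℝ) : ℝ :=
  4 * ∫ s in Ioo 0 t, ∫ y : Space d, kappa (x - pt y 0) (t - s) * f (y, s)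

/-- The integrals defining `S(f(·, t))` and `T(f)` at `(x, t)` converge absolutely and both
potentials have partial derivatives at `x` in all tangential directions. -/
def PotentialsConverge (f : Space d × ℝ → ℝ) (x : Space (d + 1)) (t : ℝ) : Prop :=
  Integrable (fun y : Space d => laplaceKernel (x - pt y 0) * f (y, t)) ∧
  IntegrableOn (fun q : Space d × ℝ => kappa (x - pt q.1 0) (t - q.2) * f q) (univ ×ˢ Ioo 0 t) ∧
  ∀ i : Fin d,
    LineDifferentiableAt ℝ (potentialS fun y => f (y, t)) x
      (EuclideanSpace.single i.castSucc (1 : ℝ)) ∧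
    LineDifferentiableAt ℝ (fun w => potentialT f w t) x
      (EuclideanSpace.single i.castSucc (1 : ℝ))

/-- The measure of the lateral boundary `ℝ^{n-1} × (0, T)`. -/
def lateral (d : ℕ) (T : ℝ) : Measure (Space d × ℝ) := volume.restrict (univ ×ˢ Ioo 0 T)

end HalfSpaceStokes

end

open Filter Topology

noncomputable section

namespace HalfSpaceStokes

variable {d : ℕ}

/-! ### Points of the half space -/

/-! Write `n = d + 1`. The derivative `D_n Γ` splits as `normalFactor t r * gauss t z`, so `L_ij` is
`D_{x_j}` of the Volterra integral `∫_0^X normalFactor t r * convGrad i t (X - r) x dr`, where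
`convGrad i t s` is the heat flow on `ℝ^d` of `D_i E(·, s)`. The theorem follows from Young's
inequality (`L¹` kernel, `L^∞` datum) once every `K_ij` is an `L¹(ℝ^d × (0,∞))` kernel, with norm
independent of `X`, plus explicit terms that either vanish or rebuild the two potentials.

For tangential `j` the derivative passes inside the integral and gives `kernelTan`, built from
`convHess`, the heat flow of `D_i D_j E(·, s)`. A second derivative of `E` with one tangential index
has mean zero on each plane `x_n = s` (`integral_hessE`), so `gauss t (x - z)` may be replaced by
`gauss t (x - z) - gauss t x`. The `L¹` modulus of the Gaussian is at most `C |z|^{1/2} t^{-1/4}`,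
and the second derivatives are `O(|(z,s)|^{-(d+1)})`, whence `‖convHess(t,s)‖_1 ≤ C t^{-1/4}
s^{-1/2}` (`lintegral_convHess_le`). Since `∫_0^∞ |normalFactor t r| t^{-1/4} dt ≤ C r^{-1/2}`
(`lintegral_normalFactor_le`), the `L¹` norm of `kernelTan` is bounded by the Beta integral `∫_0^X
r^{-1/2} (X - r)^{-1/2} dr`, which does not depend on `X` (`isBoundedKernel_kernelTan`).

For `j = n`, differentiating the Volterra integral produces a boundary term `normalFactor t X` times
the trace of `convGrad` at `s = 0` (`hasDerivAt_normal_convolution`). If `i = n`, the remaining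
integral contains `D_n D_n E`, which harmonicity turns into tangential second derivatives, and the
trace is a multiple of `gauss`, so `K_nn` is in `L¹`. If `i = k` is tangential, the trace is `D_k`
of the heat flow of `E(·, 0)`, and the boundary term is exactly `D_k κ`. It decays only like
`|x|^{-d}` and is not in `L¹`, but four times its convolution with `g_n` is `D_k T(g_n)`.

The Dirac term gives `c D_k S(g_n)` in tangential components and a convolution with the integrable
Poisson-type kernel `D_n E(·, X)` in the normal one. Subtracting `c ∇S + ∇T` from `u_T` therefore
leaves only `L¹` kernels. The weighted integrability of `g_n` serves to make `S`, `T` converge and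
to differentiate them under the integral; the constants in those decay estimates depend on `X` and
`t`, but never enter the final bound. -/

@[simp] lemma pt_castSucc (z : Space d) (s : ℝ) (i : Fin d) : pt z s i.castSucc = z i := by
  simp [pt]

@[simp] lemma pt_last (z : Space d) (s : ℝ) : pt z s (Fin.last d) = s := by
  simp [pt]

lemma norm_pt_sq (z : Space d) (s : ℝ) : ‖pt z s‖ ^ 2 = ‖z‖ ^ 2 + s ^ 2 := by
  simp [EuclideanSpace.norm_sq_eq, Fin.sum_univ_castSucc]

lemma space_ext {x y : Space (d + 1)} (h : ∀ i : Fin d, x i.castSucc = y i.castSucc)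
    (hl : x (Fin.last d) = y (Fin.last d)) : x = y := by
  ext i
  refine Fin.lastCases hl h i

/-- The projection `x ↦ x'` of `ℝ^n` to the boundary. -/
def bdry (x : Space (d + 1)) : Space d := WithLp.toLp 2 fun i => x i.castSucc

@[simp] lemma bdry_apply (x : Space (d + 1)) (i : Fin d) : bdry x i = x i.castSucc := rfl

lemma pt_bdry (x : Space (d + 1)) : pt (bdry x) (x (Fin.last d)) = x :=
  space_ext (by simp) (by simp)

lemma pt_sub_pt (y z : Space d) (r s : ℝ) : pt y r - pt z s = pt (y - z) (r - s) :=
  space_ext (by simp) (by simp)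

lemma pt_add_smul_castSucc (z : Space d) (s h : ℝ) (k : Fin d) :
    pt z s + h • EuclideanSpace.single k.castSucc (1 : ℝ)
      = pt (z + h • EuclideanSpace.single k 1) s :=
  space_ext (fun i => by simp [Fin.castSucc_inj])
    (by simp [(Fin.castSucc_lt_last k).ne'])

lemma pt_add_smul_last (z : Space d) (s h : ℝ) :
    pt z s + h • EuclideanSpace.single (Fin.last d) (1 : ℝ) = pt z (s + h) :=
  space_ext (fun i => by simp [(Fin.castSucc_lt_last i).ne]) (by simp)

lemma pd_castSucc_eq {f : Space (d + 1) → ℝ} {z : Space d} {s D : ℝ} {k : Fin d}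
    (h : HasDerivAt (fun h : ℝ => f (pt (z + h • EuclideanSpace.single k 1) s)) D 0) :
    pd k.castSucc f (pt z s) = D := by
  have : HasLineDerivAt ℝ f D (pt z s) (EuclideanSpace.single k.castSucc 1) := by
    unfold HasLineDerivAt
    simpa only [pt_add_smul_castSucc] using h
  exact this.lineDeriv

lemma pd_last_eq {f : Space (d + 1) → ℝ} {z : Space d} {s D : ℝ}
    (h : HasDerivAt (fun h : ℝ => f (pt z (s + h))) D 0) :
    pd (Fin.last d) f (pt z s) = D := by
  have : HasLineDerivAt ℝ f D (pt z s) (EuclideanSpace.single (Fin.last d) 1) := by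
    unfold HasLineDerivAt
    simpa only [pt_add_smul_last] using h
  exact this.lineDeriv

lemma sphereArea_pos : 0 < sphereArea (d + 1) := by
  unfold sphereArea
  have : 0 < Real.Gamma (((d + 1 : ℕ) : ℝ) / 2) := Real.Gamma_pos_of_pos (by positivity)
  positivity

lemma measurable_pt : Measurable fun p : Space d × ℝ => pt p.1 p.2 := by
  unfold pt
  refine (WithLp.measurable_toLp 2 _).comp (measurable_pi_lambda _ fun i => ?_)
  refine Fin.lastCases ?_ (fun j => ?_) i
  · simpa using measurable_snd
  · simpa using (by fun_prop : Measurable fun p : Space d × ℝ => p.1 j)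

/-! ### Powers of the distance to the origin and the derivatives of the Laplace kernel -/

/-- `|(z, s)|^{-m}`. -/
def radialPow (m : ℝ) (z : Space d) (s : ℝ) : ℝ := (‖z‖ ^ 2 + s ^ 2) ^ (-(m / 2))

lemma radialPow_nonneg (m : ℝ) (z : Space d) (s : ℝ) : 0 ≤ radialPow m z s := by
  unfold radialPow; positivity

lemma measurable_radialPow (m : ℝ) :
    Measurable fun p : Space d × ℝ => radialPow m p.1 p.2 := by
  unfold radialPow; fun_prop

lemma sum_sq_pos (z : Space d) {s : ℝ} (hs : 0 < s) : 0 < ‖z‖ ^ 2 + s ^ 2 := by positivity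

lemma hasDerivAt_norm_sq_line (z : Space d) (k : Fin d) (h : ℝ) :
    HasDerivAt (fun h : ℝ => ‖z + h • EuclideanSpace.single k (1 : ℝ)‖ ^ 2)
      (2 * (z + h • EuclideanSpace.single k (1 : ℝ)) k) h := by
  have h1 : HasDerivAt (fun h : ℝ => z + h • EuclideanSpace.single k (1 : ℝ))
      (EuclideanSpace.single k (1 : ℝ)) h := by
    simpa using ((hasDerivAt_id h).smul_const (EuclideanSpace.single k (1 : ℝ))).const_add z
  have := h1.norm_sq
  simpa [EuclideanSpace.inner_single_right] using this

lemma hasDerivAt_radialPow_line (m : ℝ) (z : Space d) {s : ℝ} (hs : 0 < s) (k : Fin d) (h : ℝ) :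
    HasDerivAt (fun h : ℝ => radialPow m (z + h • EuclideanSpace.single k (1 : ℝ)) s)
      (-m * (z + h • EuclideanSpace.single k (1 : ℝ)) k *
        radialPow (m + 2) (z + h • EuclideanSpace.single k (1 : ℝ)) s) h := by
  have := ((hasDerivAt_norm_sq_line z k h).add_const (s ^ 2)).rpow_const (p := -(m / 2))
    (Or.inl (sum_sq_pos _ hs).ne')
  unfold radialPow
  convert! this using 1
  rw [show -(m / 2) - 1 = -((m + 2) / 2) by ring]
  ring

lemma hasDerivAt_radialPow_normal (m : ℝ) (z : Space d) {s : ℝ} (hs : 0 < s) :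
    HasDerivAt (fun s : ℝ => radialPow m z s) (-m * s * radialPow (m + 2) z s) s := by
  have := (((hasDerivAt_id s).pow 2).const_add (‖z‖ ^ 2)).rpow_const (p := -(m / 2))
    (Or.inl (sum_sq_pos z hs).ne')
  unfold radialPow
  convert! this using 1
  rw [show -(m / 2) - 1 = -((m + 2) / 2) by ring]
  simp only [id_eq, Pi.pow_apply, Nat.cast_ofNat, Nat.add_one_sub_one, pow_one, mul_one]
  ring

lemma radialPow_mul_sq (m : ℝ) (z : Space d) {s : ℝ} (hs : 0 < s) :
    radialPow (m + 2) z s * (‖z‖ ^ 2 + s ^ 2) = radialPow m z s := by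
  unfold radialPow
  rw [← Real.rpow_add_one (sum_sq_pos z hs).ne']
  congr 1; ring

/-- The first derivatives of the Laplace kernel. -/
def gradE (i : Fin (d + 1)) (z : Space d) (s : ℝ) : ℝ :=
  (sphereArea (d + 1))⁻¹ * (pt z s i * radialPow (d + 1) z s)

/-- The second derivatives of the Laplace kernel, one of them tangential. -/
def hessE (i : Fin (d + 1)) (j : Fin d) (z : Space d) (s : ℝ) : ℝ :=
  (sphereArea (d + 1))⁻¹ * ((if i = j.castSucc then 1 else 0) * radialPow (d + 1) z s
    - (d + 1) * (pt z s i * z j) * radialPow (d + 1 + 2) z s)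

/-- There is no sign condition on `s`: the formula is also used for the trace `E(·, 0)`. At the
origin both sides vanish by the conventions for division by zero and for real powers of zero. -/
lemma laplaceKernel_pt (hd : 2 ≤ d) (z : Space d) (s : ℝ) :
    laplaceKernel (pt z s)
      = -((((d : ℝ) - 1) * sphereArea (d + 1))⁻¹ * radialPow (d - 1) z s) := by
  have h : ‖pt z s‖ ^ (d - 1) = (‖z‖ ^ 2 + s ^ 2) ^ (((d : ℝ) - 1) / 2) := by
    rw [← norm_pt_sq, ← Real.rpow_natCast, ← Real.rpow_natCast, ← Real.rpow_mul (norm_nonneg _)]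
    congr 1
    push_cast [Nat.cast_sub (show 1 ≤ d by omega)]
    ring
  unfold laplaceKernel radialPow
  rw [h, Real.rpow_neg (by positivity), one_div, mul_inv]

lemma hasDerivAt_laplaceKernel_line (hd : 2 ≤ d) (z : Space d) {s : ℝ} (hs : 0 < s) (k : Fin d)
    (h : ℝ) :
    HasDerivAt (fun h : ℝ => laplaceKernel (pt (z + h • EuclideanSpace.single k (1 : ℝ)) s))
      (gradE k.castSucc (z + h • EuclideanSpace.single k (1 : ℝ)) s) h := by
  simp only [laplaceKernel_pt hd]
  have hd' : (d : ℝ) - 1 ≠ 0 := by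
    have : (2 : ℝ) ≤ d := by exact_mod_cast hd
    linarith
  have := sphereArea_pos (d := d)
  refine ((hasDerivAt_radialPow_line (d - 1) z hs k h).const_mul
    ((((d : ℝ) - 1) * sphereArea (d + 1))⁻¹)).neg.congr_deriv ?_
  unfold gradE
  rw [show (d : ℝ) - 1 + 2 = d + 1 by ring, pt_castSucc]
  field_simp

lemma hasDerivAt_laplaceKernel_normal (hd : 2 ≤ d) (z : Space d) {s : ℝ} (hs : 0 < s) :
    HasDerivAt (fun s : ℝ => laplaceKernel (pt z s)) (gradE (Fin.last d) z s) s := by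
  simp only [laplaceKernel_pt hd]
  have hd' : (d : ℝ) - 1 ≠ 0 := by
    have : (2 : ℝ) ≤ d := by exact_mod_cast hd
    linarith
  have := sphereArea_pos (d := d)
  refine ((hasDerivAt_radialPow_normal (d - 1) z hs).const_mul
    ((((d : ℝ) - 1) * sphereArea (d + 1))⁻¹)).neg.congr_deriv ?_
  unfold gradE
  rw [show (d : ℝ) - 1 + 2 = d + 1 by ring, pt_last]
  field_simp

lemma pd_laplaceKernel (hd : 2 ≤ d) (i : Fin (d + 1)) (z : Space d) {s : ℝ} (hs : 0 < s) :
    pd i laplaceKernel (pt z s) = gradE i z s := by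
  refine Fin.lastCases ?_ (fun k => ?_) i
  · refine pd_last_eq ?_
    refine HasDerivAt.comp_const_add s 0 (f := fun s => laplaceKernel (pt z s)) ?_
    simpa using hasDerivAt_laplaceKernel_normal hd z hs
  · refine pd_castSucc_eq ?_
    simpa using hasDerivAt_laplaceKernel_line hd z hs k 0

lemma hasDerivAt_gradE_line (i : Fin (d + 1)) (z : Space d) {s : ℝ} (hs : 0 < s) (j : Fin d)
    (h : ℝ) :
    HasDerivAt (fun h : ℝ => gradE i (z + h • EuclideanSpace.single j (1 : ℝ)) s)
      (hessE i j (z + h • EuclideanSpace.single j (1 : ℝ)) s) h := by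
  have h1 : HasDerivAt (fun h : ℝ => pt (z + h • EuclideanSpace.single j (1 : ℝ)) s i)
      (if i = j.castSucc then 1 else 0) h := by
    refine Fin.lastCases ?_ (fun k => ?_) i
    · simpa [(Fin.castSucc_lt_last j).ne'] using hasDerivAt_const h s
    · by_cases hk : k = j
      · subst hk
        simpa using (hasDerivAt_id h).const_add (z k)
      · simpa [Fin.castSucc_inj, hk] using hasDerivAt_const h (z k)
  refine ((h1.mul (hasDerivAt_radialPow_line (d + 1) z hs j h)).const_mul
    (sphereArea (d + 1))⁻¹).congr_deriv ?_
  unfold hessE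
  ring

lemma hasDerivAt_gradE_castSucc_normal (k : Fin d) (z : Space d) {s : ℝ} (hs : 0 < s) :
    HasDerivAt (fun s : ℝ => gradE k.castSucc z s) (hessE (Fin.last d) k z s) s := by
  unfold gradE hessE
  simp only [pt_castSucc, pt_last, (Fin.castSucc_lt_last k).ne', if_false]
  refine (((hasDerivAt_radialPow_normal (d + 1) z hs).const_mul (z k)).const_mul
    (sphereArea (d + 1))⁻¹).congr_deriv ?_
  ring

/-- Harmonicity of `E`: the second normal derivative is minus the tangential Laplacian. This keeps
every second derivative in the proof of the form `hessE`, with at least one tangential index, which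
is what the mean value property needs. -/
lemma hasDerivAt_gradE_last_normal (z : Space d) {s : ℝ} (hs : 0 < s) :
    HasDerivAt (fun s : ℝ => gradE (Fin.last d) z s) (-∑ k, hessE k.castSucc k z s) s := by
  unfold gradE hessE
  simp only [pt_castSucc, pt_last, if_true]
  refine (((hasDerivAt_id s).mul (hasDerivAt_radialPow_normal (d + 1) z hs)).const_mul
    (sphereArea (d + 1))⁻¹).congr_deriv ?_
  have h2 := radialPow_mul_sq (d + 1) z hs
  have h3 : ∑ k, z k * z k = ‖z‖ ^ 2 := by
    simp [EuclideanSpace.real_norm_sq_eq, ← sq]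
  rw [← Finset.mul_sum, Finset.sum_sub_distrib, ← Finset.sum_mul, ← Finset.sum_mul,
    ← Finset.mul_sum, h3]
  simp only [Finset.sum_const, Finset.card_univ, Fintype.card_fin, nsmul_eq_mul, mul_one, one_mul,
    id_eq]
  rw [← h2]
  ring

lemma measurable_gradE (i : Fin (d + 1)) : Measurable fun p : Space d × ℝ => gradE i p.1 p.2 := by
  have h := measurable_radialPow (d := d) (d + 1)
  have h' : Measurable fun p : Space d × ℝ => pt p.1 p.2 i :=
    (by fun_prop : Measurable fun x : Space (d + 1) => x i).comp measurable_pt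
  unfold gradE
  fun_prop

lemma measurable_hessE (i : Fin (d + 1)) (j : Fin d) :
    Measurable fun p : Space d × ℝ => hessE i j p.1 p.2 := by
  have h := measurable_radialPow (d := d) (d + 1)
  have h2 := measurable_radialPow (d := d) (d + 1 + 2)
  have h' : Measurable fun p : Space d × ℝ => pt p.1 p.2 i :=
    (by fun_prop : Measurable fun x : Space (d + 1) => x i).comp measurable_pt
  unfold hessE
  fun_prop

lemma abs_pt_le (z : Space d) (s : ℝ) (i : Fin (d + 1)) :
    |pt z s i| ≤ Real.sqrt (‖z‖ ^ 2 + s ^ 2) := by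
  rw [← norm_pt_sq, Real.sqrt_sq (norm_nonneg _), ← Real.norm_eq_abs]
  exact PiLp.norm_apply_le _ i

lemma sqrt_mul_radialPow (m : ℝ) (z : Space d) {s : ℝ} (hs : 0 < s) :
    Real.sqrt (‖z‖ ^ 2 + s ^ 2) * radialPow (m + 1) z s = radialPow m z s := by
  unfold radialPow
  rw [Real.sqrt_eq_rpow, ← Real.rpow_add (sum_sq_pos z hs)]
  congr 1; ring

lemma abs_gradE_le (i : Fin (d + 1)) (z : Space d) {s : ℝ} (hs : 0 < s) :
    |gradE i z s| ≤ (sphereArea (d + 1))⁻¹ * radialPow d z s := by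
  have := sphereArea_pos (d := d)
  unfold gradE
  rw [abs_mul, abs_of_pos (inv_pos.2 this), abs_mul, abs_of_nonneg (radialPow_nonneg _ _ _),
    ← sqrt_mul_radialPow d z hs]
  gcongr
  · exact radialPow_nonneg _ _ _
  · exact abs_pt_le z s i

lemma abs_hessE_le (i : Fin (d + 1)) (j : Fin d) (z : Space d) {s : ℝ} (hs : 0 < s) :
    |hessE i j z s| ≤ (sphereArea (d + 1))⁻¹ * (d + 2) * radialPow (d + 1) z s := by
  have := sphereArea_pos (d := d)
  unfold hessE
  rw [abs_mul, abs_of_pos (inv_pos.2 this), mul_assoc (sphereArea (d + 1))⁻¹ ((d : ℝ) + 2)]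
  refine mul_le_mul_of_nonneg_left ?_ (inv_pos.2 this).le
  have h0 := radialPow_nonneg (d + 1) z s
  have h2 := radialPow_nonneg (d + 1 + 2) z s
  have e1 : |(if i = j.castSucc then 1 else 0) * radialPow ((d : ℝ) + 1) z s|
      ≤ radialPow (d + 1) z s := by
    split_ifs <;> simp [abs_of_nonneg h0, h0]
  have e2 : |((d : ℝ) + 1) * (pt z s i * z j) * radialPow (d + 1 + 2) z s|
      ≤ (d + 1) * radialPow (d + 1) z s := by
    rw [abs_mul, abs_mul, abs_of_nonneg h2, abs_of_pos (by positivity : (0 : ℝ) < d + 1),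
      ← radialPow_mul_sq (d + 1) z hs, mul_assoc, mul_comm (radialPow _ _ _) (_ + _)]
    gcongr
    rw [abs_mul, ← Real.mul_self_sqrt (sum_sq_pos z hs).le]
    gcongr
    · exact abs_pt_le z s i
    · simpa using abs_pt_le z s j.castSucc
  rw [abs_le] at e1 e2 ⊢
  constructor <;> linarith

/-! ### The heat kernel of the boundary -/

/-- The heat kernel of `ℝ^{n-1}`. -/
def gauss (t : ℝ) (z : Space d) : ℝ :=
  1 / Real.sqrt (4 * Real.pi * t) ^ d * Real.exp (-‖z‖ ^ 2 / (4 * t))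

/-- The first derivatives of the heat kernel of `ℝ^{n-1}`. -/
def gaussDeriv (k : Fin d) (t : ℝ) (z : Space d) : ℝ := -(z k / (2 * t)) * gauss t z

/-- The normal derivative of the one-dimensional heat kernel. -/
def normalFactor (t r : ℝ) : ℝ :=
  -(r / (2 * t)) * (1 / Real.sqrt (4 * Real.pi * t)) * Real.exp (-r ^ 2 / (4 * t))

lemma gauss_nonneg (t : ℝ) (z : Space d) : 0 ≤ gauss t z := by
  unfold gauss; positivity

lemma measurable_gauss : Measurable fun p : ℝ × Space d => gauss p.1 p.2 := by
  unfold gauss; fun_prop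

lemma measurable_gaussDeriv (k : Fin d) :
    Measurable fun p : ℝ × Space d => gaussDeriv k p.1 p.2 := by
  have := measurable_gauss (d := d)
  unfold gaussDeriv; fun_prop

lemma measurable_normalFactor : Measurable fun p : ℝ × ℝ => normalFactor p.1 p.2 := by
  unfold normalFactor; fun_prop

@[fun_prop] lemma continuous_gauss (t : ℝ) : Continuous fun z : Space d => gauss t z := by
  unfold gauss; fun_prop

@[fun_prop] lemma continuous_gaussDeriv (k : Fin d) (t : ℝ) :
    Continuous fun z : Space d => gaussDeriv k t z := by
  unfold gaussDeriv; fun_prop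

lemma gauss_le_sup (t : ℝ) (ht : 0 < t) (z : Space d) :
    gauss t z ≤ 1 / Real.sqrt (4 * Real.pi * t) ^ d := by
  unfold gauss
  refine mul_le_of_le_one_right (by positivity) (Real.exp_le_one_iff.2 ?_)
  rw [neg_div]
  exact neg_nonpos.2 (by positivity)

lemma hasDerivAt_gauss_path (t : ℝ) {γ : ℝ → Space d} {γ' : Space d} {h : ℝ}
    (hγ : HasDerivAt γ γ' h) :
    HasDerivAt (fun h => gauss t (γ h)) (-(inner ℝ (γ h) γ' / (2 * t)) * gauss t (γ h)) h := by
  unfold gauss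
  refine ((((hγ.norm_sq.neg).div_const (4 * t)).exp).const_mul _).congr_deriv ?_
  simp only [Pi.neg_apply]
  ring

lemma hasDerivAt_gauss_line (t : ℝ) (z : Space d) (k : Fin d) (h : ℝ) :
    HasDerivAt (fun h : ℝ => gauss t (z + h • EuclideanSpace.single k (1 : ℝ)))
      (gaussDeriv k t (z + h • EuclideanSpace.single k (1 : ℝ))) h := by
  have h1 : HasDerivAt (fun h : ℝ => z + h • EuclideanSpace.single k (1 : ℝ))
      (EuclideanSpace.single k (1 : ℝ)) h := by
    simpa using ((hasDerivAt_id h).smul_const (EuclideanSpace.single k (1 : ℝ))).const_add z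
  simpa [EuclideanSpace.inner_single_right, gaussDeriv] using hasDerivAt_gauss_path t h1

lemma heatKernel_pt {t : ℝ} (ht : 0 < t) (z : Space d) (r : ℝ) :
    heatKernel (pt z r) t
      = 1 / Real.sqrt (4 * Real.pi * t) * Real.exp (-r ^ 2 / (4 * t)) * gauss t z := by
  unfold heatKernel gauss
  rw [if_pos ht, norm_pt_sq, neg_add, add_div, Real.exp_add, pow_succ]
  field_simp

lemma heatKernelDn_pt {t : ℝ} (ht : 0 < t) (z : Space d) (r : ℝ) :
    heatKernelDn (pt z r) t = normalFactor t r * gauss t z := by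
  unfold heatKernelDn
  refine pd_last_eq ?_
  simp only [heatKernel_pt ht]
  have h1 : HasDerivAt (fun h : ℝ => -(r + h) ^ 2 / (4 * t)) (-(2 * r) / (4 * t)) 0 := by
    refine (((((hasDerivAt_id (0 : ℝ)).const_add r).pow 2).neg).div_const (4 * t)).congr_deriv ?_
    simp
  refine (((h1.exp).const_mul (1 / Real.sqrt (4 * Real.pi * t))).mul_const (gauss t z)).congr_deriv
    ?_
  unfold normalFactor
  simp only [add_zero]
  field_simp
  ring

lemma integral_gauss {t : ℝ} (ht : 0 < t) : ∫ z : Space d, gauss t z = 1 := by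
  unfold gauss
  rw [integral_const_mul]
  have h := GaussianFourier.integral_rexp_neg_mul_sq_norm (V := Space d)
    (show (0 : ℝ) < 1 / (4 * t) by positivity)
  have e : ∀ z : Space d, -‖z‖ ^ 2 / (4 * t) = -(1 / (4 * t)) * ‖z‖ ^ 2 := fun z => by ring
  simp only [e]
  rw [h, finrank_euclideanSpace, Fintype.card_fin, Real.sqrt_eq_rpow, ← Real.rpow_natCast,
    ← Real.rpow_mul (by positivity), show Real.pi / (1 / (4 * t)) = 4 * Real.pi * t by field_simp,
    show (1 / 2 : ℝ) * d = d / 2 by ring]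
  exact one_div_mul_cancel (by positivity)

lemma integrable_gauss {t : ℝ} (ht : 0 < t) : Integrable fun z : Space d => gauss t z := by
  refine Integrable.of_integral_ne_zero ?_
  rw [integral_gauss ht]; exact one_ne_zero

lemma lintegral_gauss {t : ℝ} (ht : 0 < t) :
    ∫⁻ z : Space d, ENNReal.ofReal (gauss t z) = 1 := by
  rw [← ofReal_integral_eq_lintegral_ofReal (integrable_gauss ht)
    (ae_of_all _ fun z => gauss_nonneg t z), integral_gauss ht, ENNReal.ofReal_one]

/-- The constant in the comparison of the gradient of the heat kernel with the heat kernel at a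
later time. -/
def slopeConst (d : ℕ) : ℝ := Real.sqrt 2 ^ d

lemma slopeConst_pos : 0 < slopeConst d := by unfold slopeConst; positivity

/-- Half of the Gaussian exponent absorbs the factor `‖z‖ / √t`, the other half is the Gaussian at
time `2t`; `slopeConst` is the ratio of the two normalizations. Gradients of the heat kernel are
thus dominated by positive kernels of known mass. -/
lemma norm_mul_gauss_le {t : ℝ} (ht : 0 < t) (z : Space d) :
    ‖z‖ / (2 * t) * gauss t z ≤ slopeConst d / Real.sqrt t * gauss (2 * t) z := by
  have hs : 0 < Real.sqrt t := Real.sqrt_pos.2 ht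
  have e1 : gauss t z
      = slopeConst d * Real.exp (-(‖z‖ ^ 2 / (8 * t))) * gauss (2 * t) z := by
    unfold gauss slopeConst
    have : Real.sqrt (4 * Real.pi * (2 * t)) = Real.sqrt 2 * Real.sqrt (4 * Real.pi * t) := by
      rw [← Real.sqrt_mul (by norm_num)]; congr 1; ring
    rw [this, mul_pow, show -‖z‖ ^ 2 / (4 * t) = -(‖z‖ ^ 2 / (8 * t)) + -‖z‖ ^ 2 / (4 * (2 * t)) by
      field_simp; ring, Real.exp_add]
    field_simp
  have e2 : ‖z‖ / (2 * t) * Real.exp (-(‖z‖ ^ 2 / (8 * t))) ≤ 1 / Real.sqrt t := by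
    rw [Real.exp_neg, ← div_eq_mul_inv, div_le_iff₀ (Real.exp_pos _)]
    have h1 := Real.add_one_le_exp (‖z‖ ^ 2 / (8 * t))
    have h2 : ‖z‖ / (2 * t) ≤ 1 / Real.sqrt t * (‖z‖ ^ 2 / (8 * t) + 1) := by
      have h3 : (Real.sqrt t) ^ 2 = t := Real.sq_sqrt ht.le
      set q := Real.sqrt t
      rw [← h3, div_le_iff₀ (by positivity)]
      have : 1 / q * (‖z‖ ^ 2 / (8 * q ^ 2) + 1) * (2 * q ^ 2) = (‖z‖ ^ 2 + 8 * q ^ 2) / (4 * q) := by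
        field_simp
        ring
      rw [this, le_div_iff₀ (by positivity)]
      nlinarith [sq_nonneg (‖z‖ - 2 * q)]
    exact h2.trans (mul_le_mul_of_nonneg_left h1 (by positivity))
  have hg := gauss_nonneg (2 * t) z
  have hc := slopeConst_pos (d := d)
  calc ‖z‖ / (2 * t) * gauss t z
      = ‖z‖ / (2 * t) * Real.exp (-(‖z‖ ^ 2 / (8 * t))) * (slopeConst d * gauss (2 * t) z) := by
        rw [e1]; ring
    _ ≤ 1 / Real.sqrt t * (slopeConst d * gauss (2 * t) z) := by gcongr
    _ = _ := by ring

lemma abs_gaussDeriv_le {t : ℝ} (ht : 0 < t) (k : Fin d) (z : Space d) :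
    |gaussDeriv k t z| ≤ slopeConst d / Real.sqrt t * gauss (2 * t) z := by
  refine le_trans ?_ (norm_mul_gauss_le ht z)
  unfold gaussDeriv
  rw [abs_mul, abs_of_nonneg (gauss_nonneg t z), abs_neg, abs_div,
    abs_of_pos (by positivity : 0 < 2 * t)]
  gcongr
  · exact gauss_nonneg t z
  · exact PiLp.norm_apply_le z k

lemma integrable_gaussDeriv {t : ℝ} (ht : 0 < t) (k : Fin d) :
    Integrable fun z : Space d => gaussDeriv k t z :=
  ((integrable_gauss (by positivity : 0 < 2 * t)).const_mul (slopeConst d / Real.sqrt t)).mono'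
    (by fun_prop) (ae_of_all _ fun z => abs_gaussDeriv_le ht k z)

/-! ### The modulus of continuity of the heat kernel -/

lemma hasDerivAt_gauss_segment (t : ℝ) (x v : Space d) (θ : ℝ) :
    HasDerivAt (fun θ : ℝ => gauss t (x - θ • v))
      (inner ℝ (x - θ • v) v / (2 * t) * gauss t (x - θ • v)) θ := by
  have h1 : HasDerivAt (fun θ : ℝ => x - θ • v) (-v) θ := by
    simpa using ((hasDerivAt_id θ).smul_const v).const_sub x
  simpa [inner_neg_right, neg_div] using hasDerivAt_gauss_path t h1

lemma abs_gauss_segment_deriv_le {t : ℝ} (ht : 0 < t) (y v : Space d) :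
    |inner ℝ y v / (2 * t) * gauss t y|
      ≤ slopeConst d / Real.sqrt t * ‖v‖ * gauss (2 * t) y := by
  have hg := gauss_nonneg t y
  rw [abs_mul, abs_of_nonneg hg, abs_div, abs_of_pos (by positivity : 0 < 2 * t)]
  calc |inner ℝ y v| / (2 * t) * gauss t y ≤ ‖y‖ * ‖v‖ / (2 * t) * gauss t y := by
        gcongr; exact abs_real_inner_le_norm y v
    _ = ‖v‖ * (‖y‖ / (2 * t) * gauss t y) := by ring
    _ ≤ ‖v‖ * (slopeConst d / Real.sqrt t * gauss (2 * t) y) := by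
        exact mul_le_mul_of_nonneg_left (norm_mul_gauss_le ht y) (norm_nonneg v)
    _ = _ := by ring

/-- Interpolation: the difference is bounded by a constant and by a multiple of `‖v‖`, hence by the
geometric mean of the two. The exponent `1/2` is chosen below `1` because `‖z‖` times
`|(z,s)|^{-(d+1)}` is not integrable on `ℝ^d`, while `‖z‖^{1/2}` times it is. -/
lemma abs_gauss_sub_le_pointwise {t : ℝ} (ht : 0 < t) :
    ∃ C : ℝ, 0 ≤ C ∧ ∀ x v : Space d, |gauss t (x - v) - gauss t x| ≤ C * ‖v‖ ^ (1 / 2 : ℝ) := by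
  set S : ℝ := 1 / Real.sqrt (4 * Real.pi * t) ^ d with hS
  set S' : ℝ := slopeConst d / Real.sqrt t * (1 / Real.sqrt (4 * Real.pi * (2 * t)) ^ d) with hS'
  have hc := slopeConst_pos (d := d)
  have hS0 : 0 ≤ S := by positivity
  have hS'0 : 0 ≤ S' := by positivity
  refine ⟨Real.sqrt (2 * S * S'), by positivity, fun x v => ?_⟩
  have h1 : |gauss t (x - v) - gauss t x| ≤ 2 * S := by
    have a1 := gauss_le_sup t ht (x - v)
    have a2 := gauss_le_sup t ht x
    have a3 := gauss_nonneg t (x - v)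
    have a4 := gauss_nonneg t x
    rw [abs_le]; constructor <;> linarith
  have h2 : |gauss t (x - v) - gauss t x| ≤ S' * ‖v‖ := by
    have := norm_image_sub_le_of_norm_deriv_le_segment' (a := (0 : ℝ)) (b := 1) (C := S' * ‖v‖)
      (f := fun θ : ℝ => gauss t (x - θ • v)) (fun θ _ =>
        (hasDerivAt_gauss_segment t x v θ).hasDerivWithinAt) (fun θ _ => ?_) 1 (by simp)
    · simpa using this
    · refine (abs_gauss_segment_deriv_le ht _ v).trans ?_
      have := gauss_le_sup (2 * t) (by positivity) (x - θ • v)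
      calc slopeConst d / Real.sqrt t * ‖v‖ * gauss (2 * t) (x - θ • v)
          ≤ slopeConst d / Real.sqrt t * ‖v‖ * (1 / Real.sqrt (4 * Real.pi * (2 * t)) ^ d) := by
            gcongr
        _ = S' * ‖v‖ := by rw [hS']; ring
  rw [← Real.sqrt_eq_rpow, ← Real.sqrt_mul (by positivity)]
  refine Real.le_sqrt_of_sq_le ?_
  rw [sq, mul_assoc (2 * S)]
  exact mul_le_mul h1 h2 (abs_nonneg _) (by positivity)

/-- The same interpolation in `L¹`: the norm is at most `2` because `gauss` has mass one, and at
most `slopeConst d * ‖v‖ / √t` by integrating the gradient along a segment. The geometric mean of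
the two gives the factor `t^{-1/4}`. -/
lemma lintegral_gauss_sub_le {t : ℝ} (ht : 0 < t) (v : Space d) :
    ∫⁻ x : Space d, ‖gauss t (x - v) - gauss t x‖ₑ
      ≤ ENNReal.ofReal (Real.sqrt (2 * slopeConst d) * ‖v‖ ^ (1 / 2 : ℝ) * t ^ (-(1 / 4) : ℝ)) := by
  have hc := slopeConst_pos (d := d)
  have hs : 0 < Real.sqrt t := Real.sqrt_pos.2 ht
  have ht2 : 0 < 2 * t := by positivity
  have h1 : ∫⁻ x : Space d, ‖gauss t (x - v) - gauss t x‖ₑ ≤ ENNReal.ofReal 2 := by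
    calc ∫⁻ x : Space d, ‖gauss t (x - v) - gauss t x‖ₑ
        ≤ ∫⁻ x : Space d, (ENNReal.ofReal (gauss t (x - v)) + ENNReal.ofReal (gauss t x)) := by
          refine lintegral_mono fun x => ?_
          refine enorm_sub_le.trans ?_
          rw [Real.enorm_of_nonneg (gauss_nonneg _ _), Real.enorm_of_nonneg (gauss_nonneg _ _)]
      _ = 1 + 1 := by
          rw [lintegral_add_right _ (by fun_prop),
            lintegral_sub_right_eq_self (fun x : Space d => ENNReal.ofReal (gauss t x)) v,
            lintegral_gauss ht]
      _ = _ := by norm_num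
  have h2 : ∫⁻ x : Space d, ‖gauss t (x - v) - gauss t x‖ₑ
      ≤ ENNReal.ofReal (slopeConst d / Real.sqrt t * ‖v‖) := by
    have hcont : ∀ x : Space d, Continuous fun θ : ℝ =>
        inner ℝ (x - θ • v) v / (2 * t) * gauss t (x - θ • v) := fun x => by fun_prop
    -- The difference is the integral of the derivative along `x - θ v`. Tonelli and translation
    -- invariance then leave only the mass of `gauss (2 * t)`, which is one.
    calc ∫⁻ x : Space d, ‖gauss t (x - v) - gauss t x‖ₑ
        ≤ ∫⁻ x : Space d, ∫⁻ θ in Ioc (0 : ℝ) 1,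
            ENNReal.ofReal (slopeConst d / Real.sqrt t * ‖v‖)
              * ENNReal.ofReal (gauss (2 * t) (x - θ • v)) := by
          refine lintegral_mono fun x => ?_
          have := intervalIntegral.integral_eq_sub_of_hasDerivAt (a := 0) (b := 1)
            (fun θ _ => hasDerivAt_gauss_segment t x v θ) ((hcont x).intervalIntegrable 0 1)
          simp only [one_smul, zero_smul, sub_zero] at this
          rw [← this, intervalIntegral.integral_of_le zero_le_one]
          refine (enorm_integral_le_lintegral_enorm _).trans (lintegral_mono fun θ => ?_)
          rw [← ENNReal.ofReal_mul (by positivity), Real.enorm_eq_ofReal_abs]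
          exact ENNReal.ofReal_le_ofReal (abs_gauss_segment_deriv_le ht _ v)
      _ = ∫⁻ θ in Ioc (0 : ℝ) 1, ∫⁻ x : Space d,
            ENNReal.ofReal (slopeConst d / Real.sqrt t * ‖v‖)
              * ENNReal.ofReal (gauss (2 * t) (x - θ • v)) := by
          refine lintegral_lintegral_swap ?_
          refine Measurable.aemeasurable ?_
          simp only [Function.uncurry_def]
          fun_prop
      _ = ∫⁻ θ in Ioc (0 : ℝ) 1, ENNReal.ofReal (slopeConst d / Real.sqrt t * ‖v‖) := by
          refine lintegral_congr fun θ => ?_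
          rw [lintegral_const_mul _ (by fun_prop),
            lintegral_sub_right_eq_self (fun x : Space d => ENNReal.ofReal (gauss (2 * t) x)) (θ • v),
            lintegral_gauss ht2, mul_one]
      _ = _ := by simp
  have hne : ∫⁻ x : Space d, ‖gauss t (x - v) - gauss t x‖ₑ ≠ ⊤ :=
    (h1.trans_lt ENNReal.ofReal_lt_top).ne
  rw [← ENNReal.ofReal_toReal hne]
  refine ENNReal.ofReal_le_ofReal ?_
  have a1 := ENNReal.toReal_le_of_le_ofReal zero_le_two h1
  have a2 := ENNReal.toReal_le_of_le_ofReal (by positivity) h2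
  have e : t ^ (-(1 / 4) : ℝ) = Real.sqrt (1 / Real.sqrt t) := by
    rw [Real.sqrt_eq_rpow, Real.sqrt_eq_rpow, one_div (t ^ (1 / 2 : ℝ)), ← Real.rpow_neg ht.le,
      ← Real.rpow_mul ht.le]
    norm_num
  rw [e, ← Real.sqrt_eq_rpow, ← Real.sqrt_mul (by positivity), ← Real.sqrt_mul (by positivity)]
  refine Real.le_sqrt_of_sq_le ?_
  calc _ ≤ 2 * (slopeConst d / Real.sqrt t * ‖v‖) := by
        rw [sq]
        exact mul_le_mul a1 a2 ENNReal.toReal_nonneg zero_le_two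
    _ = _ := by ring

/-! ### Integrals of powers of the distance -/

/-- Homogeneity under `(w, 1) ↦ (s w, s)`; every integral over the plane `x_n = s` reduces by it to
the plane `x_n = 1`. -/
lemma radialPow_smul (m : ℝ) (w : Space d) {s : ℝ} (hs : 0 < s) :
    radialPow m (s • w) s = s ^ (-m) * radialPow m w 1 := by
  unfold radialPow
  rw [norm_smul, Real.norm_of_nonneg hs.le,
    show (s * ‖w‖) ^ 2 + s ^ 2 = s ^ 2 * (‖w‖ ^ 2 + 1 ^ 2) by ring,
    Real.mul_rpow (by positivity) (by positivity), ← Real.rpow_natCast, ← Real.rpow_mul hs.le]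
  congr 2; push_cast; ring

lemma integrable_radialPow_one {m : ℝ} (hm : (d : ℝ) < m) :
    Integrable fun z : Space d => radialPow m z 1 := by
  have := integrable_rpow_neg_one_add_norm_sq (E := Space d) (μ := volume) (r := m) (by simpa using hm)
  unfold radialPow
  refine this.congr (ae_of_all _ fun z => ?_)
  simp only [one_pow, neg_div]
  rw [add_comm]

lemma integrable_of_comp_smul {f : Space d → ℝ} {s : ℝ} (hs : 0 < s)
    (h : Integrable fun w => f (s • w)) : Integrable f :=
  (integrable_comp_smul_iff volume f hs.ne').1 h

lemma integral_eq_comp_smul (f : Space d → ℝ) {s : ℝ} (hs : 0 < s) :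
    ∫ z, f z = s ^ (d : ℝ) * ∫ w, f (s • w) := by
  rw [Measure.integral_comp_smul_of_nonneg volume f s (hR := hs.le), finrank_euclideanSpace,
    Fintype.card_fin, Real.rpow_natCast, smul_eq_mul, mul_inv_cancel_left₀ (by positivity)]

lemma integrable_radialPow {m s : ℝ} (hm : (d : ℝ) < m) (hs : 0 < s) :
    Integrable fun z : Space d => radialPow m z s := by
  refine integrable_of_comp_smul hs ?_
  simp only [radialPow_smul m _ hs]
  exact (integrable_radialPow_one hm).const_mul _

/-- The integral of `|z|^{1/2} (|z|^2 + 1)^{-(d+1)/2}`. -/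
def halfMoment (d : ℕ) : ℝ := ∫ w : Space d, ‖w‖ ^ (1 / 2 : ℝ) * radialPow (d + 1) w 1

lemma measurable_radialPow_left (m s : ℝ) : Measurable fun z : Space d => radialPow m z s := by
  unfold radialPow; fun_prop

/-- The factor `‖w‖^{1/2}` lowers the decay exponent from `d + 1` to `d + 1/2`, which still exceeds
the dimension `d`. -/
lemma integrable_halfMoment_one :
    Integrable fun w : Space d => ‖w‖ ^ (1 / 2 : ℝ) * radialPow (d + 1) w 1 := by
  refine (integrable_radialPow_one (d := d) (m := d + 1 / 2) (by linarith)).mono' ?_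
    (ae_of_all _ fun w => ?_)
  · have := measurable_radialPow_left (d := d) (d + 1) 1
    exact Measurable.aestronglyMeasurable (by fun_prop)
  · rw [Real.norm_of_nonneg (mul_nonneg (by positivity) (radialPow_nonneg _ _ _))]
    have h1 : ‖w‖ ^ (1 / 2 : ℝ) ≤ (‖w‖ ^ 2 + 1 ^ 2) ^ (1 / 4 : ℝ) := by
      calc ‖w‖ ^ (1 / 2 : ℝ) = (‖w‖ ^ 2) ^ (1 / 4 : ℝ) := by
            rw [← Real.rpow_natCast, ← Real.rpow_mul (norm_nonneg _)]; norm_num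
        _ ≤ _ := by gcongr; simp
    refine (mul_le_mul_of_nonneg_right h1 (radialPow_nonneg _ _ _)).trans_eq ?_
    unfold radialPow
    rw [← Real.rpow_add (by positivity)]
    congr 1; ring

lemma halfMoment_comp_smul {s : ℝ} (hs : 0 < s) (w : Space d) :
    ‖s • w‖ ^ (1 / 2 : ℝ) * radialPow (d + 1) (s • w) s
      = s ^ (1 / 2 - (d + 1) : ℝ) * (‖w‖ ^ (1 / 2 : ℝ) * radialPow (d + 1) w 1) := by
  rw [radialPow_smul _ _ hs, norm_smul, Real.norm_of_nonneg hs.le,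
    Real.mul_rpow hs.le (norm_nonneg _), sub_eq_add_neg, Real.rpow_add hs]
  ring

lemma integrable_halfMoment {s : ℝ} (hs : 0 < s) :
    Integrable fun z : Space d => ‖z‖ ^ (1 / 2 : ℝ) * radialPow (d + 1) z s := by
  refine integrable_of_comp_smul hs ?_
  simp only [halfMoment_comp_smul hs]
  exact integrable_halfMoment_one.const_mul _

lemma integral_halfMoment {s : ℝ} (hs : 0 < s) :
    ∫ z : Space d, ‖z‖ ^ (1 / 2 : ℝ) * radialPow (d + 1) z s
      = halfMoment d * s ^ (-(1 / 2) : ℝ) := by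
  rw [integral_eq_comp_smul _ hs]
  simp only [halfMoment_comp_smul hs]
  rw [integral_const_mul, ← mul_assoc, ← Real.rpow_add hs, mul_comm]
  unfold halfMoment
  congr 2; ring

lemma halfMoment_nonneg : 0 ≤ halfMoment d :=
  integral_nonneg fun w => mul_nonneg (by positivity) (radialPow_nonneg _ _ _)

/-- The mass of the normal derivative of the Laplace kernel on horizontal hyperplanes. -/
def layerMass (d : ℕ) : ℝ := ∫ w : Space d, gradE (Fin.last d) w 1

/-- The homogeneity degree `-d` cancels the Jacobian `s^d`, so the mass of `D_n E(·, s)` is the same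
on all planes; this makes it an approximate identity as `s → 0`. -/
lemma gradE_last_smul {s : ℝ} (hs : 0 < s) (w : Space d) :
    gradE (Fin.last d) (s • w) s = s ^ (-d : ℝ) * gradE (Fin.last d) w 1 := by
  unfold gradE
  rw [radialPow_smul _ _ hs, pt_last, pt_last, neg_add, Real.rpow_add hs, Real.rpow_neg_one]
  field_simp

lemma integrable_gradE_last_one : Integrable fun w : Space d => gradE (Fin.last d) w 1 := by
  unfold gradE
  simp only [pt_last, one_mul]
  exact (integrable_radialPow_one (by linarith)).const_mul _

lemma integrable_gradE_last {s : ℝ} (hs : 0 < s) :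
    Integrable fun z : Space d => gradE (Fin.last d) z s := by
  refine integrable_of_comp_smul hs ?_
  simp only [gradE_last_smul hs]
  exact integrable_gradE_last_one.const_mul _

lemma gradE_last_nonneg {s : ℝ} (hs : 0 < s) (z : Space d) : 0 ≤ gradE (Fin.last d) z s := by
  have := sphereArea_pos (d := d)
  have := radialPow_nonneg (d + 1) z s
  unfold gradE
  rw [pt_last]
  positivity

lemma integral_gradE_last {s : ℝ} (hs : 0 < s) :
    ∫ z : Space d, gradE (Fin.last d) z s = layerMass d := by
  rw [integral_eq_comp_smul _ hs]
  simp only [gradE_last_smul hs]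
  rw [integral_const_mul, ← mul_assoc, ← Real.rpow_add hs]
  simp [layerMass]

lemma layerMass_nonneg : 0 ≤ layerMass d := integral_nonneg fun w => gradE_last_nonneg one_pos w

/-! ### Singular convolutions -/

lemma radialPow_zero_right (p : ℝ) (z : Space d) : radialPow p z 0 = ‖z‖ ^ (-p) := by
  unfold radialPow
  rw [zero_pow two_ne_zero, add_zero, ← Real.rpow_natCast, ← Real.rpow_mul (norm_nonneg _)]
  congr 1; push_cast; ring

lemma integrableOn_radialPow_zero (hd : 2 ≤ d) {p : ℝ} (hp : p < d) :
    IntegrableOn (fun z : Space d => radialPow p z 0) (Metric.ball 0 1) := by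
  refine integrableOn_ball_of_norm_le_rpow (C := 1) (α := p) (by simp; omega) (by simpa using hp)
    (ae_of_all _ fun z => ?_) (measurable_radialPow_left p 0).aestronglyMeasurable
  rw [Real.norm_of_nonneg (radialPow_nonneg _ _ _), radialPow_zero_right, one_mul]

lemma singular_bound {Φ : Space d → ℝ} {S p : ℝ} (hp0 : 0 ≤ p)
    (hΦ0 : ∀ z, 0 ≤ Φ z) (hΦS : ∀ z, Φ z ≤ S) (x z : Space d) :
    Φ (x - z) * radialPow p z 0
      ≤ S * (Metric.ball 0 1).indicator (fun z : Space d => radialPow p z 0) z + Φ (x - z) := by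
  have h0 := radialPow_nonneg p z 0
  by_cases hz : z ∈ Metric.ball (0 : Space d) 1
  · rw [indicator_of_mem hz]
    exact le_add_of_le_of_nonneg (mul_le_mul_of_nonneg_right (hΦS _) h0) (hΦ0 _)
  · rw [indicator_of_notMem hz, mul_zero, zero_add]
    refine mul_le_of_le_one_right (hΦ0 _) ?_
    rw [radialPow_zero_right]
    have : 1 ≤ ‖z‖ := by simpa using hz
    exact Real.rpow_le_one_of_one_le_of_nonpos this (by linarith)

/-- Inside the unit ball the density is at most `S` and the singularity `‖z‖^{-p}` is integrable
because `p < d`; outside the ball the singularity is at most one. Both bounds are uniform in `x`. -/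
lemma singular_convolution (hd : 2 ≤ d) {Φ : Space d → ℝ} {S p : ℝ} (hp : p < d) (hp0 : 0 ≤ p)
    (hΦ0 : ∀ z, 0 ≤ Φ z) (hΦS : ∀ z, Φ z ≤ S) (hΦ : Integrable Φ) :
    ∃ C : ℝ, 0 ≤ C ∧ ∀ x, Integrable (fun z => Φ (x - z) * radialPow p z 0) ∧
      ∫ z, Φ (x - z) * radialPow p z 0 ≤ C := by
  have h1 := (integrableOn_radialPow_zero hd hp).integrable_indicator measurableSet_ball
  have hS : 0 ≤ S := (hΦ0 0).trans (hΦS 0)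
  have hdom : ∀ x, Integrable fun z =>
      S * (Metric.ball 0 1).indicator (fun z : Space d => radialPow p z 0) z + Φ (x - z) :=
    fun x => (h1.const_mul S).add (hΦ.comp_sub_left x)
  have hint : ∀ x, Integrable (fun z => Φ (x - z) * radialPow p z 0) := fun x => by
    refine (hdom x).mono' ((hΦ.comp_sub_left x).aestronglyMeasurable.mul
      (measurable_radialPow_left p 0).aestronglyMeasurable) (ae_of_all _ fun z => ?_)
    rw [Real.norm_of_nonneg (mul_nonneg (hΦ0 _) (radialPow_nonneg _ _ _))]
    exact singular_bound hp0 hΦ0 hΦS x z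
  refine ⟨S * (∫ z, (Metric.ball 0 1).indicator (fun z : Space d => radialPow p z 0) z)
    + ∫ z, Φ z, ?_, fun x => ⟨hint x, ?_⟩⟩
  · refine add_nonneg (mul_nonneg hS (integral_nonneg fun z => ?_)) (integral_nonneg hΦ0)
    exact indicator_nonneg (fun z _ => radialPow_nonneg _ _ _) z
  · refine (integral_mono (hint x) (hdom x) fun z => singular_bound hp0 hΦ0 hΦS x z).trans_eq ?_
    rw [integral_add (h1.const_mul S) (hΦ.comp_sub_left x), integral_const_mul,
      integral_sub_left_eq_self Φ volume x]

/-! ### The second derivatives of the Laplace kernel have mean value zero -/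

lemma measurable_hessE_left (i : Fin (d + 1)) (j : Fin d) (s : ℝ) :
    Measurable fun z : Space d => hessE i j z s := by
  exact Measurable.of_uncurry_right (f := fun z s => hessE i j z s) (measurable_hessE i j)

lemma measurable_gradE_left (i : Fin (d + 1)) (s : ℝ) :
    Measurable fun z : Space d => gradE i z s :=
  (measurable_gradE i).comp (by fun_prop : Measurable fun z : Space d => (z, s))

lemma integrable_hessE (i : Fin (d + 1)) (j : Fin d) {s : ℝ} (hs : 0 < s) :
    Integrable fun z : Space d => hessE i j z s :=
  ((integrable_radialPow (by linarith) hs).const_mul _).mono'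
    (measurable_hessE_left i j s).aestronglyMeasurable
    (ae_of_all _ fun z => abs_hessE_le i j z hs)

lemma radialPow_le {m : ℝ} (hm : 0 ≤ m) (z : Space d) {s : ℝ} (hs : 0 < s) :
    radialPow m z s ≤ s ^ (-m) := by
  have : s ^ (-m) = (s ^ 2) ^ (-(m / 2)) := by
    rw [← Real.rpow_natCast, ← Real.rpow_mul hs.le]; congr 1; push_cast; ring
  rw [this]
  exact Real.rpow_le_rpow_of_nonpos (by positivity) (by simp) (by linarith)

/-- A derivative should integrate to zero, but its primitive `gradE` may decay only like `|z|^{-d}`,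
which is not integrable. Hence integration by parts is carried out against the cutoff `exp(-b
‖z‖^2)`, and `b → 0` is taken by dominated convergence on both sides. -/
lemma integral_hessE (i : Fin (d + 1)) (j : Fin d) {s : ℝ} (hs : 0 < s) :
    ∫ z : Space d, hessE i j z s = 0 := by
  set f : ℝ → Space d → ℝ := fun b z => Real.exp (-b * ‖z‖ ^ 2) with hf
  set f' : ℝ → Space d → ℝ := fun b z => -(2 * b * z j) * Real.exp (-b * ‖z‖ ^ 2) with hf'
  have hω := sphereArea_pos (d := d)
  set K : ℝ := 2 * (1 + s ^ 2) * (sphereArea (d + 1))⁻¹ with hK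
  -- The derivative of the cutoff supplies `b z_j`, and `b (‖z‖^2 + s^2) exp(-b ‖z‖^2)` stays
  -- bounded by `1 + s^2`. This yields an integrable majorant independent of `b`.
  have hdom : ∀ b : ℝ, 0 < b → b ≤ 1 → ∀ z : Space d,
      |f' b z * gradE i z s| ≤ K * radialPow (d + 1) z s := by
    intro b hb hb1 z
    have hR := radialPow_nonneg (d + 1) z s
    have e1 : |z j| * |pt z s i| ≤ ‖z‖ ^ 2 + s ^ 2 := by
      rw [← Real.mul_self_sqrt (sum_sq_pos z hs).le]
      gcongr
      · simpa using abs_pt_le z s j.castSucc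
      · exact abs_pt_le z s i
    have e2 : b * (‖z‖ ^ 2 + s ^ 2) * Real.exp (-b * ‖z‖ ^ 2) ≤ 1 + s ^ 2 := by
      have a1 : b * ‖z‖ ^ 2 * Real.exp (-b * ‖z‖ ^ 2) ≤ 1 := by
        rw [neg_mul, Real.exp_neg, ← div_eq_mul_inv, div_le_one (Real.exp_pos _)]
        linarith [Real.add_one_le_exp (b * ‖z‖ ^ 2)]
      have a2 : b * s ^ 2 * Real.exp (-b * ‖z‖ ^ 2) ≤ s ^ 2 := by
        have : Real.exp (-b * ‖z‖ ^ 2) ≤ 1 :=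
          Real.exp_le_one_iff.2 (by rw [neg_mul]; exact neg_nonpos.2 (by positivity))
        calc b * s ^ 2 * Real.exp (-b * ‖z‖ ^ 2) ≤ 1 * s ^ 2 * 1 := by gcongr
          _ = s ^ 2 := by ring
      linarith
    calc |f' b z * gradE i z s|
        = 2 * (b * (|z j| * |pt z s i|) * Real.exp (-b * ‖z‖ ^ 2)) * (sphereArea (d + 1))⁻¹
            * radialPow (d + 1) z s := by
          simp only [hf', gradE, abs_mul, abs_neg, abs_of_pos hb, abs_of_pos (inv_pos.2 hω),
            abs_of_nonneg hR, abs_of_pos (Real.exp_pos _), abs_of_pos (zero_lt_two (α := ℝ))]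
          ring
      _ ≤ 2 * (b * (‖z‖ ^ 2 + s ^ 2) * Real.exp (-b * ‖z‖ ^ 2)) * (sphereArea (d + 1))⁻¹
            * radialPow (d + 1) z s := by gcongr
      _ ≤ 2 * (1 + s ^ 2) * (sphereArea (d + 1))⁻¹ * radialPow (d + 1) z s := by gcongr
      _ = _ := by rw [hK]
  have hR := (integrable_radialPow (d := d) (m := d + 1) (by linarith) hs)
  have hle : ∀ b : ℝ, 0 < b → ∀ z : Space d, f b z ≤ 1 := fun b hb z =>
    Real.exp_le_one_iff.2 (by rw [neg_mul]; exact neg_nonpos.2 (by positivity))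
  have hmeas : ∀ b, Measurable (f b) := fun b => by simp only [hf]; fun_prop
  have hmeas' : ∀ b, Measurable (f' b) := fun b => by simp only [hf']; fun_prop
  have hmg := measurable_gradE_left i (d := d) s
  have hmh := measurable_hessE_left i j s
  have hibp : ∀ b : ℝ, 0 < b → b ≤ 1 →
      ∫ z, f b z * hessE i j z s = -∫ z, f' b z * gradE i z s := by
    intro b hb hb1
    refine integral_bilinear_hasLineDerivAt_right_eq_neg_left_of_integrable
      (B := ContinuousLinearMap.mul ℝ ℝ) (v := EuclideanSpace.single j (1 : ℝ)) ?_ ?_ ?_ ?_ ?_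
    · exact (hR.const_mul K).mono' ((hmeas' b).mul hmg).aestronglyMeasurable
        (ae_of_all _ fun z => hdom b hb hb1 z)
    · refine (integrable_hessE i j hs).norm.mono' ((hmeas b).mul hmh).aestronglyMeasurable
        (ae_of_all _ fun z => ?_)
      simp only [ContinuousLinearMap.mul_apply', norm_mul]
      refine mul_le_of_le_one_left (norm_nonneg _) ?_
      rw [Real.norm_of_nonneg (Real.exp_pos _).le]
      exact hle b hb z
    · have hfi : Integrable (f b) := by
        have := (integrable_gauss (d := d) (show 0 < 1 / (4 * b) by positivity)).const_mul
          (Real.sqrt (4 * Real.pi * (1 / (4 * b))) ^ d)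
        refine this.congr (ae_of_all _ fun z => ?_)
        have h4 : 0 < Real.sqrt (4 * Real.pi * (1 / (4 * b))) := by positivity
        simp only [gauss, hf]
        rw [← mul_assoc, mul_one_div_cancel (by positivity), one_mul]
        congr 1
        field_simp
      refine (hfi.mul_const ((sphereArea (d + 1))⁻¹ * s ^ (-d : ℝ))).mono'
        ((hmeas b).mul hmg).aestronglyMeasurable (ae_of_all _ fun z => ?_)
      simp only [ContinuousLinearMap.mul_apply', norm_mul]
      rw [Real.norm_of_nonneg (Real.exp_pos _).le]
      refine mul_le_mul_of_nonneg_left ?_ (Real.exp_pos _).le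
      refine (abs_gradE_le i z hs).trans ?_
      gcongr
      exact radialPow_le (by positivity) z hs
    · intro z _
      have := ((hasDerivAt_norm_sq_line z j 0).const_mul (-b)).exp
      unfold HasLineDerivAt
      refine this.congr_deriv ?_
      simp only [hf', zero_smul, add_zero]
      ring
    · intro z _
      simpa [HasLineDerivAt] using hasDerivAt_gradE_line i z hs j 0
  have hev : ∀ᶠ b : ℝ in 𝓝[>] 0, 0 < b ∧ b ≤ 1 := by
    filter_upwards [Ioc_mem_nhdsGT (zero_lt_one (α := ℝ))] with b hb using hb
  have lim1 : Tendsto (fun b => ∫ z, f b z * hessE i j z s) (𝓝[>] 0)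
      (𝓝 (∫ z, hessE i j z s)) := by
    refine tendsto_integral_filter_of_dominated_convergence (fun z => ‖hessE i j z s‖)
      (Eventually.of_forall fun b => ((hmeas b).mul hmh).aestronglyMeasurable) ?_
      (integrable_hessE i j hs).norm (ae_of_all _ fun z => ?_)
    · filter_upwards [hev] with b hb
      refine ae_of_all _ fun z => ?_
      rw [norm_mul]
      refine mul_le_of_le_one_left (norm_nonneg _) ?_
      rw [Real.norm_of_nonneg (Real.exp_pos _).le]
      exact hle b hb.1 z
    · have : Continuous fun b : ℝ => f b z * hessE i j z s := by simp only [hf]; fun_prop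
      simpa [hf] using (this.tendsto 0).mono_left nhdsWithin_le_nhds
  have lim2 : Tendsto (fun b => -∫ z, f' b z * gradE i z s) (𝓝[>] 0) (𝓝 0) := by
    have : Tendsto (fun b => ∫ z, f' b z * gradE i z s) (𝓝[>] 0)
        (𝓝 (∫ z : Space d, (0 : ℝ))) := by
      refine tendsto_integral_filter_of_dominated_convergence (fun z => K * radialPow (d + 1) z s)
        (Eventually.of_forall fun b => ((hmeas' b).mul hmg).aestronglyMeasurable) ?_
        (hR.const_mul K) (ae_of_all _ fun z => ?_)
      · filter_upwards [hev] with b hb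
        exact ae_of_all _ fun z => hdom b hb.1 hb.2 z
      · have : Continuous fun b : ℝ => f' b z * gradE i z s := by simp only [hf']; fun_prop
        simpa [hf'] using (this.tendsto 0).mono_left nhdsWithin_le_nhds
    simpa using this.neg
  refine tendsto_nhds_unique lim1 (lim2.congr' ?_)
  filter_upwards [hev] with b hb using (hibp b hb.1 hb.2).symm

/-! ### Heat flow of the derivatives of the Laplace kernel -/

/-- The heat flow of `D_i E(·, s)` on the boundary. -/
def convGrad (i : Fin (d + 1)) (t s : ℝ) (x : Space d) : ℝ :=
  ∫ z : Space d, gauss t (x - z) * gradE i z s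

/-- The heat flow of `D_i D_j E(·, s)` on the boundary. -/
def convHess (i : Fin (d + 1)) (j : Fin d) (t s : ℝ) (x : Space d) : ℝ :=
  ∫ z : Space d, gauss t (x - z) * hessE i j z s

lemma stronglyMeasurable_convHess (i : Fin (d + 1)) (j : Fin d) :
    StronglyMeasurable fun p : (Space d × ℝ) × ℝ => convHess i j p.1.2 p.2 p.1.1 := by
  unfold convHess
  refine StronglyMeasurable.integral_prod_right
    (f := fun (p : (Space d × ℝ) × ℝ) (z : Space d) => gauss p.1.2 (p.1.1 - z) * hessE i j z p.2) ?_
  refine Measurable.stronglyMeasurable ?_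
  have h1 : Measurable fun q : ((Space d × ℝ) × ℝ) × Space d => gauss q.1.1.2 (q.1.1.1 - q.2) :=
    measurable_gauss.comp
      (by fun_prop : Measurable fun q : ((Space d × ℝ) × ℝ) × Space d => (q.1.1.2, q.1.1.1 - q.2))
  have h2 : Measurable fun q : ((Space d × ℝ) × ℝ) × Space d => hessE i j q.2 q.1.2 := by
    have h3 : Measurable fun q : ((Space d × ℝ) × ℝ) × Space d => (q.2, q.1.2) := by fun_prop
    have := (measurable_hessE i j).comp h3
    simpa only [Function.comp_def] using this
  exact h1.mul h2

/-- The constant in the bound of the second derivatives of the Laplace kernel. -/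
def hessConst (d : ℕ) : ℝ := (sphereArea (d + 1))⁻¹ * (d + 2)

lemma hessConst_nonneg : 0 ≤ hessConst d := by
  have := sphereArea_pos (d := d)
  unfold hessConst; positivity

lemma integrable_gauss_mul_hessE {t s : ℝ} (ht : 0 < t) (hs : 0 < s) (i : Fin (d + 1)) (j : Fin d)
    (x : Space d) : Integrable fun z => gauss t (x - z) * hessE i j z s :=
  (integrable_hessE i j hs).bdd_mul (by fun_prop)
    (ae_of_all _ fun z => by
      rw [Real.norm_of_nonneg (gauss_nonneg _ _)]; exact gauss_le_sup t ht (x - z))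

/-- The mean value zero of `hessE` allows subtracting the value of the Gaussian at `z = 0`; without
this cancellation the bound in `s` would be `s^{-1}`, not integrable at zero. -/
lemma convHess_eq {t s : ℝ} (ht : 0 < t) (hs : 0 < s) (i : Fin (d + 1)) (j : Fin d) (x : Space d) :
    convHess i j t s x = ∫ z : Space d, (gauss t (x - z) - gauss t x) * hessE i j z s := by
  simp only [sub_mul]
  rw [integral_sub (integrable_gauss_mul_hessE ht hs i j x) ((integrable_hessE i j hs).const_mul _),
    integral_const_mul, integral_hessE i j hs, mul_zero, sub_zero]
  rfl

/-- The constant depends on `t`. The bound is purely qualitative: at fixed `t` it gives an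
integrable majorant in the normal variable for differentiating under the integral. -/
lemma abs_convHess_le {t : ℝ} (ht : 0 < t) :
    ∃ C : ℝ, 0 ≤ C ∧ ∀ (i : Fin (d + 1)) (j : Fin d) (s : ℝ) (x : Space d), 0 < s →
      |convHess i j t s x| ≤ C * s ^ (-(1 / 2) : ℝ) := by
  obtain ⟨C, hC, h⟩ := abs_gauss_sub_le_pointwise (d := d) ht
  refine ⟨C * hessConst d * halfMoment d,
    mul_nonneg (mul_nonneg hC hessConst_nonneg) halfMoment_nonneg, fun i j s x hs => ?_⟩
  rw [convHess_eq ht hs, ← Real.norm_eq_abs, mul_assoc _ (halfMoment d), ← integral_halfMoment hs,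
    ← integral_const_mul]
  refine norm_integral_le_of_norm_le ((integrable_halfMoment hs).const_mul _)
    (ae_of_all _ fun z => ?_)
  rw [norm_mul]
  calc ‖gauss t (x - z) - gauss t x‖ * ‖hessE i j z s‖
      ≤ (C * ‖z‖ ^ (1 / 2 : ℝ)) * (hessConst d * radialPow (d + 1) z s) := by
        gcongr
        · exact h x z
        · exact abs_hessE_le i j z hs
    _ = _ := by ring

/-- The constant in the `L¹` bound of `convHess`. -/
def flowConst (d : ℕ) : ℝ := Real.sqrt (2 * slopeConst d) * hessConst d * halfMoment d

lemma flowConst_nonneg : 0 ≤ flowConst d :=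
  mul_nonneg (mul_nonneg (Real.sqrt_nonneg _) hessConst_nonneg) halfMoment_nonneg

/-- The main quantitative estimate: the `L¹` modulus of the Gaussian contributes `‖z‖^{1/2}
t^{-1/4}`, and the moment of order `1/2` of `|(z,s)|^{-(d+1)}` contributes `s^{-1/2}` by scaling. -/
lemma lintegral_convHess_le {t s : ℝ} (ht : 0 < t) (hs : 0 < s) (i : Fin (d + 1)) (j : Fin d) :
    ∫⁻ x : Space d, ‖convHess i j t s x‖ₑ
      ≤ ENNReal.ofReal (flowConst d * t ^ (-(1 / 4) : ℝ) * s ^ (-(1 / 2) : ℝ)) := by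
  have hmh := measurable_hessE_left i j s
  calc ∫⁻ x : Space d, ‖convHess i j t s x‖ₑ
      ≤ ∫⁻ x : Space d, ∫⁻ z : Space d, ‖gauss t (x - z) - gauss t x‖ₑ * ‖hessE i j z s‖ₑ := by
        refine lintegral_mono fun x => ?_
        rw [convHess_eq ht hs]
        refine (enorm_integral_le_lintegral_enorm _).trans_eq ?_
        simp only [enorm_mul]
    _ = ∫⁻ z : Space d, ∫⁻ x : Space d, ‖gauss t (x - z) - gauss t x‖ₑ * ‖hessE i j z s‖ₑ := by
        refine lintegral_lintegral_swap (Measurable.aemeasurable ?_)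
        simp only [Function.uncurry_def]
        fun_prop
    _ = ∫⁻ z : Space d, (∫⁻ x : Space d, ‖gauss t (x - z) - gauss t x‖ₑ) * ‖hessE i j z s‖ₑ := by
        refine lintegral_congr fun z => ?_
        rw [lintegral_mul_const _ (by fun_prop)]
    _ ≤ ∫⁻ z : Space d, ENNReal.ofReal (Real.sqrt (2 * slopeConst d) * hessConst d
          * t ^ (-(1 / 4) : ℝ) * (‖z‖ ^ (1 / 2 : ℝ) * radialPow (d + 1) z s)) := by
        refine lintegral_mono fun z => ?_
        have h1 : ‖hessE i j z s‖ₑ ≤ ENNReal.ofReal (hessConst d * radialPow (d + 1) z s) := by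
          rw [Real.enorm_eq_ofReal_abs]
          exact ENNReal.ofReal_le_ofReal (abs_hessE_le i j z hs)
        refine (mul_le_mul' (lintegral_gauss_sub_le ht z) h1).trans_eq ?_
        rw [← ENNReal.ofReal_mul (by positivity)]
        congr 1; ring
    _ = _ := by
        rw [← ofReal_integral_eq_lintegral_ofReal ((integrable_halfMoment hs).const_mul _)
          (ae_of_all _ fun z => ?_), integral_const_mul, integral_halfMoment hs]
        · congr 1; unfold flowConst; ring
        · have := hessConst_nonneg (d := d)
          have := radialPow_nonneg (d + 1) z s
          exact mul_nonneg (by positivity) (by positivity)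

/-- The power `d` of the distance is split as `1/2 + (d - 1/2)`: the first part is bounded by means
of `s`, the second by means of `‖z‖`. Both factors are then locally integrable in their own
variable. -/
lemma abs_gradE_le_singular (i : Fin (d + 1)) {z : Space d} (hz : z ≠ 0) {s : ℝ} (hs : 0 < s) :
    |gradE i z s| ≤ (sphereArea (d + 1))⁻¹ * s ^ (-(1 / 2) : ℝ) * radialPow (d - 1 / 2) z 0 := by
  have hω := sphereArea_pos (d := d)
  refine (abs_gradE_le i z hs).trans ?_
  rw [mul_assoc]
  refine mul_le_mul_of_nonneg_left ?_ (inv_pos.2 hω).le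
  have hz' : 0 < ‖z‖ ^ 2 := by positivity
  have e1 : s ^ (-(1 / 2) : ℝ) = (s ^ 2) ^ (-(1 / 4) : ℝ) := by
    rw [← Real.rpow_natCast, ← Real.rpow_mul hs.le]; norm_num
  unfold radialPow
  rw [e1, show -((d : ℝ) / 2) = -(1 / 4) + -((d - 1 / 2) / 2) by ring,
    Real.rpow_add (sum_sq_pos z hs)]
  by_cases hd : d = 0
  · subst hd; exact absurd (Subsingleton.elim z 0) hz
  have hd1 : (1 : ℝ) ≤ d := by exact_mod_cast Nat.one_le_iff_ne_zero.2 hd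
  gcongr ?_ * ?_
  · exact Real.rpow_le_rpow_of_nonpos (by positivity) (by linarith) (by norm_num)
  · exact Real.rpow_le_rpow_of_nonpos (by positivity) (by simp [sq_nonneg]) (by linarith)

lemma ae_ne_zero (hd : 2 ≤ d) : ∀ᵐ z : Space d, z ≠ 0 := by
  have : Nonempty (Fin d) := ⟨⟨0, by omega⟩⟩
  exact Measure.ae_ne volume 0

lemma integrable_gauss_mul_gradE {t s : ℝ} (ht : 0 < t) (hs : 0 < s) (i : Fin (d + 1))
    (x : Space d) : Integrable fun z => gauss t (x - z) * gradE i z s := by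
  have hω := sphereArea_pos (d := d)
  refine Integrable.mul_bdd (c := (sphereArea (d + 1))⁻¹ * s ^ (-d : ℝ))
    ((integrable_gauss ht).comp_sub_left x)
    (measurable_gradE_left i s).aestronglyMeasurable (ae_of_all _ fun z => ?_)
  refine (abs_gradE_le i z hs).trans ?_
  gcongr
  exact radialPow_le (by positivity) z hs

lemma abs_convGrad_le (hd : 2 ≤ d) {t : ℝ} (ht : 0 < t) :
    ∃ C : ℝ, 0 ≤ C ∧ ∀ (i : Fin (d + 1)) (s : ℝ) (x : Space d), 0 < s →
      |convGrad i t s x| ≤ C * s ^ (-(1 / 2) : ℝ) := by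
  have hω := sphereArea_pos (d := d)
  have hd' : (2 : ℝ) ≤ d := by exact_mod_cast hd
  obtain ⟨C, hC, h⟩ := singular_convolution (d := d) (p := d - 1 / 2) hd (by linarith) (by linarith)
    (gauss_nonneg t) (gauss_le_sup t ht) (integrable_gauss ht)
  refine ⟨(sphereArea (d + 1))⁻¹ * C, by positivity, fun i s x hs => ?_⟩
  have h1 : |convGrad i t s x| ≤ ∫ z, (sphereArea (d + 1))⁻¹ * s ^ (-(1 / 2) : ℝ)
      * (gauss t (x - z) * radialPow (d - 1 / 2) z 0) := by
    rw [← Real.norm_eq_abs, convGrad]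
    refine norm_integral_le_of_norm_le ((h x).1.const_mul _) ?_
    filter_upwards [ae_ne_zero hd] with z hz
    rw [norm_mul, Real.norm_of_nonneg (gauss_nonneg _ _)]
    calc _ ≤ gauss t (x - z) * ((sphereArea (d + 1))⁻¹ * s ^ (-(1 / 2) : ℝ)
            * radialPow (d - 1 / 2) z 0) :=
          mul_le_mul_of_nonneg_left (abs_gradE_le_singular i hz hs) (gauss_nonneg _ _)
      _ = _ := by ring
  refine h1.trans ?_
  rw [integral_const_mul]
  calc _ ≤ (sphereArea (d + 1))⁻¹ * s ^ (-(1 / 2) : ℝ) * C := by gcongr; exact (h x).2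
    _ = _ := by ring

/-! ### Derivatives of the heat flow -/

/-- Moving the translation onto the Laplace kernel lets the tangential derivative fall on `gradE`,
whose derivatives are bounded for fixed `s > 0`. -/
lemma convGrad_comm (i : Fin (d + 1)) (t s : ℝ) (x : Space d) :
    convGrad i t s x = ∫ z : Space d, gauss t z * gradE i (x - z) s := by
  unfold convGrad
  rw [← integral_sub_left_eq_self (fun z => gauss t z * gradE i (x - z) s) volume x]
  simp

lemma convHess_comm (i : Fin (d + 1)) (j : Fin d) (t s : ℝ) (x : Space d) :
    convHess i j t s x = ∫ z : Space d, gauss t z * hessE i j (x - z) s := by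
  unfold convHess
  rw [← integral_sub_left_eq_self (fun z => gauss t z * hessE i j (x - z) s) volume x]
  simp

lemma abs_hessE_le_const (i : Fin (d + 1)) (j : Fin d) (z : Space d) {s : ℝ} (hs : 0 < s) :
    |hessE i j z s| ≤ hessConst d * s ^ (-(d + 1) : ℝ) := by
  refine (abs_hessE_le i j z hs).trans ?_
  have := hessConst_nonneg (d := d)
  exact mul_le_mul_of_nonneg_left (radialPow_le (by positivity) z hs) this

lemma hasDerivAt_convGrad_line {t s : ℝ} (ht : 0 < t) (hs : 0 < s) (i : Fin (d + 1)) (j : Fin d)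
    (x : Space d) (h : ℝ) :
    HasDerivAt (fun h : ℝ => convGrad i t s (x + h • EuclideanSpace.single j (1 : ℝ)))
      (convHess i j t s (x + h • EuclideanSpace.single j (1 : ℝ))) h := by
  simp only [convGrad_comm, convHess_comm]
  have hmg := measurable_gradE_left i (d := d) s
  have hmh := measurable_hessE_left i j s
  refine (hasDerivAt_integral_of_dominated_loc_of_deriv_le
    (F := fun h z => gauss t z * gradE i (x + h • EuclideanSpace.single j (1 : ℝ) - z) s)
    (F' := fun h z => gauss t z * hessE i j (x + h • EuclideanSpace.single j (1 : ℝ) - z) s)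
    (bound := fun z => gauss t z * (hessConst d * s ^ (-(d + 1) : ℝ)))
    univ_mem ?_ ?_ ?_ ?_ ?_ ?_).2
  · exact Eventually.of_forall fun h => ((continuous_gauss t).measurable.mul
      (hmg.comp (by fun_prop))).aestronglyMeasurable
  · have := (integrable_gauss_mul_gradE ht hs i
      (x + h • EuclideanSpace.single j (1 : ℝ))).comp_sub_left
        (x + h • EuclideanSpace.single j (1 : ℝ))
    simpa using this
  · exact ((continuous_gauss t).measurable.mul (hmh.comp (by fun_prop))).aestronglyMeasurable
  · refine ae_of_all _ fun z h _ => ?_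
    rw [norm_mul, Real.norm_of_nonneg (gauss_nonneg _ _)]
    exact mul_le_mul_of_nonneg_left (abs_hessE_le_const i j _ hs) (gauss_nonneg _ _)
  · exact (integrable_gauss ht).mul_const _
  · refine ae_of_all _ fun z h _ => HasDerivAt.const_mul _ ?_
    have := hasDerivAt_gradE_line i (x - z) hs j h
    have e : ∀ h : ℝ, x - z + h • EuclideanSpace.single j (1 : ℝ)
      = x + h • EuclideanSpace.single j (1 : ℝ) - z := fun h => by abel
    simpa only [e] using this

/-- Differentiation under the integral, dominated on `(s/2, ∞)`, where the derivative is at most `K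
(s/2)^{-(d+1)}`. The derivative `G` is left abstract to serve both the tangential and the normal
index. -/
lemma hasDerivAt_convGrad_normal_of {t s : ℝ} (ht : 0 < t) (hs : 0 < s) (i : Fin (d + 1))
    (x : Space d) {G : Space d → ℝ → ℝ} (hG : ∀ s, Measurable fun z => G z s) {K : ℝ}
    (hK : ∀ z s, 0 < s → |G z s| ≤ K * s ^ (-(d + 1) : ℝ)) (hK0 : 0 ≤ K)
    (hD : ∀ z s, 0 < s → HasDerivAt (fun s => gradE i z s) (G z s) s) :
    HasDerivAt (fun s : ℝ => convGrad i t s x) (∫ z, gauss t (x - z) * G z s) s := by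
  have hmg := measurable_gradE_left i (d := d)
  refine (hasDerivAt_integral_of_dominated_loc_of_deriv_le
    (F := fun s z => gauss t (x - z) * gradE i z s) (F' := fun s z => gauss t (x - z) * G z s)
    (bound := fun z => gauss t (x - z) * (K * (s / 2) ^ (-(d + 1) : ℝ)))
    (Ioi_mem_nhds (half_lt_self hs)) ?_ ?_ ?_ ?_ ?_ ?_).2
  · exact Eventually.of_forall fun s =>
      (Measurable.mul (by fun_prop) (hmg s)).aestronglyMeasurable
  · exact integrable_gauss_mul_gradE ht hs i x
  · exact (Measurable.mul (by fun_prop) (hG s)).aestronglyMeasurable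
  · refine ae_of_all _ fun z r hr => ?_
    have hr0 : 0 < s / 2 := by positivity
    rw [norm_mul, Real.norm_of_nonneg (gauss_nonneg _ _)]
    refine mul_le_mul_of_nonneg_left ((hK z r (hr0.trans hr)).trans ?_) (gauss_nonneg _ _)
    refine mul_le_mul_of_nonneg_left ?_ hK0
    exact Real.rpow_le_rpow_of_nonpos hr0 (le_of_lt hr) (by linarith [Nat.cast_nonneg (α := ℝ) d])
  · exact ((integrable_gauss ht).comp_sub_left x).mul_const _
  · exact ae_of_all _ fun z r hr => HasDerivAt.const_mul _
      (hD z r ((by positivity : 0 < s / 2).trans hr))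

lemma hasDerivAt_convGrad_castSucc {t s : ℝ} (ht : 0 < t) (hs : 0 < s) (k : Fin d) (x : Space d) :
    HasDerivAt (fun s : ℝ => convGrad k.castSucc t s x) (convHess (Fin.last d) k t s x) s :=
  hasDerivAt_convGrad_normal_of ht hs _ x (fun s => measurable_hessE_left _ _ s)
    (fun z _ hs => abs_hessE_le_const _ _ z hs) hessConst_nonneg
    (fun z _ hs => hasDerivAt_gradE_castSucc_normal k z hs)

lemma hasDerivAt_convGrad_last {t s : ℝ} (ht : 0 < t) (hs : 0 < s) (x : Space d) :
    HasDerivAt (fun s : ℝ => convGrad (Fin.last d) t s x)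
      (-∑ k : Fin d, convHess k.castSucc k t s x) s := by
  refine (hasDerivAt_convGrad_normal_of (K := d * hessConst d)
    (G := fun z s => -∑ k : Fin d, hessE k.castSucc k z s) ht hs _ x
    (fun s => ?_) (fun z s hs => ?_)
    (mul_nonneg (by positivity) hessConst_nonneg)
    (fun z _ hs => hasDerivAt_gradE_last_normal z hs)).congr_deriv ?_
  · exact (Finset.measurable_sum _ fun k _ => measurable_hessE_left _ _ s).neg
  · rw [abs_neg]
    refine (Finset.abs_sum_le_sum_abs _ _).trans
      ((Finset.sum_le_sum fun k _ => abs_hessE_le_const _ _ z hs).trans_eq ?_)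
    simp; ring
  · simp only [mul_neg, Finset.mul_sum]
    rw [integral_neg, integral_finsetSum _ fun k _ => integrable_gauss_mul_hessE ht hs _ _ x]
    rfl

/-! ### Boundary values of the heat flow -/

/-- The substitution `z = s w` turns `D_n E(·, s)` into a fixed integrable profile, so this is the
limit of an approximate identity of mass `layerMass d`. -/
lemma tendsto_convGrad_last {t : ℝ} (ht : 0 < t) (x : Space d) :
    Tendsto (fun s => convGrad (Fin.last d) t s x) (𝓝[>] 0) (𝓝 (layerMass d * gauss t x)) := by
  have h1 : Tendsto (fun s : ℝ => ∫ w, gauss t (x - s • w) * gradE (Fin.last d) w 1) (𝓝[>] 0)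
      (𝓝 (∫ w, gauss t x * gradE (Fin.last d) w 1)) := by
    refine tendsto_integral_filter_of_dominated_convergence
      (fun w => 1 / Real.sqrt (4 * Real.pi * t) ^ d * gradE (Fin.last d) w 1)
      (Eventually.of_forall fun s => (Measurable.mul (by fun_prop)
        (measurable_gradE_left _ 1)).aestronglyMeasurable) ?_
      (integrable_gradE_last_one.const_mul _) (ae_of_all _ fun w => ?_)
    · refine Eventually.of_forall fun s => ae_of_all _ fun w => ?_
      have := gradE_last_nonneg one_pos w
      rw [Real.norm_of_nonneg (mul_nonneg (gauss_nonneg _ _) this)]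
      exact mul_le_mul_of_nonneg_right (gauss_le_sup t ht _) this
    · have : Continuous fun s : ℝ => gauss t (x - s • w) * gradE (Fin.last d) w 1 := by fun_prop
      simpa using (this.tendsto 0).mono_left nhdsWithin_le_nhds
  rw [integral_const_mul, mul_comm] at h1
  refine h1.congr' ?_
  filter_upwards [self_mem_nhdsWithin] with s hs
  unfold convGrad
  rw [integral_eq_comp_smul (fun z => gauss t (x - z) * gradE (Fin.last d) z s) hs,
    ← integral_const_mul]
  refine integral_congr_ae (ae_of_all _ fun w => ?_)
  simp only [gradE_last_smul hs]
  rw [Real.rpow_neg (le_of_lt hs)]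
  have : 0 < s ^ (d : ℝ) := Real.rpow_pos_of_pos hs _
  field_simp

/-- The heat flow of `E(·, 0)` on the boundary, differentiated in a tangential direction. -/
def convLaplaceDeriv (k : Fin d) (t : ℝ) (x : Space d) : ℝ :=
  ∫ z : Space d, gaussDeriv k t (x - z) * laplaceKernel (pt z 0)

/-- The normalization of the Laplace kernel. -/
def laplaceConst (d : ℕ) : ℝ := (((d : ℝ) - 1) * sphereArea (d + 1))⁻¹

lemma laplaceConst_nonneg (hd : 2 ≤ d) : 0 ≤ laplaceConst d := by
  have := sphereArea_pos (d := d)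
  have hd' : (2 : ℝ) ≤ d := by exact_mod_cast hd
  unfold laplaceConst
  exact inv_nonneg.2 (mul_nonneg (by linarith) this.le)

lemma abs_laplaceKernel_pt (hd : 2 ≤ d) (z : Space d) (s : ℝ) :
    |laplaceKernel (pt z s)| = laplaceConst d * radialPow (d - 1) z s := by
  rw [laplaceKernel_pt hd, abs_neg, abs_of_nonneg]
  · rfl
  · exact mul_nonneg (laplaceConst_nonneg hd) (radialPow_nonneg _ _ _)

lemma measurable_laplaceKernel : Measurable (laplaceKernel (d := d)) := by
  unfold laplaceKernel; fun_prop

lemma measurable_laplaceKernel_pt (s : ℝ) :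
    Measurable fun z : Space d => laplaceKernel (pt z s) :=
  measurable_laplaceKernel.comp
    (Measurable.of_uncurry_right (f := fun (z : Space d) (s : ℝ) => pt z s) measurable_pt)

/-- Integration by parts puts the derivative on the Gaussian. As `s → 0` the kernel `E(·, s)` keeps
a singularity `|z|^{-(d-1)}`, locally integrable on `ℝ^d`, whereas that of `D_k E`, of order
`|z|^{-d}`, is not. -/
lemma convGrad_castSucc_eq (hd : 2 ≤ d) {t s : ℝ} (ht : 0 < t) (hs : 0 < s) (k : Fin d)
    (x : Space d) :
    convGrad k.castSucc t s x = ∫ z : Space d, gaussDeriv k t (x - z) * laplaceKernel (pt z s) := by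
  have hd' : (2 : ℝ) ≤ d := by exact_mod_cast hd
  have hE : ∀ z : Space d, ‖laplaceKernel (pt z s)‖ ≤ laplaceConst d * s ^ (-(d - 1) : ℝ) :=
    fun z => by
      rw [Real.norm_eq_abs, abs_laplaceKernel_pt hd]
      exact mul_le_mul_of_nonneg_left (radialPow_le (by linarith) z hs) (laplaceConst_nonneg hd)
  have hEm := (measurable_laplaceKernel_pt (d := d) s).aestronglyMeasurable (μ := volume)
  have := integral_bilinear_hasLineDerivAt_right_eq_neg_left_of_integrable
    (B := ContinuousLinearMap.mul ℝ ℝ) (v := EuclideanSpace.single k (1 : ℝ)) (μ := volume)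
    (f := fun z : Space d => gauss t (x - z)) (f' := fun z => -gaussDeriv k t (x - z))
    (g := fun z => laplaceKernel (pt z s)) (g' := fun z => gradE k.castSucc z s) ?_ ?_ ?_ ?_ ?_
  · simp only [ContinuousLinearMap.mul_apply', neg_mul, integral_neg, neg_neg] at this
    exact this
  · exact ((integrable_gaussDeriv ht k).comp_sub_left x).neg.mul_bdd hEm (ae_of_all _ hE)
  · exact integrable_gauss_mul_gradE ht hs _ x
  · exact ((integrable_gauss ht).comp_sub_left x).mul_bdd hEm (ae_of_all _ hE)
  · intro z _
    have h1 : HasDerivAt (fun h : ℝ => x - (z + h • EuclideanSpace.single k (1 : ℝ)))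
        (-EuclideanSpace.single k (1 : ℝ)) 0 := by
      simpa using (((hasDerivAt_id (0 : ℝ)).smul_const
        (EuclideanSpace.single k (1 : ℝ))).const_add z).const_sub x
    refine (hasDerivAt_gauss_path t h1).congr_deriv ?_
    simp [EuclideanSpace.inner_single_right, gaussDeriv, inner_neg_right]
    ring
  · intro z _
    simpa [HasLineDerivAt] using hasDerivAt_laplaceKernel_line hd z hs k 0

lemma tendsto_convGrad_castSucc (hd : 2 ≤ d) {t : ℝ} (ht : 0 < t) (k : Fin d) (x : Space d) :
    Tendsto (fun s => convGrad k.castSucc t s x) (𝓝[>] 0) (𝓝 (convLaplaceDeriv k t x)) := by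
  have hd' : (2 : ℝ) ≤ d := by exact_mod_cast hd
  have hc := slopeConst_pos (d := d)
  have h2t : 0 < 2 * t := by positivity
  obtain ⟨C, -, h⟩ := singular_convolution (d := d) (p := d - 1) hd (by linarith) (by linarith)
    (gauss_nonneg (2 * t)) (gauss_le_sup (2 * t) h2t) (integrable_gauss h2t)
  have : Tendsto (fun s => ∫ z : Space d, gaussDeriv k t (x - z) * laplaceKernel (pt z s)) (𝓝[>] 0)
      (𝓝 (convLaplaceDeriv k t x)) := by
    refine tendsto_integral_filter_of_dominated_convergence
      (fun z => slopeConst d / Real.sqrt t * laplaceConst d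
        * (gauss (2 * t) (x - z) * radialPow (d - 1) z 0))
      (Eventually.of_forall fun s => (Measurable.mul (by fun_prop)
        (measurable_laplaceKernel_pt s)).aestronglyMeasurable) ?_ ((h x).1.const_mul _) ?_
    · filter_upwards [self_mem_nhdsWithin] with s hs
      filter_upwards [ae_ne_zero hd] with z hz
      rw [norm_mul, Real.norm_eq_abs, Real.norm_eq_abs, abs_laplaceKernel_pt hd]
      have h0 := laplaceConst_nonneg hd
      have h1 := radialPow_nonneg (d - 1) z s
      have hz' : 0 < ‖z‖ ^ 2 := by positivity
      have h3 : radialPow (d - 1) z s ≤ radialPow (d - 1) z 0 := by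
        unfold radialPow
        exact Real.rpow_le_rpow_of_nonpos (by simpa using hz') (by simp [sq_nonneg]) (by linarith)
      calc _ ≤ (slopeConst d / Real.sqrt t * gauss (2 * t) (x - z))
            * (laplaceConst d * radialPow (d - 1) z 0) := by
              gcongr
              · exact mul_nonneg (by positivity) (gauss_nonneg _ _)
              · exact abs_gaussDeriv_le ht k (x - z)
        _ = _ := by ring
    · filter_upwards [ae_ne_zero hd] with z hz
      have hz' : ‖z‖ ^ 2 ≠ 0 := by positivity
      simp only [laplaceKernel_pt hd]
      have : ContinuousAt (fun s : ℝ => gaussDeriv k t (x - z)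
          * -((((d : ℝ) - 1) * sphereArea (d + 1))⁻¹ * radialPow (d - 1) z s)) 0 := by
        unfold radialPow
        refine continuousAt_const.mul (continuousAt_const.mul ?_).neg
        exact ContinuousAt.rpow_const (by fun_prop) (Or.inl (by simpa using hz'))
      exact this.tendsto.mono_left nhdsWithin_le_nhds
  refine this.congr' ?_
  filter_upwards [self_mem_nhdsWithin] with s hs using (convGrad_castSucc_eq hd ht hs k x).symm

/-! ### Convolution in the normal variable -/

/-- The derivative of the normal factor. -/
def normalFactorDeriv (t r : ℝ) : ℝ :=
  -(1 / (2 * t)) * (1 / Real.sqrt (4 * Real.pi * t)) * (1 - r ^ 2 / (2 * t))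
    * Real.exp (-r ^ 2 / (4 * t))

@[fun_prop] lemma continuous_normalFactor (t : ℝ) : Continuous fun r => normalFactor t r := by
  unfold normalFactor; fun_prop

@[fun_prop] lemma continuous_normalFactorDeriv (t : ℝ) :
    Continuous fun r => normalFactorDeriv t r := by
  unfold normalFactorDeriv; fun_prop

lemma normalFactor_zero (t : ℝ) : normalFactor t 0 = 0 := by simp [normalFactor]

lemma hasDerivAt_normalFactor {t : ℝ} (ht : 0 < t) (r : ℝ) :
    HasDerivAt (fun r => normalFactor t r) (normalFactorDeriv t r) r := by
  unfold normalFactor normalFactorDeriv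
  have h1 : HasDerivAt (fun r : ℝ => -r ^ 2 / (4 * t)) (-(2 * r) / (4 * t)) r := by
    refine ((((hasDerivAt_id r).pow 2).neg).div_const (4 * t)).congr_deriv ?_
    simp
  refine (((((hasDerivAt_id r).div_const (2 * t)).neg).mul_const
    (1 / Real.sqrt (4 * Real.pi * t))).mul h1.exp).congr_deriv ?_
  simp only [id_eq, Pi.neg_apply]
  field_simp
  ring

lemma abs_normalFactorDeriv_le {t : ℝ} (ht : 0 < t) (r : ℝ) :
    |normalFactorDeriv t r| ≤ 1 / (2 * t) * (1 / Real.sqrt (4 * Real.pi * t)) * 3 := by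
  have h1 : |1 - r ^ 2 / (2 * t)| * Real.exp (-r ^ 2 / (4 * t)) ≤ 3 := by
    set u := r ^ 2 / (4 * t) with hu
    have hu0 : 0 ≤ u := by positivity
    rw [show r ^ 2 / (2 * t) = 2 * u by rw [hu]; field_simp; norm_num,
      show -r ^ 2 / (4 * t) = -u by rw [hu]; ring, Real.exp_neg, ← div_eq_mul_inv,
      div_le_iff₀ (Real.exp_pos _)]
    have := Real.add_one_le_exp u
    rw [abs_le]
    constructor <;> linarith
  unfold normalFactorDeriv
  rw [abs_mul, abs_mul, abs_of_pos (Real.exp_pos _), mul_assoc, abs_mul, abs_neg,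
    abs_of_pos (by positivity : 0 < 1 / (2 * t)),
    abs_of_pos (by positivity : 0 < 1 / Real.sqrt (4 * Real.pi * t))]
  exact mul_le_mul_of_nonneg_left h1 (by positivity)

/-- Because `normalFactor` vanishes at `0`, cutting it off at negative arguments only creates a
kink. The truncated function stays Lipschitz, which is enough to differentiate under the integral.
-/
lemma lipschitz_normalFactor_max {t : ℝ} (ht : 0 < t) :
    LipschitzWith (Real.nnabs (1 / (2 * t) * (1 / Real.sqrt (4 * Real.pi * t)) * 3))
      fun r => normalFactor t (max r 0) := by
  have h1 : LipschitzWith (Real.nnabs (1 / (2 * t) * (1 / Real.sqrt (4 * Real.pi * t)) * 3))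
      (normalFactor t) := by
    refine lipschitzWith_of_nnnorm_deriv_le
      (fun r => (hasDerivAt_normalFactor ht r).differentiableAt) fun r => ?_
    rw [(hasDerivAt_normalFactor ht r).deriv, ← NNReal.coe_le_coe, coe_nnnorm, Real.norm_eq_abs,
      Real.coe_nnabs, abs_of_nonneg (a := _ * _) (by positivity)]
    exact abs_normalFactorDeriv_le ht r
  have h2 := h1.comp (LipschitzWith.id.max_const 0)
  rw [mul_one] at h2
  exact h2

lemma abs_normalFactor_le {t X : ℝ} (ht : 0 < t) {r : ℝ} (hr : 0 ≤ r) (hrX : r ≤ X) :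
    |normalFactor t r| ≤ X / (2 * t) * (1 / Real.sqrt (4 * Real.pi * t)) := by
  unfold normalFactor
  rw [abs_mul, abs_mul, abs_neg, abs_of_pos (Real.exp_pos _),
    abs_of_nonneg (by positivity : 0 ≤ r / (2 * t)),
    abs_of_pos (by positivity : 0 < 1 / Real.sqrt (4 * Real.pi * t))]
  refine (mul_le_of_le_one_right (by positivity) (Real.exp_le_one_iff.2 ?_)).trans (by gcongr)
  rw [neg_div]
  exact neg_nonpos.2 (by positivity)

lemma setIntegral_Ioo_reflect {Y : ℝ} (hY : 0 ≤ Y) (f : ℝ → ℝ) :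
    ∫ r in Ioo 0 Y, f (Y - r) = ∫ s in Ioo 0 Y, f s := by
  rw [← integral_Ioc_eq_integral_Ioo, ← integral_Ioc_eq_integral_Ioo,
    ← intervalIntegral.integral_of_le hY, ← intervalIntegral.integral_of_le hY,
    intervalIntegral.integral_comp_sub_left]
  simp

lemma integrableOn_rpow_neg_half (Y : ℝ) :
    IntegrableOn (fun s : ℝ => s ^ (-(1 / 2) : ℝ)) (Ioo 0 Y) := by
  rcases le_or_gt Y 0 with h | h
  · rw [Ioo_eq_empty_of_le h]; exact integrableOn_empty
  · exact (intervalIntegral.integrableOn_Ioo_rpow_iff h).2 (by norm_num)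

lemma integrableOn_reflect {Y : ℝ} {f : ℝ → ℝ} (hf : IntegrableOn f (Ioo 0 Y)) :
    IntegrableOn (fun r => f (Y - r)) (Ioo 0 Y) := by
  rw [← integrable_indicator_iff measurableSet_Ioo] at hf ⊢
  refine (hf.comp_sub_left Y).congr (ae_of_all _ fun r => ?_)
  simp only [indicator, mem_Ioo]
  congr 1
  exact propext ⟨fun h => ⟨by linarith [h.2], by linarith [h.1]⟩,
    fun h => ⟨by linarith [h.2], by linarith [h.1]⟩⟩

lemma integrableOn_mul_of_le_rpow {f g : ℝ → ℝ} {Y A C : ℝ} (hf : Continuous f)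
    (hfA : ∀ s ∈ Ioo 0 Y, |f s| ≤ A) (hA : 0 ≤ A)
    (hg : AEStronglyMeasurable g (volume.restrict (Ioo 0 Y)))
    (hgC : ∀ s, 0 < s → |g s| ≤ C * s ^ (-(1 / 2) : ℝ)) :
    IntegrableOn (fun s => f s * g s) (Ioo 0 Y) := by
  refine (((integrableOn_rpow_neg_half Y).const_mul C).const_mul A).mono'
    (hf.aestronglyMeasurable.mul hg) ?_
  filter_upwards [ae_restrict_mem measurableSet_Ioo] with s hs
  rw [norm_mul]
  exact mul_le_mul (hfA s hs) (hgC s hs.1) (abs_nonneg _) hA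

/-- After the reflection `s = Y - r` the integrand vanishes for `s ≥ Y` thanks to the truncation, so
the moving upper limit is replaced by a fixed one. -/
lemma setIntegral_normalFactor_eq {t X Y : ℝ} (hY : 0 < Y) (hYX : Y ≤ X) (g : ℝ → ℝ) :
    ∫ r in Ioo 0 Y, normalFactor t r * g (Y - r)
      = ∫ s in Ioo 0 X, normalFactor t (max (Y - s) 0) * g s := by
  have h := setIntegral_Ioo_reflect hY.le fun s => normalFactor t (Y - s) * g s
  simp only [sub_sub_cancel] at h
  rw [h, setIntegral_eq_of_subset_of_forall_sdiff_eq_zero measurableSet_Ioo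
    (Ioo_subset_Ioo_right hYX) (fun s hs => ?_)]
  · refine setIntegral_congr_fun measurableSet_Ioo fun s hs => ?_
    rw [max_eq_left (by linarith [hs.2])]
  · have : Y ≤ s := by
      by_contra h
      exact hs.2 ⟨hs.1.1, by linarith⟩
    rw [max_eq_right (by linarith), normalFactor_zero, zero_mul]

/-- Leibniz rule for a Volterra convolution with `g'` possibly singular at `0`. After reflection the
variable sits in `normalFactor` over a fixed interval, so the derivative first falls on this smooth
factor; an integration by parts then moves it to `g` and creates the boundary term with the limit
`g0`. -/
lemma hasDerivAt_normal_convolution {t X C g0 : ℝ} (ht : 0 < t) (hX : 0 < X) {g g' : ℝ → ℝ}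
    (hg : ∀ s, 0 < s → |g s| ≤ C * s ^ (-(1 / 2) : ℝ))
    (hg' : ∀ s, 0 < s → |g' s| ≤ C * s ^ (-(1 / 2) : ℝ))
    (hD : ∀ s, 0 < s → HasDerivAt g (g' s) s) (hmeas : Measurable g')
    (h0 : Tendsto g (𝓝[>] 0) (𝓝 g0)) :
    HasDerivAt (fun h => ∫ r in Ioo 0 (X + h), normalFactor t r * g (X + h - r))
      (normalFactor t X * g0 + ∫ r in Ioo 0 X, normalFactor t r * g' (X - r)) 0 := by
  have hgm : ∀ Y, AEStronglyMeasurable g (volume.restrict (Ioo 0 Y)) := fun Y => by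
    refine ContinuousOn.aestronglyMeasurable (fun s hs => ?_) measurableSet_Ioo
    exact (hD s hs.1).continuousAt.continuousWithinAt
  set K : ℝ := 1 / (2 * t) * (1 / Real.sqrt (4 * Real.pi * t)) * 3 with hK
  have hK0 : 0 ≤ K := by positivity
  have hlip := lipschitz_normalFactor_max ht
  rw [← hK] at hlip
  have hcont := hlip.continuous
  have habs : ∀ r, |normalFactor t (max r 0)| ≤ K * |r| := fun r => by
    have := hlip.dist_le_mul r 0
    simpa [Real.dist_eq, normalFactor_zero, abs_of_nonneg hK0] using this
  have key : HasDerivAt (fun h => ∫ s in Ioo 0 (X + 1), normalFactor t (max (X + h - s) 0) * g s)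
      (∫ s in Ioo 0 (X + 1), (Iio X).indicator (fun s => normalFactorDeriv t (X - s)) s * g s)
      0 := by
    refine (hasDerivAt_integral_of_dominated_loc_of_lip
      (F := fun h s => normalFactor t (max (X + h - s) 0) * g s)
      (F' := fun s => (Iio X).indicator (fun s => normalFactorDeriv t (X - s)) s * g s)
      (bound := fun s => K * (C * s ^ (-(1 / 2) : ℝ))) univ_mem ?_ ?_ ?_ ?_ ?_ ?_).2
    · refine Eventually.of_forall fun h => AEStronglyMeasurable.mul ?_ (hgm _)
      exact (hcont.comp (by fun_prop : Continuous fun s => X + h - s)).aestronglyMeasurable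
    · refine integrableOn_mul_of_le_rpow (A := K * (X + 1))
        (hcont.comp (by fun_prop : Continuous fun s => X + 0 - s)) (fun s hs => ?_)
        (by positivity) (hgm _) hg
      refine (habs _).trans (mul_le_mul_of_nonneg_left ?_ hK0)
      rw [abs_le]; constructor <;> linarith [hs.1, hs.2]
    · refine AEStronglyMeasurable.mul ?_ (hgm _)
      exact ((Measurable.indicator (by fun_prop) measurableSet_Iio)).aestronglyMeasurable
    · filter_upwards [ae_restrict_mem measurableSet_Ioo] with s hs
      refine LipschitzOnWith.of_dist_le_mul fun h _ h' _ => ?_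
      have h1 := hlip.dist_le_mul (X + h - s) (X + h' - s)
      have h2 := hg s hs.1
      have h3 : 0 ≤ C * s ^ (-(1 / 2) : ℝ) := (abs_nonneg _).trans h2
      rw [Real.coe_nnabs, abs_of_nonneg (mul_nonneg hK0 h3)]
      rw [Real.coe_nnabs, abs_of_nonneg hK0, Real.dist_eq, Real.dist_eq] at h1
      rw [Real.dist_eq, Real.dist_eq, ← sub_mul, abs_mul]
      rw [show X + h - s - (X + h' - s) = h - h' by ring] at h1
      calc _ ≤ K * |h - h'| * (C * s ^ (-(1 / 2) : ℝ)) := by gcongr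
        _ = _ := by ring
    · exact ((integrableOn_rpow_neg_half _).const_mul C).const_mul K
    -- The truncated factor may fail to be differentiable only at its kink, which corresponds to `s
    -- = X`, a null set.
    · have hne : ∀ᵐ s ∂(volume.restrict (Ioo 0 (X + 1))), s ≠ X :=
        ae_restrict_of_ae (Measure.ae_ne volume X)
      filter_upwards [hne] with s hs
      refine HasDerivAt.mul_const ?_ _
      rcases lt_or_gt_of_ne hs with h | h
      · rw [indicator_of_mem (by exact h)]
        have h1 : HasDerivAt (fun h => normalFactor t (X + h - s)) (normalFactorDeriv t (X - s))
            0 := by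
          have := (hasDerivAt_normalFactor ht (X - s)).comp_of_eq (0 : ℝ)
            (((hasDerivAt_id (0 : ℝ)).const_add X).sub_const s) (by simp)
          simpa [Function.comp_def] using this
        refine h1.congr_of_eventuallyEq ?_
        filter_upwards [Ioi_mem_nhds (show s - X < 0 by linarith)] with h' hh'
        have : s - X < h' := hh'
        rw [max_eq_left (by linarith)]
      · rw [indicator_of_notMem (by simpa using h.le)]
        refine (hasDerivAt_const (0 : ℝ) (0 : ℝ)).congr_of_eventuallyEq ?_
        filter_upwards [Iio_mem_nhds (show 0 < s - X by linarith)] with h' hh'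
        have : h' < s - X := hh'
        rw [max_eq_right (by linarith), normalFactor_zero]
  have hint1 : IntegrableOn (fun s => normalFactorDeriv t (X - s) * g s) (Ioo 0 X) :=
    integrableOn_mul_of_le_rpow (A := K) (by fun_prop)
      (fun s _ => abs_normalFactorDeriv_le ht _) hK0 (hgm _) hg
  have hint2 : IntegrableOn (fun s => normalFactor t (X - s) * g' s) (Ioo 0 X) :=
    integrableOn_mul_of_le_rpow (by fun_prop)
      (fun s hs => abs_normalFactor_le ht (by linarith [hs.2]) (by linarith [hs.1] : X - s ≤ X))
      (by positivity) hmeas.aestronglyMeasurable hg'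
  have hval : ∫ s in Ioo 0 (X + 1), (Iio X).indicator (fun s => normalFactorDeriv t (X - s)) s * g s
      = normalFactor t X * g0 + ∫ r in Ioo 0 X, normalFactor t r * g' (X - r) := by
    have e1 : ∫ s in Ioo 0 (X + 1),
        (Iio X).indicator (fun s => normalFactorDeriv t (X - s)) s * g s
        = ∫ s in Ioo 0 X, normalFactorDeriv t (X - s) * g s := by
      rw [setIntegral_eq_of_subset_of_forall_sdiff_eq_zero measurableSet_Ioo
        (Ioo_subset_Ioo_right (by linarith : X ≤ X + 1)) (fun s hs => ?_)]
      · refine setIntegral_congr_fun measurableSet_Ioo fun s hs => ?_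
        rw [indicator_of_mem (by exact hs.2)]
      · have : X ≤ s := by
          by_contra h
          exact hs.2 ⟨hs.1.1, by linarith⟩
        rw [indicator_of_notMem (by simpa using this), zero_mul]
    have e2 : ∫ r in Ioo 0 X, normalFactor t r * g' (X - r)
        = ∫ s in Ioo 0 X, normalFactor t (X - s) * g' s := by
      rw [← setIntegral_Ioo_reflect hX.le]
      simp
    -- Fundamental theorem for `normalFactor t (X - s) * g s`, stated with one-sided limits since
    -- `g` is not controlled at `0`. The contribution at `s = X` vanishes because `normalFactor t 0
    -- = 0`.
    have e3 := intervalIntegral.integral_eq_sub_of_hasDerivAt_of_tendsto (a := 0) (b := X)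
      (f := fun s => normalFactor t (X - s) * g s)
      (f' := fun s => -normalFactorDeriv t (X - s) * g s + normalFactor t (X - s) * g' s)
      (fa := normalFactor t X * g0) (fb := normalFactor t 0 * g X) hX
      (fun s hs => ?_) ?_ ?_ ?_
    · rw [intervalIntegral.integral_of_le hX.le, integral_Ioc_eq_integral_Ioo] at e3
      simp only [neg_mul] at e3
      have e4 := integral_add hint1.neg hint2
      simp only [Pi.neg_apply] at e4
      rw [e4, integral_neg, normalFactor_zero, zero_mul] at e3
      rw [e1, e2]
      linarith
    · have h1 : HasDerivAt (fun s => normalFactor t (X - s)) (-normalFactorDeriv t (X - s)) s := by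
        have := (hasDerivAt_normalFactor ht (X - s)).comp s ((hasDerivAt_id s).const_sub X)
        simpa [Function.comp_def] using this
      exact h1.mul (hD s hs.1)
    · rw [intervalIntegrable_iff_integrableOn_Ioo_of_le hX.le]
      simp only [neg_mul]
      exact hint1.neg.add hint2
    · have h1 : Tendsto (fun s => normalFactor t (X - s)) (𝓝[>] 0) (𝓝 (normalFactor t X)) := by
        have : Continuous fun s => normalFactor t (X - s) := by fun_prop
        simpa using (this.tendsto 0).mono_left nhdsWithin_le_nhds
      exact h1.mul h0
    · have h1 : ContinuousAt (fun s => normalFactor t (X - s) * g s) X :=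
        (Continuous.continuousAt (by fun_prop)).mul (hD X hX).continuousAt
      simpa using h1.tendsto.mono_left nhdsWithin_le_nhds
  rw [hval] at key
  refine key.congr_of_eventuallyEq ?_
  filter_upwards [Ioo_mem_nhds (show -X < 0 by linarith) zero_lt_one] with h hh
  exact setIntegral_normalFactor_eq (by linarith [hh.1]) (by linarith [hh.2]) g

/-! ### Formulas for the kernel `L_ij` -/

/-- The kernel `L_ij` for tangential `j`, as an absolutely convergent integral. -/
def kernelTan (i : Fin (d + 1)) (j : Fin d) (t X : ℝ) (x : Space d) : ℝ :=
  ∫ r in Ioo 0 X, normalFactor t r * convHess i j t (X - r) x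

lemma measurable_convHess_normal (i : Fin (d + 1)) (j : Fin d) (t : ℝ) (x : Space d) :
    Measurable fun s => convHess i j t s x :=
  (stronglyMeasurable_convHess i j).measurable.comp
    (by fun_prop : Measurable fun s : ℝ => ((x, t), s))

lemma setIntegral_kernelL (hd : 2 ≤ d) {t : ℝ} (ht : 0 < t) (i : Fin (d + 1)) (x : Space d)
    (X : ℝ) :
    (∫ r in Ioo 0 (pt x X (Fin.last d)), ∫ z : Space d,
      heatKernelDn (pt z r) t * pd i laplaceKernel (pt x X - pt z r))
      = ∫ r in Ioo 0 X, normalFactor t r * convGrad i t (X - r) x := by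
  rw [pt_last]
  refine setIntegral_congr_fun measurableSet_Ioo fun r hr => ?_
  simp only [convGrad_comm]
  rw [← integral_const_mul]
  refine integral_congr_ae (ae_of_all _ fun z => ?_)
  simp only
  rw [pt_sub_pt, pd_laplaceKernel hd i _ (sub_pos.2 hr.2), heatKernelDn_pt ht, mul_assoc]

/-- A tangential derivative does not touch the limits of integration, so it passes under the
integral; the majorant is `C (X - r)^{-1/2}`, with `C` depending on `t` and `X`. -/
lemma kernelL_castSucc (hd : 2 ≤ d) {t X : ℝ} (ht : 0 < t) (i : Fin (d + 1)) (j : Fin d)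
    (x : Space d) : kernelL i j.castSucc (pt x X) t = kernelTan i j t X x := by
  unfold kernelL kernelTan
  refine pd_castSucc_eq ?_
  simp only [setIntegral_kernelL hd ht]
  obtain ⟨C, hC, hM⟩ := abs_convHess_le (d := d) ht
  obtain ⟨C', hC', hH⟩ := abs_convGrad_le (d := d) hd ht
  set A := |X| / (2 * t) * (1 / Real.sqrt (4 * Real.pi * t)) with hA
  have hA0 : 0 ≤ A := by positivity
  have hbd : ∀ s ∈ Ioo 0 X, |normalFactor t s| ≤ A := fun s hs =>
    abs_normalFactor_le ht hs.1.le (hs.2.le.trans (le_abs_self _))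
  have hmg : ∀ y : Space d, AEStronglyMeasurable (fun r => normalFactor t r * convGrad i t (X - r) y)
      (volume.restrict (Ioo 0 X)) := fun y => by
    refine ContinuousOn.aestronglyMeasurable (fun r hr => ?_) measurableSet_Ioo
    refine (Continuous.continuousWithinAt (by fun_prop)).mul ?_
    have h1 : ContinuousAt (fun s => convGrad i t s y) (X - r) := by
      refine Fin.lastCases ?_ (fun k => ?_) i
      · exact (hasDerivAt_convGrad_last ht (sub_pos.2 hr.2) y).continuousAt
      · exact (hasDerivAt_convGrad_castSucc ht (sub_pos.2 hr.2) k y).continuousAt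
    exact (ContinuousAt.comp (f := fun r => X - r) h1 (by fun_prop)).continuousWithinAt
  have key := (hasDerivAt_integral_of_dominated_loc_of_deriv_le (μ := volume.restrict (Ioo 0 X))
    (x₀ := (0 : ℝ)) (s := univ)
    (F := fun h r => normalFactor t r
      * convGrad i t (X - r) (x + h • EuclideanSpace.single j (1 : ℝ)))
    (F' := fun h r => normalFactor t r
      * convHess i j t (X - r) (x + h • EuclideanSpace.single j (1 : ℝ)))
    (bound := fun r => A * (C * (X - r) ^ (-(1 / 2) : ℝ))) univ_mem ?_ ?_ ?_ ?_ ?_ ?_).2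
  · simpa using key
  · exact Eventually.of_forall fun h => hmg _
  · refine (((integrableOn_reflect (integrableOn_rpow_neg_half X)).const_mul C').const_mul A).mono'
      (hmg _) ?_
    filter_upwards [ae_restrict_mem measurableSet_Ioo] with r hr
    rw [norm_mul]
    exact mul_le_mul (hbd r hr) (hH _ _ _ (sub_pos.2 hr.2)) (abs_nonneg _) hA0
  · refine Measurable.aestronglyMeasurable (Measurable.mul (by fun_prop) ?_)
    exact (measurable_convHess_normal i j t _).comp (by fun_prop : Measurable fun r => X - r)
  · filter_upwards [ae_restrict_mem measurableSet_Ioo] with r hr h _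
    rw [norm_mul]
    exact mul_le_mul (hbd r hr) (hM _ _ _ _ (sub_pos.2 hr.2)) (abs_nonneg _) hA0
  · exact ((integrableOn_reflect (integrableOn_rpow_neg_half X)).const_mul C).const_mul A
  · filter_upwards [ae_restrict_mem measurableSet_Ioo] with r hr h _
    exact (hasDerivAt_convGrad_line ht (sub_pos.2 hr.2) i j x h).const_mul _

/-- The trace of `convGrad k.castSucc` appears as a boundary term. It is the only part of the
Poisson kernel's function part that is not absorbed into an `L¹` bound, and it is the density of
`D_k T`. -/
lemma kernelL_castSucc_last (hd : 2 ≤ d) {t X : ℝ} (ht : 0 < t) (hX : 0 < X) (k : Fin d)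
    (x : Space d) :
    kernelL k.castSucc (Fin.last d) (pt x X) t
      = normalFactor t X * convLaplaceDeriv k t x + kernelTan (Fin.last d) k t X x := by
  unfold kernelL kernelTan
  refine pd_last_eq ?_
  simp only [setIntegral_kernelL hd ht]
  obtain ⟨C, hC, hM⟩ := abs_convHess_le (d := d) ht
  obtain ⟨C', hC', hH⟩ := abs_convGrad_le (d := d) hd ht
  refine hasDerivAt_normal_convolution (C := max C C') (g := fun s => convGrad k.castSucc t s x)
    (g' := fun s => convHess (Fin.last d) k t s x) ht hX (fun s hs => (hH _ s x hs).trans ?_)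
    (fun s hs => (hM _ _ s x hs).trans ?_)
    (fun s hs => hasDerivAt_convGrad_castSucc ht hs k x)
    (measurable_convHess_normal _ _ t x) (tendsto_convGrad_castSucc hd ht k x)
  · gcongr; exact le_max_right _ _
  · gcongr; exact le_max_left _ _

lemma integrableOn_kernelTan {t X : ℝ} (ht : 0 < t) (i : Fin (d + 1)) (j : Fin d) (x : Space d) :
    IntegrableOn (fun r => normalFactor t r * convHess i j t (X - r) x) (Ioo 0 X) := by
  obtain ⟨C, hC, hM⟩ := abs_convHess_le (d := d) ht
  refine (((integrableOn_reflect (integrableOn_rpow_neg_half X)).const_mul C).const_mul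
    (|X| / (2 * t) * (1 / Real.sqrt (4 * Real.pi * t)))).mono' ?_ ?_
  · refine Measurable.aestronglyMeasurable (Measurable.mul (by fun_prop) ?_)
    exact (measurable_convHess_normal i j t _).comp (by fun_prop : Measurable fun r => X - r)
  · filter_upwards [ae_restrict_mem measurableSet_Ioo] with r hr
    rw [norm_mul]
    exact mul_le_mul (abs_normalFactor_le ht hr.1.le (hr.2.le.trans (le_abs_self _)))
      (hM _ _ _ _ (sub_pos.2 hr.2)) (abs_nonneg _) (by positivity)

/-- Here the trace is a multiple of the Gaussian, which reproduces `D_n Γ`, and harmonicity rewrites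
the remaining second normal derivative as tangential kernels. Every term is therefore `L¹`. -/
lemma kernelL_last_last (hd : 2 ≤ d) {t X : ℝ} (ht : 0 < t) (hX : 0 < X) (x : Space d) :
    kernelL (Fin.last d) (Fin.last d) (pt x X) t
      = layerMass d * heatKernelDn (pt x X) t - ∑ k : Fin d, kernelTan k.castSucc k t X x := by
  have e : layerMass d * heatKernelDn (pt x X) t - ∑ k : Fin d, kernelTan k.castSucc k t X x
      = normalFactor t X * (layerMass d * gauss t x)
        + ∫ r in Ioo 0 X, normalFactor t r * -∑ k : Fin d, convHess k.castSucc k t (X - r) x := by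
    unfold kernelTan
    rw [heatKernelDn_pt ht, ← integral_finsetSum _ fun k _ => integrableOn_kernelTan ht _ _ x]
    simp only [mul_neg, integral_neg, Finset.mul_sum]
    ring
  rw [e]
  unfold kernelL
  refine pd_last_eq ?_
  simp only [setIntegral_kernelL hd ht]
  obtain ⟨C, hC, hM⟩ := abs_convHess_le (d := d) ht
  obtain ⟨C', hC', hH⟩ := abs_convGrad_le (d := d) hd ht
  refine hasDerivAt_normal_convolution (C := max (d * C) C')
    (g := fun s => convGrad (Fin.last d) t s x)
    (g' := fun s => -∑ k : Fin d, convHess k.castSucc k t s x) ht hX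
    (fun s hs => (hH _ s x hs).trans ?_) (fun s hs => ?_)
    (fun s hs => hasDerivAt_convGrad_last ht hs x)
    (Finset.measurable_sum _ fun k _ => measurable_convHess_normal _ _ t x).neg
    (tendsto_convGrad_last ht x)
  · gcongr; exact le_max_right _ _
  · rw [abs_neg]
    refine (Finset.abs_sum_le_sum_abs _ _).trans
      ((Finset.sum_le_sum fun k _ => hM _ _ s x hs).trans ?_)
    rw [Finset.sum_const, Finset.card_univ, Fintype.card_fin, nsmul_eq_mul, ← mul_assoc]
    gcongr; exact le_max_left _ _

/-! ### Bounds in `L¹` of the kernels -/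

lemma abs_normalFactor_mul_rpow_le {t r β : ℝ} (ht : 0 < t) (hr : 0 < r) :
    |normalFactor t r| * t ^ (-β) ≤ r * t ^ (-(3 / 2) - β) * Real.exp (-(r ^ 2 / (4 * t))) := by
  have hs : Real.sqrt t ≤ Real.sqrt (4 * Real.pi * t) :=
    Real.sqrt_le_sqrt (by nlinarith [Real.pi_gt_three])
  have hs0 : 0 < Real.sqrt t := Real.sqrt_pos.2 ht
  have e1 : |normalFactor t r|
      = r / (2 * t) * (1 / Real.sqrt (4 * Real.pi * t)) * Real.exp (-(r ^ 2 / (4 * t))) := by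
    unfold normalFactor
    rw [abs_mul, abs_mul, abs_neg, abs_of_pos (Real.exp_pos _),
      abs_of_nonneg (by positivity : 0 ≤ r / (2 * t)),
      abs_of_nonneg (by positivity : 0 ≤ 1 / Real.sqrt (4 * Real.pi * t)), neg_div]
  have e2 : t ^ (-(3 / 2) - β) = 1 / t * (1 / Real.sqrt t) * t ^ (-β) := by
    rw [sub_eq_add_neg, Real.rpow_add ht, show (-(3 / 2) : ℝ) = -1 + -(1 / 2) by norm_num,
      Real.rpow_add ht, Real.rpow_neg_one, Real.rpow_neg ht.le, ← Real.sqrt_eq_rpow, one_div,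
      one_div]
  rw [e1, e2]
  calc _ ≤ r / t * (1 / Real.sqrt t) * Real.exp (-(r ^ 2 / (4 * t))) * t ^ (-β) := by
        gcongr
        linarith
    _ = _ := by ring

lemma exp_neg_le_two_div_sq {y : ℝ} (hy : 0 < y) : Real.exp (-y) ≤ 2 / y ^ 2 := by
  rw [Real.exp_neg, inv_eq_one_div, div_le_div_iff₀ (Real.exp_pos _) (by positivity)]
  have := Real.quadratic_le_exp_of_nonneg hy.le
  linarith

/-- The integral is split at the parabolic scale `t = r^2`. Below it `exp(-y) ≤ 2 / y^2` with `y =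
r^2 / (4t)` costs `32`; above it the exponential is dropped and the power integrates to at most `2`.
The upper bound on `β` makes the exponent `3/2 - β` at least one. The values used are `β = 1/4` and
`β = 0`. -/
lemma lintegral_normalFactor_le {r β : ℝ} (hr : 0 < r) (hβ : 0 ≤ β) (hβ' : β ≤ 1 / 4) :
    ∫⁻ t in Ioi 0, ‖normalFactor t r‖ₑ * ENNReal.ofReal (t ^ (-β))
      ≤ ENNReal.ofReal (34 * r ^ (-(2 * β))) := by
  have hr2 : 0 < r ^ 2 := by positivity
  have hpow : ∀ a : ℝ, (r ^ 2) ^ a = r ^ (2 * a) := fun a => by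
    rw [← Real.rpow_natCast, ← Real.rpow_mul hr.le]; norm_num
  have hconv : ∀ t : ℝ, 0 < t → ‖normalFactor t r‖ₑ * ENNReal.ofReal (t ^ (-β))
      = ENNReal.ofReal (|normalFactor t r| * t ^ (-β)) := fun t ht => by
    rw [Real.enorm_eq_ofReal_abs, ENNReal.ofReal_mul (abs_nonneg _)]
  have h1 : ∫⁻ t in Ioc 0 (r ^ 2), ‖normalFactor t r‖ₑ * ENNReal.ofReal (t ^ (-β))
      ≤ ENNReal.ofReal (32 * r ^ (-(2 * β))) := by
    calc _ ≤ ∫⁻ t in Ioc 0 (r ^ 2), ENNReal.ofReal (32 * r ^ (-3 : ℝ) * t ^ (1 / 2 - β)) := by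
          refine setLIntegral_mono' measurableSet_Ioc fun t ht => ?_
          have ht0 : 0 < t := ht.1
          rw [hconv t ht0]
          refine ENNReal.ofReal_le_ofReal ((abs_normalFactor_mul_rpow_le ht0 hr).trans ?_)
          calc _ ≤ r * t ^ (-(3 / 2) - β) * (2 / (r ^ 2 / (4 * t)) ^ 2) := by
                gcongr; exact exp_neg_le_two_div_sq (by positivity)
            _ = 32 * r ^ (-3 : ℝ) * (t ^ (-(3 / 2) - β) * t ^ (2 : ℝ)) := by
                rw [Real.rpow_neg hr.le]
                norm_cast
                field_simp
                norm_num
            _ = _ := by rw [← Real.rpow_add ht0]; congr 2; ring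
      _ = ENNReal.ofReal (∫ t in Ioc 0 (r ^ 2), 32 * r ^ (-3 : ℝ) * t ^ (1 / 2 - β)) := by
          refine (ofReal_integral_eq_lintegral_ofReal ?_ ?_).symm
          · refine Integrable.const_mul ?_ _
            rw [← IntegrableOn, ← intervalIntegrable_iff_integrableOn_Ioc_of_le hr2.le]
            exact intervalIntegral.intervalIntegrable_rpow' (by linarith)
          · filter_upwards [ae_restrict_mem measurableSet_Ioc] with t ht
            have : 0 < t := ht.1
            positivity
      _ ≤ _ := by
          refine ENNReal.ofReal_le_ofReal ?_
          rw [integral_const_mul, ← intervalIntegral.integral_of_le hr2.le,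
            integral_rpow (Or.inl (by linarith)), Real.zero_rpow (by linarith), sub_zero, hpow,
            mul_div_assoc', mul_assoc, ← Real.rpow_add hr]
          have : -3 + 2 * (1 / 2 - β + 1) = -(2 * β) := by ring
          rw [this]
          exact div_le_self (by positivity) (by linarith)
  have h2 : ∫⁻ t in Ioi (r ^ 2), ‖normalFactor t r‖ₑ * ENNReal.ofReal (t ^ (-β))
      ≤ ENNReal.ofReal (2 * r ^ (-(2 * β))) := by
    calc _ ≤ ∫⁻ t in Ioi (r ^ 2), ENNReal.ofReal (r * t ^ (-(3 / 2) - β)) := by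
          refine setLIntegral_mono' measurableSet_Ioi fun t ht => ?_
          have ht0 : 0 < t := hr2.trans ht
          rw [hconv t ht0]
          refine ENNReal.ofReal_le_ofReal ((abs_normalFactor_mul_rpow_le ht0 hr).trans ?_)
          refine mul_le_of_le_one_right (by positivity) (Real.exp_le_one_iff.2 ?_)
          exact neg_nonpos.2 (by positivity)
      _ = ENNReal.ofReal (∫ t in Ioi (r ^ 2), r * t ^ (-(3 / 2) - β)) := by
          refine (ofReal_integral_eq_lintegral_ofReal ?_ ?_).symm
          · exact (integrableOn_Ioi_rpow_of_lt (by linarith) hr2).const_mul _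
          · filter_upwards [ae_restrict_mem measurableSet_Ioi] with t ht
            have : 0 < t := hr2.trans ht
            positivity
      _ ≤ _ := by
          refine ENNReal.ofReal_le_ofReal ?_
          rw [integral_const_mul, integral_Ioi_rpow_of_lt (by linarith) hr2, hpow]
          have e : r * r ^ (2 * (-(3 / 2) - β + 1)) = r ^ (-(2 * β)) := by
            nth_rewrite 1 [← Real.rpow_one r]
            rw [← Real.rpow_add hr]; congr 1; ring
          rw [mul_div_assoc', mul_neg, e, show -(3 / 2) - β + 1 = -(1 / 2 + β) by ring, neg_div_neg_eq,
            div_le_iff₀ (by linarith)]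
          have : 0 < r ^ (-(2 * β)) := by positivity
          nlinarith
  rw [← Ioc_union_Ioi_eq_Ioi hr2.le]
  refine (lintegral_union_le _ _ _).trans ((add_le_add h1 h2).trans_eq ?_)
  rw [← ENNReal.ofReal_add (by positivity) (by positivity)]
  congr 1; ring

/-- One of `r`, `X - r` is at least `X / 2`, so the product is at most `(X / 2)^{-1/2}` times the
sum of the two powers. Scaling removes `X`; the crude constant `8` replaces the exact value `π`. -/
lemma lintegral_beta_half_le {X : ℝ} (hX : 0 < X) :
    ∫⁻ r in Ioo 0 X, ENNReal.ofReal (r ^ (-(1 / 2) : ℝ) * (X - r) ^ (-(1 / 2) : ℝ))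
      ≤ ENNReal.ofReal 8 := by
  have hi := integrableOn_rpow_neg_half X
  have hi' := integrableOn_reflect hi
  have hv : ∫ r in Ioo 0 X, r ^ (-(1 / 2) : ℝ) = 2 * X ^ (1 / 2 : ℝ) := by
    rw [← integral_Ioc_eq_integral_Ioo, ← intervalIntegral.integral_of_le hX.le,
      integral_rpow (Or.inl (by norm_num)), Real.zero_rpow (by norm_num)]
    norm_num
    ring
  calc _ ≤ ∫⁻ r in Ioo 0 X, ENNReal.ofReal ((X / 2) ^ (-(1 / 2) : ℝ)
          * (r ^ (-(1 / 2) : ℝ) + (X - r) ^ (-(1 / 2) : ℝ))) := by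
        refine setLIntegral_mono' measurableSet_Ioo fun r hr => ENNReal.ofReal_le_ofReal ?_
        have hr1 : 0 < r := hr.1
        have hr2 : 0 < X - r := sub_pos.2 hr.2
        have p1 : 0 < r ^ (-(1 / 2) : ℝ) := by positivity
        have p2 : 0 < (X - r) ^ (-(1 / 2) : ℝ) := by positivity
        have p3 : 0 < (X / 2) ^ (-(1 / 2) : ℝ) := by positivity
        rcases le_total r (X / 2) with h | h
        · have : (X - r) ^ (-(1 / 2) : ℝ) ≤ (X / 2) ^ (-(1 / 2) : ℝ) :=
            Real.rpow_le_rpow_of_nonpos (by positivity) (by linarith) (by norm_num)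
          nlinarith [mul_pos p3 p2]
        · have : r ^ (-(1 / 2) : ℝ) ≤ (X / 2) ^ (-(1 / 2) : ℝ) :=
            Real.rpow_le_rpow_of_nonpos (by positivity) (by linarith) (by norm_num)
          nlinarith [mul_pos p3 p1]
    _ = ENNReal.ofReal (∫ r in Ioo 0 X, (X / 2) ^ (-(1 / 2) : ℝ)
          * (r ^ (-(1 / 2) : ℝ) + (X - r) ^ (-(1 / 2) : ℝ))) := by
        refine (ofReal_integral_eq_lintegral_ofReal ((hi.add hi').const_mul _) ?_).symm
        filter_upwards [ae_restrict_mem measurableSet_Ioo] with r hr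
        have hr1 : 0 < r := hr.1
        have hr2 : 0 < X - r := sub_pos.2 hr.2
        change 0 ≤ (X / 2) ^ (-(1 / 2) : ℝ) * (r ^ (-(1 / 2) : ℝ) + (X - r) ^ (-(1 / 2) : ℝ))
        positivity
    _ ≤ _ := by
        refine ENNReal.ofReal_le_ofReal ?_
        rw [integral_const_mul, integral_add hi hi',
          setIntegral_Ioo_reflect hX.le (fun s => s ^ (-(1 / 2) : ℝ)), hv,
          Real.div_rpow hX.le (by norm_num), div_mul_eq_mul_div, div_le_iff₀ (by positivity)]
        have e : X ^ (-(1 / 2) : ℝ) * X ^ (1 / 2 : ℝ) = 1 := by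
          rw [← Real.rpow_add hX]; norm_num
        have e2 : (1 / 2 : ℝ) ≤ 2 ^ (-(1 / 2) : ℝ) := by
          calc (1 / 2 : ℝ) = 2 ^ (-1 : ℝ) := by rw [Real.rpow_neg_one]; norm_num
            _ ≤ _ := Real.rpow_le_rpow_of_exponent_le (by norm_num) (by norm_num)
        nlinarith

/-- A kernel on `ℝ^{n-1} × (0, ∞)` whose `L¹` norm is at most `C`. -/
structure IsBoundedKernel (C : ℝ) (F : ℝ → Space d → ℝ) : Prop where
  measurable : Measurable fun p : ℝ × Space d => F p.1 p.2
  lintegral_le : ∫⁻ t in Ioi 0, ∫⁻ x, ‖F t x‖ₑ ≤ ENNReal.ofReal C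

lemma IsBoundedKernel.add {C D : ℝ} {F G : ℝ → Space d → ℝ} (hF : IsBoundedKernel C F)
    (hG : IsBoundedKernel D G) (hC : 0 ≤ C) (hD : 0 ≤ D) :
    IsBoundedKernel (C + D) fun t x => F t x + G t x := by
  have hFm := hF.measurable
  have hGm := hG.measurable
  refine ⟨by fun_prop, ?_⟩
  rw [ENNReal.ofReal_add hC hD]
  refine le_trans ?_ (add_le_add hF.lintegral_le hG.lintegral_le)
  have hF1 : Measurable fun t => ∫⁻ x, ‖F t x‖ₑ :=
    Measurable.lintegral_prod_right' (f := fun p : ℝ × Space d => ‖F p.1 p.2‖ₑ) (by fun_prop)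
  rw [← lintegral_add_left hF1]
  refine lintegral_mono fun t => ?_
  have hF2 : Measurable (F t) := hFm.of_uncurry_left (x := t)
  rw [← lintegral_add_left (by fun_prop)]
  exact lintegral_mono fun x => enorm_add_le _ _

lemma IsBoundedKernel.const_mul {C : ℝ} {F : ℝ → Space d → ℝ} (hF : IsBoundedKernel C F) (a : ℝ) :
    IsBoundedKernel (|a| * C) fun t x => a * F t x := by
  have hFm := hF.measurable
  refine ⟨by fun_prop, ?_⟩
  have hF1 : Measurable fun t => ∫⁻ x, ‖F t x‖ₑ :=
    Measurable.lintegral_prod_right' (f := fun p : ℝ × Space d => ‖F p.1 p.2‖ₑ) (by fun_prop)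
  have hF2 : ∀ t, Measurable (F t) := fun t => hFm.of_uncurry_left (x := t)
  simp only [enorm_mul]
  rw [lintegral_congr fun t => lintegral_const_mul _ (hF2 t).enorm, lintegral_const_mul _ hF1,
    ENNReal.ofReal_mul (abs_nonneg _), Real.enorm_eq_ofReal_abs]
  exact mul_le_mul_right hF.lintegral_le _

lemma IsBoundedKernel.sum {ι : Type*} (s : Finset ι) {C : ℝ} {F : ι → ℝ → Space d → ℝ}
    (hF : ∀ i, IsBoundedKernel C (F i)) (hC : 0 ≤ C) :
    IsBoundedKernel (s.card * C) fun t x => ∑ i ∈ s, F i t x := by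
  classical
  induction s using Finset.induction_on with
  | empty => exact ⟨by simp, by simp⟩
  | insert a s ha ih =>
    simp only [Finset.sum_insert ha, Finset.card_insert_of_notMem ha]
    have := (hF a).add ih hC (by positivity)
    convert this using 1
    push_cast; ring

lemma isBoundedKernel_heatKernelDn {X : ℝ} (hX : 0 < X) :
    IsBoundedKernel 34 fun t (x : Space d) => normalFactor t X * gauss t x := by
  have h1 : Measurable fun t => normalFactor t X := measurable_normalFactor.of_uncurry_right
  have h2 := measurable_gauss (d := d)
  refine ⟨by fun_prop, ?_⟩
  have := lintegral_normalFactor_le hX le_rfl (by norm_num)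
  simp only [neg_zero, mul_zero, Real.rpow_zero, mul_one, ENNReal.ofReal_one] at this
  refine le_trans (setLIntegral_mono' measurableSet_Ioi fun t ht => ?_) this
  simp only [enorm_mul]
  rw [lintegral_const_mul _ (by fun_prop)]
  refine (mul_le_of_le_one_right' (le_of_eq ?_))
  rw [← lintegral_gauss (d := d) ht]
  exact lintegral_congr fun x => Real.enorm_of_nonneg (gauss_nonneg _ _)

lemma measurable_kernelTan (i : Fin (d + 1)) (j : Fin d) (X : ℝ) :
    Measurable fun p : ℝ × Space d => kernelTan i j p.1 X p.2 := by
  unfold kernelTan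
  refine (StronglyMeasurable.integral_prod_right
    (f := fun (p : ℝ × Space d) (r : ℝ) => normalFactor p.1 r * convHess i j p.1 (X - r) p.2)
    ?_).measurable
  refine Measurable.stronglyMeasurable (Measurable.mul ?_ ?_)
  · exact measurable_normalFactor.comp
      (by fun_prop : Measurable fun q : (ℝ × Space d) × ℝ => (q.1.1, q.2))
  · have h : Measurable fun q : (ℝ × Space d) × ℝ => ((q.1.2, q.1.1), X - q.2) := by fun_prop
    exact (stronglyMeasurable_convHess i j).measurable.comp h

/-- The `L¹` bound of the kernels `L_ij` with tangential `j`. -/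
def tanConst (d : ℕ) : ℝ := flowConst d * 34 * 8

lemma tanConst_nonneg : 0 ≤ tanConst d := by
  have := flowConst_nonneg (d := d)
  unfold tanConst; positivity

/-- By Tonelli the space integral is done first, then time, then the normal variable. The exponents
match so that the last integral is the scale-invariant Beta integral, which is why the bound does
not see `X`. -/
lemma isBoundedKernel_kernelTan {X : ℝ} (hX : 0 < X) (i : Fin (d + 1)) (j : Fin d) :
    IsBoundedKernel (tanConst d) fun t x => kernelTan i j t X x := by
  refine ⟨measurable_kernelTan i j X, ?_⟩
  have hfl := flowConst_nonneg (d := d)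
  have hm1 : ∀ t, Measurable fun p : Space d × ℝ => ‖convHess i j t (X - p.2) p.1‖ₑ := fun t => by
    have h : Measurable fun p : Space d × ℝ => ((p.1, t), X - p.2) := by fun_prop
    have := (stronglyMeasurable_convHess i j).measurable.comp h
    simp only [Function.comp_def] at this
    exact this.enorm
  have hm2 : ∀ t s, Measurable fun x => ‖convHess i j t s x‖ₑ := fun t s => by
    have h : Measurable fun x : Space d => ((x, t), s) := by fun_prop
    have := (stronglyMeasurable_convHess i j).measurable.comp h
    simp only [Function.comp_def] at this
    exact this.enorm
  have hmn : Measurable fun p : ℝ × ℝ => ‖normalFactor p.1 p.2‖ₑ := measurable_normalFactor.enorm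
  have hmr : ∀ t, Measurable fun r => ‖normalFactor t r‖ₑ := fun t =>
    (continuous_normalFactor t).measurable.enorm
  have hmt : ∀ r, Measurable fun t => ‖normalFactor t r‖ₑ := fun r =>
    (measurable_normalFactor.of_uncurry_right (y := r)).enorm
  calc ∫⁻ t in Ioi 0, ∫⁻ x, ‖kernelTan i j t X x‖ₑ
      ≤ ∫⁻ t in Ioi 0, ∫⁻ r in Ioo 0 X, ‖normalFactor t r‖ₑ * ENNReal.ofReal (t ^ (-(1 / 4) : ℝ))
          * ENNReal.ofReal (flowConst d * (X - r) ^ (-(1 / 2) : ℝ)) := by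
        refine setLIntegral_mono' measurableSet_Ioi fun t ht => ?_
        calc ∫⁻ x, ‖kernelTan i j t X x‖ₑ
            ≤ ∫⁻ x, ∫⁻ r in Ioo 0 X, ‖normalFactor t r‖ₑ * ‖convHess i j t (X - r) x‖ₑ := by
              refine lintegral_mono fun x => (enorm_integral_le_lintegral_enorm _).trans_eq ?_
              simp only [enorm_mul]
          _ = ∫⁻ r in Ioo 0 X, ∫⁻ x, ‖normalFactor t r‖ₑ * ‖convHess i j t (X - r) x‖ₑ := by
              refine lintegral_lintegral_swap (Measurable.aemeasurable ?_)
              exact ((hmr t).comp measurable_snd).mul (hm1 t)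
          _ ≤ _ := by
              refine setLIntegral_mono' measurableSet_Ioo fun r hr => ?_
              rw [lintegral_const_mul _ (hm2 t _), mul_assoc]
              refine mul_le_mul_right ((lintegral_convHess_le ht (sub_pos.2 hr.2) i j).trans_eq ?_) _
              have : 0 < t := ht
              rw [← ENNReal.ofReal_mul (by positivity)]
              congr 1; ring
    _ = ∫⁻ r in Ioo 0 X, ∫⁻ t in Ioi 0, ‖normalFactor t r‖ₑ * ENNReal.ofReal (t ^ (-(1 / 4) : ℝ))
          * ENNReal.ofReal (flowConst d * (X - r) ^ (-(1 / 2) : ℝ)) := by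
        refine lintegral_lintegral_swap (Measurable.aemeasurable ?_)
        simp only [Function.uncurry_def]
        fun_prop
    _ ≤ ∫⁻ r in Ioo 0 X, ENNReal.ofReal (flowConst d * 34)
          * ENNReal.ofReal (r ^ (-(1 / 2) : ℝ) * (X - r) ^ (-(1 / 2) : ℝ)) := by
        refine setLIntegral_mono' measurableSet_Ioo fun r hr => ?_
        have hr0 : 0 < r := hr.1
        have hr1 : 0 < X - r := sub_pos.2 hr.2
        have hmt' : Measurable fun t => ‖normalFactor t r‖ₑ * ENNReal.ofReal (t ^ (-(1 / 4) : ℝ)) :=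
          (hmt r).mul (by fun_prop)
        rw [lintegral_mul_const _ hmt']
        refine (mul_le_mul_left (lintegral_normalFactor_le hr0 (by norm_num) le_rfl) _).trans_eq ?_
        rw [← ENNReal.ofReal_mul (by positivity), ← ENNReal.ofReal_mul (by positivity)]
        congr 1
        norm_num
        ring
    _ ≤ _ := by
        rw [lintegral_const_mul _ (by fun_prop)]
        refine (mul_le_mul_right (lintegral_beta_half_le hX) _).trans_eq ?_
        rw [← ENNReal.ofReal_mul (by positivity)]
        rfl

/-- A common bound for the integrable parts of the kernels `K_ij`. -/
def kernelConst (d : ℕ) : ℝ := |4 * layerMass d - 2| * 34 + 2 * 34 + 4 * (d + 1) * tanConst d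

lemma kernelConst_nonneg : 0 ≤ kernelConst d := by
  have := tanConst_nonneg (d := d)
  unfold kernelConst; positivity

lemma IsBoundedKernel.mono {C D : ℝ} {F : ℝ → Space d → ℝ} (hF : IsBoundedKernel C F)
    (h : C ≤ D) : IsBoundedKernel D F :=
  ⟨hF.measurable, hF.lintegral_le.trans (ENNReal.ofReal_le_ofReal h)⟩

lemma kernelK_castSucc_eq (hd : 2 ≤ d) {X : ℝ} (hX : 0 < X) (i : Fin (d + 1)) (j : Fin d) :
    ∃ F : ℝ → Space d → ℝ, IsBoundedKernel (kernelConst d) F ∧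
      ∀ t x, 0 < t → kernelK i j.castSucc (pt x X) t = F t x := by
  refine ⟨_, (((isBoundedKernel_heatKernelDn hX).const_mul
    (-2 * (if i = j.castSucc then 1 else 0))).add ((isBoundedKernel_kernelTan hX i j).const_mul 4)
      (by positivity) (mul_nonneg (abs_nonneg _) tanConst_nonneg)).mono ?_, fun t x ht => ?_⟩
  · have h1 := tanConst_nonneg (d := d)
    have h2 : |-2 * (if i = j.castSucc then 1 else 0 : ℝ)| ≤ 2 := by split_ifs <;> norm_num
    have h3 : 0 ≤ |4 * layerMass d - 2| := abs_nonneg _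
    have h4 : 0 ≤ (d : ℝ) * tanConst d := by positivity
    unfold kernelConst
    rw [abs_of_pos (zero_lt_four (α := ℝ))]
    nlinarith
  · unfold kernelK
    rw [kernelL_castSucc hd ht, heatKernelDn_pt ht]

/-- The diagonal term is absent since the indices differ; the non-integrable boundary term is kept
explicit, to be cancelled later by the gradient of `T`. -/
lemma kernelK_castSucc_last_eq (hd : 2 ≤ d) {X : ℝ} (hX : 0 < X) (k : Fin d) :
    ∃ F : ℝ → Space d → ℝ, IsBoundedKernel (kernelConst d) F ∧
      ∀ t x, 0 < t → kernelK k.castSucc (Fin.last d) (pt x X) t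
        = F t x + 4 * (normalFactor t X * convLaplaceDeriv k t x) := by
  refine ⟨_, ((isBoundedKernel_kernelTan hX (Fin.last d) k).const_mul 4).mono ?_, fun t x ht => ?_⟩
  · have h1 := tanConst_nonneg (d := d)
    have h3 : 0 ≤ |4 * layerMass d - 2| := abs_nonneg _
    have h4 : 0 ≤ (d : ℝ) * tanConst d := by positivity
    unfold kernelConst
    rw [abs_of_pos (zero_lt_four (α := ℝ))]
    nlinarith
  · unfold kernelK
    rw [kernelL_castSucc_last hd ht hX, if_neg (Fin.castSucc_lt_last k).ne]
    ring

lemma kernelK_last_last_eq (hd : 2 ≤ d) {X : ℝ} (hX : 0 < X) :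
    ∃ F : ℝ → Space d → ℝ, IsBoundedKernel (kernelConst d) F ∧
      ∀ t x, 0 < t → kernelK (Fin.last d) (Fin.last d) (pt x X) t = F t x := by
  have h1 := tanConst_nonneg (d := d)
  -- Classically `layerMass d = 1/2`, so this coefficient is zero; only the finiteness of
  -- `layerMass` is used.
  refine ⟨_, (((isBoundedKernel_heatKernelDn hX).const_mul (4 * layerMass d - 2)).add
    ((IsBoundedKernel.sum Finset.univ
      (fun k : Fin d => isBoundedKernel_kernelTan hX k.castSucc k) h1).const_mul (-4))
      (by positivity) (by positivity)).mono ?_, fun t x ht => ?_⟩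
  · unfold kernelConst
    rw [Finset.card_univ, Fintype.card_fin, abs_neg, abs_of_pos (zero_lt_four (α := ℝ))]
    nlinarith
  · unfold kernelK
    rw [kernelL_last_last hd ht hX, heatKernelDn_pt ht, if_pos rfl]
    ring

/-! ### Decay of the kernels of the potentials -/

/-- The heat flow of `E(·, 0)` on the boundary. -/
def convLaplace (t : ℝ) (x : Space d) : ℝ :=
  ∫ z : Space d, gauss t (x - z) * laplaceKernel (pt z 0)

lemma kappa_pt {t : ℝ} (ht : 0 < t) (x : Space d) (X : ℝ) :
    kappa (pt x X) t = normalFactor t X * convLaplace t x := by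
  unfold kappa convLaplace
  rw [← integral_const_mul]
  refine integral_congr_ae (ae_of_all _ fun z => ?_)
  simp only
  rw [pt_sub_pt, sub_zero, heatKernelDn_pt ht, mul_assoc]

lemma measurable_convLaplace : Measurable fun p : ℝ × Space d => convLaplace p.1 p.2 := by
  unfold convLaplace
  refine (StronglyMeasurable.integral_prod_right
    (f := fun (p : ℝ × Space d) (z : Space d) => gauss p.1 (p.2 - z) * laplaceKernel (pt z 0))
    ?_).measurable
  refine Measurable.stronglyMeasurable (Measurable.mul ?_ ?_)
  · exact measurable_gauss.comp
      (by fun_prop : Measurable fun q : (ℝ × Space d) × Space d => (q.1.1, q.1.2 - q.2))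
  · exact (measurable_laplaceKernel_pt 0).comp measurable_snd

lemma measurable_convLaplaceDeriv (k : Fin d) :
    Measurable fun p : ℝ × Space d => convLaplaceDeriv k p.1 p.2 := by
  unfold convLaplaceDeriv
  refine (StronglyMeasurable.integral_prod_right
    (f := fun (p : ℝ × Space d) (z : Space d) => gaussDeriv k p.1 (p.2 - z) * laplaceKernel (pt z 0))
    ?_).measurable
  refine Measurable.stronglyMeasurable (Measurable.mul ?_ ?_)
  · exact (measurable_gaussDeriv k).comp
      (by fun_prop : Measurable fun q : (ℝ × Space d) × Space d => (q.1.1, q.1.2 - q.2))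
  · exact (measurable_laplaceKernel_pt 0).comp measurable_snd

/-- Peetre's inequality. It moves polynomial weights through convolutions. -/
lemma one_add_norm_le_mul (x y : Space d) : 1 + ‖y‖ ≤ (1 + ‖x‖) * (1 + ‖x - y‖) := by
  have h : ‖y‖ ≤ ‖x‖ + ‖x - y‖ := by
    calc ‖y‖ = ‖x - (x - y)‖ := by rw [sub_sub_cancel]
      _ ≤ _ := norm_sub_le _ _
  nlinarith [norm_nonneg x, norm_nonneg (x - y), mul_nonneg (norm_nonneg x) (norm_nonneg (x - y))]

/-- A singular factor in time that bounds the heat kernel and its first derivatives. -/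
def timeFactor (d : ℕ) (t : ℝ) : ℝ := 1 / Real.sqrt (4 * Real.pi * t) ^ d * (1 + 1 / (2 * t))

lemma timeFactor_nonneg {t : ℝ} (ht : 0 < t) : 0 ≤ timeFactor d t := by
  unfold timeFactor; positivity

/-- For `t ≤ T` the Gaussian exponential at time `t` is at most the one at time `T`, and half of the
latter beats any polynomial weight. All singular behaviour as `t → 0` is put into `timeFactor`. -/
lemma gauss_weight_le {T : ℝ} (hT : 0 < T) :
    ∃ C : ℝ, 0 ≤ C ∧ ∀ t, 0 < t → t ≤ T → ∀ w : Space d,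
      (1 + ‖w‖) ^ (d - 1) * gauss t w ≤ timeFactor d t * (C * gauss (2 * T) w) ∧
      ∀ k, (1 + ‖w‖) ^ (d - 1) * |gaussDeriv k t w| ≤ timeFactor d t * (C * gauss (2 * T) w) := by
  set S : ℝ := Real.sqrt (4 * Real.pi * (2 * T)) ^ d with hS
  have hS0 : 0 < S := by positivity
  set C : ℝ := (d.factorial : ℝ) * Real.exp (1 + 2 * T) * S with hC
  refine ⟨C, by positivity, fun t ht htT w => ?_⟩
  set u := ‖w‖ with hu
  have hu0 : 0 ≤ u := norm_nonneg w
  -- One power more than the weight `d - 1` requires: it pays for the factor `w k` in the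
  -- derivative.
  have key : (1 + u) ^ d * Real.exp (-u ^ 2 / (4 * t)) ≤ C * gauss (2 * T) w := by
    have h1 : (1 + u) ^ d ≤ (d.factorial : ℝ) * Real.exp (1 + u) := by
      have := Real.pow_div_factorial_le_exp (1 + u) (by positivity) d
      rwa [div_le_iff₀ (by positivity), mul_comm] at this
    have h2 : Real.exp (-u ^ 2 / (4 * t)) ≤ Real.exp (-u ^ 2 / (4 * T)) := by
      refine Real.exp_le_exp.2 ?_
      rw [neg_div, neg_div]
      exact neg_le_neg (by gcongr)
    have h3 : Real.exp (1 + u) * Real.exp (-u ^ 2 / (4 * T))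
        ≤ Real.exp (1 + 2 * T) * Real.exp (-u ^ 2 / (4 * (2 * T))) := by
      rw [← Real.exp_add, ← Real.exp_add]
      refine Real.exp_le_exp.2 ?_
      have : -u ^ 2 / (4 * T) = -u ^ 2 / (4 * (2 * T)) - u ^ 2 / (8 * T) := by field_simp; ring
      rw [this]
      have h4 : u ≤ 2 * T + u ^ 2 / (8 * T) := by
        have e : 2 * T + u ^ 2 / (8 * T) = (16 * T ^ 2 + u ^ 2) / (8 * T) := by
          field_simp; ring
        rw [e, le_div_iff₀ (by positivity)]
        nlinarith [sq_nonneg (u - 4 * T)]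
      linarith
    calc _ ≤ ((d.factorial : ℝ) * Real.exp (1 + u)) * Real.exp (-u ^ 2 / (4 * T)) := by gcongr
      _ = (d.factorial : ℝ) * (Real.exp (1 + u) * Real.exp (-u ^ 2 / (4 * T))) := by ring
      _ ≤ (d.factorial : ℝ) * (Real.exp (1 + 2 * T) * Real.exp (-u ^ 2 / (4 * (2 * T)))) := by
          gcongr
      _ = C * gauss (2 * T) w := by
          unfold gauss
          rw [← hS, hC, ← hu]
          field_simp
  have hp1 : (1 + u) ^ (d - 1) ≤ (1 + u) ^ d :=
    pow_le_pow_right₀ (by linarith) (Nat.sub_le _ _)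
  have hg0 : 0 ≤ C * gauss (2 * T) w := mul_nonneg (by positivity) (gauss_nonneg _ _)
  constructor
  · unfold timeFactor
    nth_rewrite 1 [gauss]
    rw [← hu]
    calc _ ≤ (1 + u) ^ d * (1 / Real.sqrt (4 * Real.pi * t) ^ d
            * Real.exp (-u ^ 2 / (4 * t))) := by gcongr
      _ = 1 / Real.sqrt (4 * Real.pi * t) ^ d * 1
            * ((1 + u) ^ d * Real.exp (-u ^ 2 / (4 * t))) := by ring
      _ ≤ _ := by
          gcongr
          exact le_add_of_nonneg_right (by positivity)
  · intro k
    have hd : 1 ≤ d := by have := k.isLt; omega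
    have hk : |w k| ≤ u := by
      rw [← Real.norm_eq_abs]; exact PiLp.norm_apply_le w k
    unfold timeFactor gaussDeriv
    rw [abs_mul, abs_neg, abs_div, abs_of_pos (by positivity : 0 < 2 * t),
      abs_of_nonneg (gauss_nonneg _ _)]
    nth_rewrite 1 [gauss]
    rw [← hu]
    calc _ ≤ (1 + u) ^ (d - 1) * ((1 + u) / (2 * t) * (1 / Real.sqrt (4 * Real.pi * t) ^ d
            * Real.exp (-u ^ 2 / (4 * t)))) := by gcongr; linarith
      _ = 1 / Real.sqrt (4 * Real.pi * t) ^ d * (1 / (2 * t))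
            * ((1 + u) ^ (d - 1 + 1) * Real.exp (-u ^ 2 / (4 * t))) := by rw [pow_succ]; ring
      _ ≤ _ := by
          rw [Nat.sub_add_cancel hd]
          gcongr
          linarith

lemma pow_mul_radialPow_le (hd : 2 ≤ d) {z : Space d} (hz : z ≠ 0) :
    (1 + ‖z‖) ^ (d - 1) * radialPow (d - 1) z 0 ≤ 2 ^ (d - 1) * (1 + radialPow (d - 1) z 0) := by
  have hz0 : 0 < ‖z‖ := norm_pos_iff.2 hz
  have e : radialPow ((d : ℝ) - 1) z 0 = (‖z‖ ^ (d - 1))⁻¹ := by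
    rw [radialPow_zero_right, Real.rpow_neg hz0.le, ← Real.rpow_natCast,
      Nat.cast_sub (by omega), Nat.cast_one]
  rw [e]
  rcases le_total 1 ‖z‖ with h | h
  · calc _ ≤ (2 * ‖z‖) ^ (d - 1) * (‖z‖ ^ (d - 1))⁻¹ := by gcongr; linarith
      _ = 2 ^ (d - 1) * 1 := by rw [mul_pow, mul_assoc, mul_inv_cancel₀ (by positivity)]
      _ ≤ _ := by gcongr; exact le_add_of_nonneg_right (by positivity)
  · calc _ ≤ 2 ^ (d - 1) * (‖z‖ ^ (d - 1))⁻¹ := by gcongr; linarith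
      _ ≤ _ := by gcongr; exact le_add_of_nonneg_left zero_le_one

/-- Away from the boundary, `exp(-X^2 / (4t))` beats every negative power of `t`. With `v = 1/t`,
all powers are collected as `(1 + v)^{d+3}`: one from `X / (2t)`, one from the square root, `d + 1`
from `timeFactor`. -/
lemma normalFactor_mul_timeFactor_le {X : ℝ} (hX : 0 < X) :
    ∃ C : ℝ, 0 ≤ C ∧ ∀ t, 0 < t → |normalFactor t X| * timeFactor d t ≤ C := by
  set a := X ^ 2 / 4 with ha
  have ha0 : 0 < a := by positivity
  refine ⟨X * ((d + 3).factorial * Real.exp a / a ^ (d + 3)), by positivity, fun t ht => ?_⟩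
  set v := 1 / t with hv
  have hv0 : 0 < v := by positivity
  have hq : 1 / Real.sqrt (4 * Real.pi * t) ≤ 1 + v := by
    have h1 : Real.sqrt t ≤ Real.sqrt (4 * Real.pi * t) :=
      Real.sqrt_le_sqrt (by nlinarith [Real.pi_gt_three])
    have hs0 : 0 < Real.sqrt t := Real.sqrt_pos.2 ht
    have h2 : v = (1 / Real.sqrt t) ^ 2 := by rw [div_pow, Real.sq_sqrt ht.le, one_pow]
    calc 1 / Real.sqrt (4 * Real.pi * t) ≤ 1 / Real.sqrt t := by gcongr
      _ ≤ 1 + v := by rw [h2]; nlinarith [sq_nonneg (1 / Real.sqrt t - 1)]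
  have hexp : (1 + v) ^ (d + 3) * Real.exp (-(a * v))
      ≤ (d + 3).factorial * Real.exp a / a ^ (d + 3) := by
    have := Real.pow_div_factorial_le_exp (a * (1 + v)) (by positivity) (d + 3)
    rw [div_le_iff₀ (by positivity), mul_pow, mul_add, mul_one, Real.exp_add] at this
    rw [Real.exp_neg, le_div_iff₀ (by positivity), ← div_eq_mul_inv, div_mul_eq_mul_div,
      div_le_iff₀ (Real.exp_pos _)]
    linarith
  unfold normalFactor timeFactor
  rw [abs_mul, abs_mul, abs_neg, abs_of_pos (Real.exp_pos _),
    abs_of_nonneg (by positivity : 0 ≤ X / (2 * t)),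
    abs_of_pos (by positivity : 0 < 1 / Real.sqrt (4 * Real.pi * t)),
    show -X ^ 2 / (4 * t) = -(a * v) by rw [ha, hv]; field_simp,
    show X / (2 * t) = X * (v / 2) by rw [hv]; field_simp,
    show 1 / (2 * t) = v / 2 by rw [hv]; field_simp, ← one_div_pow]
  calc _ ≤ X * (1 + v) * (1 + v) * Real.exp (-(a * v)) * ((1 + v) ^ d * (1 + v)) := by
        gcongr <;> linarith
    _ = X * ((1 + v) ^ (d + 3) * Real.exp (-(a * v))) := by ring
    _ ≤ _ := by gcongr

/-- Bound of the heat flow of a singular kernel, weighted by a power of the distance. -/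
lemma weighted_convolution_le (hd : 2 ≤ d) {T : ℝ} (hT : 0 < T) :
    ∃ C : ℝ, 0 ≤ C ∧ ∀ (G : Space d → ℝ) (A : ℝ), 0 ≤ A →
      (∀ w, (1 + ‖w‖) ^ (d - 1) * |G w| ≤ A * gauss (2 * T) w) → ∀ x : Space d,
      (1 + ‖x‖) ^ (d - 1) * |∫ z : Space d, G (x - z) * laplaceKernel (pt z 0)| ≤ A * C := by
  have hd' : (2 : ℝ) ≤ d := by exact_mod_cast hd
  have h2T : 0 < 2 * T := by positivity
  obtain ⟨C, hC, h⟩ := singular_convolution (d := d) (p := d - 1) hd (by linarith) (by linarith)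
    (gauss_nonneg (2 * T)) (gauss_le_sup (2 * T) h2T) (integrable_gauss h2T)
  have hl := laplaceConst_nonneg hd
  refine ⟨laplaceConst d * 2 ^ (d - 1) * (1 + C), by positivity, fun G A hA hG x => ?_⟩
  have hint : Integrable fun z : Space d =>
      gauss (2 * T) (x - z) + gauss (2 * T) (x - z) * radialPow (d - 1) z 0 :=
    ((integrable_gauss h2T).comp_sub_left x).add (h x).1
  have hx : 0 < (1 + ‖x‖) ^ (d - 1) := by positivity
  rw [← abs_of_pos hx, ← abs_mul, ← integral_const_mul, ← Real.norm_eq_abs]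
  have hb : ‖∫ z : Space d, (1 + ‖x‖) ^ (d - 1) * (G (x - z) * laplaceKernel (pt z 0))‖
      ≤ ∫ z : Space d, A * (laplaceConst d * 2 ^ (d - 1)) *
        (gauss (2 * T) (x - z) + gauss (2 * T) (x - z) * radialPow (d - 1) z 0) := by
    refine norm_integral_le_of_norm_le (hint.const_mul _) ?_
    filter_upwards [ae_ne_zero hd] with z hz
    have h1 : (1 + ‖x‖) ^ (d - 1) ≤ (1 + ‖x - z‖) ^ (d - 1) * (1 + ‖z‖) ^ (d - 1) := by
      rw [← mul_pow]
      have := one_add_norm_le_mul (x - z) x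
      rw [sub_sub_cancel_left, norm_neg] at this
      gcongr
    have h2 := radialPow_nonneg (d - 1) z 0
    have h3 := gauss_nonneg (2 * T) (x - z)
    rw [norm_mul, norm_mul, Real.norm_of_nonneg hx.le, Real.norm_eq_abs, Real.norm_eq_abs,
      abs_laplaceKernel_pt hd]
    calc _ ≤ (1 + ‖x - z‖) ^ (d - 1) * (1 + ‖z‖) ^ (d - 1)
          * (|G (x - z)| * (laplaceConst d * radialPow (d - 1) z 0)) := by gcongr
      _ = ((1 + ‖x - z‖) ^ (d - 1) * |G (x - z)|)
          * (laplaceConst d * ((1 + ‖z‖) ^ (d - 1) * radialPow (d - 1) z 0)) := by ring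
      _ ≤ (A * gauss (2 * T) (x - z))
          * (laplaceConst d * (2 ^ (d - 1) * (1 + radialPow (d - 1) z 0))) := by
            refine mul_le_mul (hG _) (mul_le_mul_of_nonneg_left (pow_mul_radialPow_le hd hz) hl)
              (by positivity) (by positivity)
      _ = _ := by ring
  refine hb.trans ?_
  rw [integral_const_mul, integral_add ((integrable_gauss h2T).comp_sub_left x) (h x).1,
    integral_sub_left_eq_self (fun z => gauss (2 * T) z) volume x, integral_gauss h2T]
  calc _ ≤ A * (laplaceConst d * 2 ^ (d - 1)) * (1 + C) := by gcongr; exact (h x).2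
    _ = _ := by ring

/-- The heat flow preserves the decay `|x|^{-(d-1)}` of `E(·, 0)`, and `normalFactor` kills the
singularity at `t = 0`. The constant depends on `X` and `T`, which is harmless as it only serves the
convergence and differentiability of `T(g_n)`. -/
lemma kappa_decay (hd : 2 ≤ d) {X T : ℝ} (hX : 0 < X) (hT : 0 < T) :
    ∃ K : ℝ, 0 ≤ K ∧ ∀ t, 0 < t → t ≤ T → ∀ x : Space d,
      |normalFactor t X * convLaplace t x| ≤ K / (1 + ‖x‖) ^ (d - 1) ∧
      ∀ k, |normalFactor t X * convLaplaceDeriv k t x| ≤ K / (1 + ‖x‖) ^ (d - 1) := by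
  obtain ⟨C1, hC1, h1⟩ := gauss_weight_le (d := d) hT
  obtain ⟨C2, hC2, h2⟩ := normalFactor_mul_timeFactor_le (d := d) hX
  obtain ⟨C3, hC3, h3⟩ := weighted_convolution_le hd hT
  refine ⟨C2 * C1 * C3, by positivity, fun t ht htT x => ?_⟩
  have hτ := timeFactor_nonneg (d := d) ht
  have main : ∀ G : Space d → ℝ,
      (∀ w, (1 + ‖w‖) ^ (d - 1) * |G w| ≤ timeFactor d t * (C1 * gauss (2 * T) w)) →
      |normalFactor t X * ∫ z : Space d, G (x - z) * laplaceKernel (pt z 0)|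
        ≤ C2 * C1 * C3 / (1 + ‖x‖) ^ (d - 1) := by
    intro G hG
    have := h3 G (timeFactor d t * C1) (by positivity) (fun w => (hG w).trans_eq (by ring)) x
    rw [le_div_iff₀ (by positivity), abs_mul]
    calc _ = |normalFactor t X| * ((1 + ‖x‖) ^ (d - 1)
          * |∫ z : Space d, G (x - z) * laplaceKernel (pt z 0)|) := by ring
      _ ≤ |normalFactor t X| * (timeFactor d t * C1 * C3) := by gcongr
      _ = (|normalFactor t X| * timeFactor d t) * C1 * C3 := by ring
      _ ≤ _ := by gcongr; exact h2 t ht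
  refine ⟨main (gauss t) fun w => ?_, fun k => main (gaussDeriv k t) fun w => ?_⟩
  · rw [abs_of_nonneg (gauss_nonneg _ _)]
    exact (h1 t ht htT w).1
  · exact (h1 t ht htT w).2 k

/-- From `‖x‖^2 ≤ 2 ‖x + v‖^2 + 2 ‖v‖^2`: doubling the time absorbs a bounded translation. This
gives a majorant uniform over small tangential increments. -/
lemma gauss_shift_le {t : ℝ} (ht : 0 < t) (x v : Space d) :
    gauss t (x + v) ≤ slopeConst d * Real.exp (‖v‖ ^ 2 / (4 * t)) * gauss (2 * t) x := by
  unfold gauss slopeConst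
  have : Real.sqrt (4 * Real.pi * (2 * t)) = Real.sqrt 2 * Real.sqrt (4 * Real.pi * t) := by
    rw [← Real.sqrt_mul (by norm_num)]; congr 1; ring
  have h1 : Real.exp (-‖x + v‖ ^ 2 / (4 * t))
      ≤ Real.exp (‖v‖ ^ 2 / (4 * t)) * Real.exp (-‖x‖ ^ 2 / (4 * (2 * t))) := by
    rw [← Real.exp_add]
    refine Real.exp_le_exp.2 ?_
    have h2 : ‖x‖ ^ 2 ≤ 2 * ‖x + v‖ ^ 2 + 2 * ‖v‖ ^ 2 := by
      have : ‖x‖ ≤ ‖x + v‖ + ‖v‖ := by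
        calc ‖x‖ = ‖x + v - v‖ := by rw [add_sub_cancel_right]
          _ ≤ _ := norm_sub_le _ _
      nlinarith [sq_nonneg (‖x + v‖ - ‖v‖), norm_nonneg x]
    have h3 : -‖x + v‖ ^ 2 / (4 * t) = -(2 * ‖x + v‖ ^ 2) / (8 * t) := by field_simp; ring
    have h4 : ‖v‖ ^ 2 / (4 * t) + -‖x‖ ^ 2 / (4 * (2 * t))
        = (2 * ‖v‖ ^ 2 - ‖x‖ ^ 2) / (8 * t) := by field_simp; ring
    rw [h3, h4]
    gcongr
    linarith
  rw [this, mul_pow]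
  calc _ ≤ 1 / Real.sqrt (4 * Real.pi * t) ^ d * (Real.exp (‖v‖ ^ 2 / (4 * t))
        * Real.exp (-‖x‖ ^ 2 / (4 * (2 * t)))) := by gcongr
    _ = _ := by field_simp

/-- The derivative falls on the Gaussian. The majorant for increments less than one combines the
gradient bound, which passes to time `2t`, with the shift bound, which passes to time `4t`. -/
lemma hasDerivAt_convLaplace (hd : 2 ≤ d) {t : ℝ} (ht : 0 < t) (k : Fin d) (x : Space d) (h : ℝ) :
    HasDerivAt (fun h : ℝ => convLaplace t (x + h • EuclideanSpace.single k (1 : ℝ)))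
      (convLaplaceDeriv k t (x + h • EuclideanSpace.single k (1 : ℝ))) h := by
  have hd' : (2 : ℝ) ≤ d := by exact_mod_cast hd
  have hl := laplaceConst_nonneg hd
  have hsl := slopeConst_pos (d := d)
  have hsing : ∀ τ : ℝ, 0 < τ → ∀ y : Space d,
      Integrable fun z => gauss τ (y - z) * radialPow (d - 1) z 0 := fun τ hτ y => by
    obtain ⟨C, -, hC⟩ := singular_convolution (d := d) (p := d - 1) hd (by linarith) (by linarith)
      (gauss_nonneg τ) (gauss_le_sup τ hτ) (integrable_gauss hτ)
    exact (hC y).1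
  have hEm := measurable_laplaceKernel_pt (d := d) 0
  set e : Space d := EuclideanSpace.single k (1 : ℝ) with he
  have h2t : 0 < 2 * t := by positivity
  refine (hasDerivAt_integral_of_dominated_loc_of_deriv_le
    (F := fun h z => gauss t (x + h • e - z) * laplaceKernel (pt z 0))
    (F' := fun h z => gaussDeriv k t (x + h • e - z) * laplaceKernel (pt z 0))
    (bound := fun z => slopeConst d / Real.sqrt t * (slopeConst d * Real.exp (1 / (4 * (2 * t))))
      * laplaceConst d * (gauss (2 * (2 * t)) (x + h • e - z) * radialPow (d - 1) z 0))
    (Metric.ball_mem_nhds h zero_lt_one) ?_ ?_ ?_ ?_ ?_ ?_).2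
  · exact Eventually.of_forall fun h =>
      (Measurable.mul (by fun_prop) hEm).aestronglyMeasurable
  · refine ((hsing t ht (x + h • e)).const_mul (laplaceConst d)).mono'
      (Measurable.mul (by fun_prop) hEm).aestronglyMeasurable (ae_of_all _ fun z => ?_)
    rw [norm_mul, Real.norm_of_nonneg (gauss_nonneg _ _), Real.norm_eq_abs,
      abs_laplaceKernel_pt hd]
    exact le_of_eq (by ring)
  · exact (Measurable.mul (by fun_prop) hEm).aestronglyMeasurable
  · refine ae_of_all _ fun z h' hh' => ?_
    have h1 := abs_gaussDeriv_le ht k (x + h' • e - z)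
    have h2 := gauss_shift_le h2t (x + h • e - z) ((h' - h) • e)
    rw [show x + h • e - z + (h' - h) • e = x + h' • e - z by rw [sub_smul]; abel] at h2
    have h3 : ‖(h' - h) • e‖ ^ 2 ≤ 1 := by
      rw [norm_smul, he, PiLp.norm_single, norm_one, mul_one]
      have : ‖h' - h‖ < 1 := by simpa [dist_eq_norm] using hh'
      exact pow_le_one₀ (norm_nonneg _) this.le
    have h4 := radialPow_nonneg (d - 1) z 0
    have h5 := gauss_nonneg (2 * (2 * t)) (x + h • e - z)
    rw [norm_mul, Real.norm_eq_abs, Real.norm_eq_abs, abs_laplaceKernel_pt hd]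
    calc _ ≤ slopeConst d / Real.sqrt t * (slopeConst d * Real.exp (1 / (4 * (2 * t)))
          * gauss (2 * (2 * t)) (x + h • e - z)) * (laplaceConst d * radialPow (d - 1) z 0) := by
          refine mul_le_mul_of_nonneg_right (h1.trans ?_) (by positivity)
          refine mul_le_mul_of_nonneg_left (h2.trans ?_) (by positivity)
          gcongr
      _ = _ := by ring
  · exact (hsing _ (by positivity) _).const_mul _
  · refine ae_of_all _ fun z h' _ => HasDerivAt.mul_const ?_ _
    have := hasDerivAt_gauss_line t (x - z) k h'
    have e' : ∀ h : ℝ, x - z + h • EuclideanSpace.single k (1 : ℝ) = x + h • e - z :=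
      fun h => by rw [he]; abel
    simpa only [e'] using this

/-- For fixed `X > 0` one has `1 + ‖w‖ ≤ (2 + 1/X) √(‖w‖^2 + X^2)`; the extra power in the second
bound costs another `1/X`. -/
lemma radialPow_decay (hd : 2 ≤ d) {X : ℝ} (hX : 0 < X) :
    ∃ K : ℝ, 0 ≤ K ∧ ∀ w : Space d, radialPow (d - 1) w X ≤ K / (1 + ‖w‖) ^ (d - 1) ∧
      radialPow d w X ≤ K / (1 + ‖w‖) ^ (d - 1) := by
  have hd' : (2 : ℝ) ≤ d := by exact_mod_cast hd
  set m := 1 + 1 / X with hm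
  have hm0 : 0 < m := by positivity
  set a := (1 + m) ^ (d - 1) with ha
  refine ⟨a * (1 + 1 / X), by positivity, fun w => ?_⟩
  have hs0 : 0 < Real.sqrt (‖w‖ ^ 2 + X ^ 2) := Real.sqrt_pos.2 (sum_sq_pos w hX)
  have hsX : X ≤ Real.sqrt (‖w‖ ^ 2 + X ^ 2) := Real.le_sqrt_of_sq_le (by simp)
  have hsw : ‖w‖ ≤ Real.sqrt (‖w‖ ^ 2 + X ^ 2) := Real.le_sqrt_of_sq_le (by simp [sq_nonneg])
  have h1 : 1 + ‖w‖ ≤ (1 + m) * Real.sqrt (‖w‖ ^ 2 + X ^ 2) := by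
    have : 1 ≤ m * Real.sqrt (‖w‖ ^ 2 + X ^ 2) := by
      calc (1 : ℝ) ≤ m * X := by rw [hm]; field_simp; linarith
        _ ≤ _ := by gcongr
    linarith
  have e1 : radialPow ((d : ℝ) - 1) w X = (Real.sqrt (‖w‖ ^ 2 + X ^ 2) ^ (d - 1))⁻¹ := by
    unfold radialPow
    rw [Real.sqrt_eq_rpow, ← Real.rpow_mul_natCast (by positivity),
      ← Real.rpow_neg (by positivity), Nat.cast_sub (by omega), Nat.cast_one]
    congr 1; ring
  have h2 : radialPow (d - 1) w X ≤ a / (1 + ‖w‖) ^ (d - 1) := by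
    rw [e1, le_div_iff₀ (by positivity), inv_mul_le_iff₀ (by positivity), ha, ← mul_pow, mul_comm]
    gcongr
  have h3 : radialPow d w X ≤ (1 / X) * radialPow (d - 1) w X := by
    have := sqrt_mul_radialPow ((d : ℝ) - 1) w hX
    rw [sub_add_cancel] at this
    rw [← this, one_div, ← div_eq_inv_mul, le_div_iff₀ hX, mul_comm]
    exact mul_le_mul_of_nonneg_right hsX (radialPow_nonneg _ _ _)
  have hb : 0 ≤ a / (1 + ‖w‖) ^ (d - 1) := by positivity
  have hX' : 0 < 1 / X := by positivity
  constructor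
  · refine h2.trans ?_
    rw [mul_div_right_comm]
    exact le_mul_of_one_le_right hb (by linarith)
  · refine h3.trans ((mul_le_mul_of_nonneg_left h2 hX'.le).trans ?_)
    rw [mul_div_right_comm, mul_comm]
    exact mul_le_mul_of_nonneg_left (by linarith) hb

/-! ### Potentials with decaying kernels -/

section Potential

variable {α : Type*} [MeasurableSpace α] {μ : Measure α} {y : α → Space d} {f : α → ℝ}
  {k k' : Space d → α → ℝ} {K : ℝ}

lemma aestronglyMeasurable_of_weighted (hy : Measurable y)
    (hf : Integrable (fun a => f a / (1 + ‖y a‖) ^ (d - 1)) μ) : AEStronglyMeasurable f μ := by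
  have h1 : Measurable fun a => (1 + ‖y a‖) ^ (d - 1) := by fun_prop
  refine (hf.aestronglyMeasurable.mul h1.aestronglyMeasurable).congr (ae_of_all _ fun a => ?_)
  have : (1 + ‖y a‖) ^ (d - 1) ≠ 0 := by positivity
  exact div_mul_cancel₀ _ this

/-- Peetre's inequality exchanges the decay of the kernel for the weight of the density. The shift
`v` is kept apart so that the bound is uniform over bounded increments of `x`. -/
lemma abs_potential_le {b x v : Space d} {κ φ : ℝ} (hK : 0 ≤ K)
    (hκ : |κ| ≤ K / (1 + ‖x + v - b‖) ^ (d - 1)) :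
    |κ * φ| ≤ K * (1 + (‖x‖ + ‖v‖)) ^ (d - 1) * |φ / (1 + ‖b‖) ^ (d - 1)| := by
  have h1 : (1 + ‖b‖) ^ (d - 1) ≤ (1 + (‖x‖ + ‖v‖)) ^ (d - 1) * (1 + ‖x + v - b‖) ^ (d - 1) := by
    rw [← mul_pow]
    have h2 := one_add_norm_le_mul (x + v) b
    have h3 := norm_add_le x v
    gcongr
    exact h2.trans (by gcongr)
  rw [abs_mul, abs_div, abs_of_pos (by positivity : 0 < (1 + ‖b‖) ^ (d - 1)), mul_div_assoc',
    le_div_iff₀ (by positivity)]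
  calc |κ| * |φ| * (1 + ‖b‖) ^ (d - 1)
      ≤ K / (1 + ‖x + v - b‖) ^ (d - 1) * |φ|
        * ((1 + (‖x‖ + ‖v‖)) ^ (d - 1) * (1 + ‖x + v - b‖) ^ (d - 1)) := by gcongr
    _ = _ := by
        have : (1 + ‖x + v - b‖) ^ (d - 1) ≠ 0 := by positivity
        field_simp

lemma integrable_potential (hy : Measurable y)
    (hf : Integrable (fun a => f a / (1 + ‖y a‖) ^ (d - 1)) μ)
    (hk : Measurable fun p : Space d × α => k p.1 p.2) (hK : 0 ≤ K)
    (hkK : ∀ᵐ a ∂μ, ∀ w, |k w a| ≤ K / (1 + ‖w‖) ^ (d - 1)) (x : Space d) :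
    Integrable (fun a => k (x - y a) a * f a) μ := by
  have hm : Measurable fun a => (x - y a, a) := by fun_prop
  refine (hf.abs.const_mul (K * (1 + (‖x‖ + ‖(0 : Space d)‖)) ^ (d - 1))).mono'
    ((hk.comp hm).aestronglyMeasurable.mul (aestronglyMeasurable_of_weighted hy hf)) ?_
  filter_upwards [hkK] with a ha
  refine abs_potential_le hK ?_
  rw [add_zero]
  exact ha _

/-- Stated over an abstract measure space with a position map `y`, so that it covers both `S` (over
`ℝ^d`) and `T` (over the lateral boundary, with a kernel depending on time as well). -/
lemma hasDerivAt_potential (hy : Measurable y)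
    (hf : Integrable (fun a => f a / (1 + ‖y a‖) ^ (d - 1)) μ)
    (hk : Measurable fun p : Space d × α => k p.1 p.2)
    (hk' : Measurable fun p : Space d × α => k' p.1 p.2) (hK : 0 ≤ K)
    (hkK : ∀ᵐ a ∂μ, ∀ w, |k w a| ≤ K / (1 + ‖w‖) ^ (d - 1))
    (hkK' : ∀ᵐ a ∂μ, ∀ w, |k' w a| ≤ K / (1 + ‖w‖) ^ (d - 1)) (j : Fin d)
    (hD : ∀ᵐ a ∂μ, ∀ (w : Space d) (h : ℝ), HasDerivAt
      (fun h : ℝ => k (w + h • EuclideanSpace.single j (1 : ℝ)) a)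
      (k' (w + h • EuclideanSpace.single j (1 : ℝ)) a) h) (x : Space d) :
    HasDerivAt (fun h : ℝ => ∫ a, k (x + h • EuclideanSpace.single j (1 : ℝ) - y a) a * f a ∂μ)
      (∫ a, k' (x - y a) a * f a ∂μ) 0 := by
  have hm : ∀ x, Measurable fun a => (x - y a, a) := fun x => by fun_prop
  have hfm := aestronglyMeasurable_of_weighted hy hf
  set e : Space d := EuclideanSpace.single j (1 : ℝ) with he
  have key := (hasDerivAt_integral_of_dominated_loc_of_deriv_le (μ := μ) (x₀ := (0 : ℝ))
    (F := fun h a => k (x + h • e - y a) a * f a) (F' := fun h a => k' (x + h • e - y a) a * f a)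
    (bound := fun a => K * (1 + (‖x‖ + 1)) ^ (d - 1) * |f a / (1 + ‖y a‖) ^ (d - 1)|)
    (Metric.ball_mem_nhds 0 zero_lt_one) ?_ ?_ ?_ ?_ ?_ ?_).2
  · simpa using key
  · exact Eventually.of_forall fun h => (hk.comp (hm _)).aestronglyMeasurable.mul hfm
  · exact integrable_potential hy hf hk hK hkK _
  · exact (hk'.comp (hm _)).aestronglyMeasurable.mul hfm
  · filter_upwards [hkK'] with a ha h hh
    refine (abs_potential_le hK (ha _)).trans ?_
    have : ‖h • e‖ ≤ 1 := by
      rw [norm_smul, he, PiLp.norm_single, norm_one, mul_one]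
      exact (by simpa using hh : |h| < 1).le
    gcongr
  · exact hf.abs.const_mul _
  · filter_upwards [hD] with a ha h _
    have := ha (x - y a) h
    have e' : ∀ h : ℝ, x - y a + h • e = x + h • e - y a := fun h => by abel
    simp only [e'] at this
    exact this.mul_const _

end Potential

/-! ### Integrals over the lateral boundary -/

lemma lateral_eq_prod (T : ℝ) :
    lateral d T = (volume : Measure (Space d)).prod (volume.restrict (Ioo 0 T)) := by
  unfold lateral
  rw [Measure.volume_eq_prod, ← Measure.prod_restrict, Measure.restrict_univ]

lemma ae_lateral_mem (T : ℝ) : ∀ᵐ q ∂(lateral d T), q.2 ∈ Ioo 0 T := by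
  filter_upwards [ae_restrict_mem (MeasurableSet.univ.prod measurableSet_Ioo)] with q hq using hq.2

lemma lateral_mono {t T : ℝ} (h : t ≤ T) : lateral d t ≤ lateral d T :=
  Measure.restrict_mono (prod_mono le_rfl (Ioo_subset_Ioo_right h)) le_rfl

lemma integral_lateral {t : ℝ} {h : Space d × ℝ → ℝ} (hh : Integrable h (lateral d t)) :
    ∫ s in Ioo 0 t, ∫ y : Space d, h (y, s) = ∫ q, h q ∂(lateral d t) := by
  rw [lateral_eq_prod] at hh ⊢
  exact (integral_prod_symm _ hh).symm

/-- Translation in space and the reflection `s ↦ t - s` carry the domain into `(0, ∞)`, so the bound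
is uniform in `x` and `t`. -/
lemma IsBoundedKernel.lintegral_lateral_le {C : ℝ} {F : ℝ → Space d → ℝ}
    (hF : IsBoundedKernel C F) (t : ℝ) (x : Space d) :
    ∫⁻ q, ‖F (t - q.2) (x - q.1)‖ₑ ∂(lateral d t) ≤ ENNReal.ofReal C := by
  have hFm := hF.measurable
  have hG : Measurable fun τ => ∫⁻ y, ‖F τ y‖ₑ :=
    Measurable.lintegral_prod_right' (f := fun p : ℝ × Space d => ‖F p.1 p.2‖ₑ) (by fun_prop)
  have hm : Measurable fun q : Space d × ℝ => (t - q.2, x - q.1) := by fun_prop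
  have hFt : Measurable fun q : Space d × ℝ => ‖F (t - q.2) (x - q.1)‖ₑ := (hFm.comp hm).enorm
  rw [lateral_eq_prod, lintegral_prod_symm' _ hFt]
  calc ∫⁻ s in Ioo 0 t, ∫⁻ y, ‖F (t - s) (x - y)‖ₑ
      = ∫⁻ s in Ioo 0 t, ∫⁻ y, ‖F (t - s) y‖ₑ :=
        lintegral_congr fun s => lintegral_sub_left_eq_self (fun y => ‖F (t - s) y‖ₑ) x
    _ ≤ ∫⁻ s, (Ioi 0).indicator (fun τ => ∫⁻ y, ‖F τ y‖ₑ) (t - s) := by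
        rw [← lintegral_indicator measurableSet_Ioo]
        refine lintegral_mono fun s => ?_
        by_cases hs : s ∈ Ioo 0 t
        · have : t - s ∈ Ioi (0 : ℝ) := sub_pos.2 hs.2
          rw [indicator_of_mem hs, indicator_of_mem this]
        · rw [indicator_of_notMem hs]; exact zero_le
    _ = ∫⁻ τ in Ioi 0, ∫⁻ y, ‖F τ y‖ₑ := by
        rw [lintegral_sub_left_eq_self (fun τ => (Ioi 0).indicator (fun τ => ∫⁻ y, ‖F τ y‖ₑ) τ) t,
          lintegral_indicator measurableSet_Ioi]
    _ ≤ _ := hF.lintegral_le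

lemma IsBoundedKernel.integrable_mul {C M : ℝ} {F : ℝ → Space d → ℝ} (hF : IsBoundedKernel C F)
    {t : ℝ} (x : Space d) {f : Space d × ℝ → ℝ} (hf : AEStronglyMeasurable f (lateral d t))
    (hM : ∀ᵐ q ∂(lateral d t), |f q| ≤ M) :
    Integrable (fun q => F (t - q.2) (x - q.1) * f q) (lateral d t) := by
  have hm : Measurable fun q : Space d × ℝ => (t - q.2, x - q.1) := by fun_prop
  have h1 : Integrable (fun q : Space d × ℝ => F (t - q.2) (x - q.1)) (lateral d t) :=
    ⟨(hF.measurable.comp hm).aestronglyMeasurable,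
      (hF.lintegral_lateral_le t x).trans_lt ENNReal.ofReal_lt_top⟩
  exact h1.mul_bdd hf hM

lemma IsBoundedKernel.abs_integral_mul_le {C M : ℝ} {F : ℝ → Space d → ℝ}
    (hF : IsBoundedKernel C F) (hC : 0 ≤ C) (hM0 : 0 ≤ M) {t : ℝ} (x : Space d)
    {f : Space d × ℝ → ℝ} (hM : ∀ᵐ q ∂(lateral d t), |f q| ≤ M) :
    |∫ q, F (t - q.2) (x - q.1) * f q ∂(lateral d t)| ≤ C * M := by
  have hm : Measurable fun q : Space d × ℝ => (t - q.2, x - q.1) := by fun_prop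
  have hFt : Measurable fun q : Space d × ℝ => ‖F (t - q.2) (x - q.1)‖ₑ :=
    (hF.measurable.comp hm).enorm
  have h1 : ‖∫ q, F (t - q.2) (x - q.1) * f q ∂(lateral d t)‖ₑ ≤ ENNReal.ofReal (C * M) := by
    calc _ ≤ ∫⁻ q, ‖F (t - q.2) (x - q.1) * f q‖ₑ ∂(lateral d t) :=
          enorm_integral_le_lintegral_enorm _
      _ ≤ ∫⁻ q, ‖F (t - q.2) (x - q.1)‖ₑ * ENNReal.ofReal M ∂(lateral d t) := by
          refine lintegral_mono_ae ?_
          filter_upwards [hM] with q hq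
          rw [enorm_mul, Real.enorm_eq_ofReal_abs (f q)]
          exact mul_le_mul_right (ENNReal.ofReal_le_ofReal hq) _
      _ ≤ _ := by
          rw [lintegral_mul_const _ hFt, ENNReal.ofReal_mul hC]
          exact mul_le_mul_left (hF.lintegral_lateral_le t x) _
  rw [Real.enorm_eq_ofReal_abs] at h1
  exact (ENNReal.ofReal_le_ofReal_iff (by positivity)).1 h1

/-- A kernel that coincides with a bounded one defines bounded potentials. -/
lemma bounded_potential {C M : ℝ} {F : ℝ → Space d → ℝ} (hF : IsBoundedKernel C F) (hC : 0 ≤ C)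
    (hM0 : 0 ≤ M) {t : ℝ} (x : Space d) {f G : Space d × ℝ → ℝ}
    (hf : AEStronglyMeasurable f (lateral d t)) (hM : ∀ᵐ q ∂(lateral d t), |f q| ≤ M)
    (hG : ∀ q : Space d × ℝ, q.2 ∈ Ioo 0 t → G q = F (t - q.2) (x - q.1)) :
    Integrable (fun q => G q * f q) (lateral d t) ∧
      |∫ s in Ioo 0 t, ∫ y : Space d, G (y, s) * f (y, s)| ≤ C * M := by
  have h0 : (fun q => F (t - q.2) (x - q.1) * f q) =ᵐ[lateral d t] fun q => G q * f q := by
    filter_upwards [ae_lateral_mem t] with q hq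
    rw [hG q hq]
  have h1 := (hF.integrable_mul x hf hM).congr h0
  refine ⟨h1, ?_⟩
  rw [integral_lateral h1, ← integral_congr_ae h0]
  exact hF.abs_integral_mul_le hC hM0 x hM

/-! ### The single layer potentials -/

/-- `D_n E(·, X)` is nonnegative with mass `layerMass d` at every height, so the normal component of
the Dirac term is bounded without any decay of the datum. The tangential components have no such
bound. -/
lemma gradE_layer_last {X M : ℝ} (hX : 0 < X) (x : Space d) {f : Space d → ℝ}
    (hf : AEStronglyMeasurable f) (hM : ∀ᵐ y, |f y| ≤ M) :
    Integrable (fun y => gradE (Fin.last d) (x - y) X * f y) ∧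
      |∫ y, gradE (Fin.last d) (x - y) X * f y| ≤ layerMass d * M := by
  have h1 := (integrable_gradE_last (d := d) hX).comp_sub_left x
  refine ⟨h1.mul_bdd hf hM, ?_⟩
  have h2 : ‖∫ y, gradE (Fin.last d) (x - y) X * f y‖
      ≤ ∫ y, gradE (Fin.last d) (x - y) X * M := by
    refine norm_integral_le_of_norm_le (h1.mul_const M) ?_
    filter_upwards [hM] with y hy
    rw [norm_mul, Real.norm_of_nonneg (gradE_last_nonneg hX _)]
    exact mul_le_mul_of_nonneg_left hy (gradE_last_nonneg hX _)
  refine h2.trans_eq ?_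
  rw [integral_mul_const, integral_sub_left_eq_self (fun y => gradE (Fin.last d) y X) volume x,
    integral_gradE_last hX]

lemma laplace_decay (hd : 2 ≤ d) {X : ℝ} (hX : 0 < X) :
    ∃ K : ℝ, 0 ≤ K ∧ (∀ w : Space d, |laplaceKernel (pt w X)| ≤ K / (1 + ‖w‖) ^ (d - 1)) ∧
      ∀ i, ∀ w : Space d, |gradE i w X| ≤ K / (1 + ‖w‖) ^ (d - 1) := by
  obtain ⟨K, hK, h⟩ := radialPow_decay hd hX
  have hω := sphereArea_pos (d := d)
  have hl := laplaceConst_nonneg hd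
  refine ⟨(laplaceConst d + (sphereArea (d + 1))⁻¹) * K, by positivity, fun w => ?_, fun i w => ?_⟩
  · rw [abs_laplaceKernel_pt hd, mul_div_assoc]
    refine mul_le_mul ?_ (h w).1 (radialPow_nonneg _ _ _) (by positivity)
    exact le_add_of_nonneg_right (by positivity)
  · refine (abs_gradE_le i w hX).trans ?_
    rw [mul_div_assoc]
    refine mul_le_mul ?_ (h w).2 (radialPow_nonneg _ _ _) (by positivity)
    exact le_add_of_nonneg_left hl

lemma pt_sub_boundary (x y : Space d) (X : ℝ) : pt x X - pt y 0 = pt (x - y) X := by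
  rw [pt_sub_pt, sub_zero]

lemma hasLineDerivAt_castSucc {f : Space (d + 1) → ℝ} {z : Space d} {s D : ℝ} {k : Fin d}
    (h : HasDerivAt (fun h : ℝ => f (pt (z + h • EuclideanSpace.single k 1) s)) D 0) :
    HasLineDerivAt ℝ f D (pt z s) (EuclideanSpace.single k.castSucc 1) := by
  unfold HasLineDerivAt
  simpa only [pt_add_smul_castSucc] using h

lemma potentialS_properties (hd : 2 ≤ d) {X : ℝ} (hX : 0 < X) (x : Space d) {f : Space d → ℝ}
    (hf : Integrable fun y => f y / (1 + ‖y‖) ^ (d - 1)) :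
    Integrable (fun y : Space d => laplaceKernel (pt x X - pt y 0) * f y) ∧
    (∀ i, Integrable fun y : Space d => gradE i (x - y) X * f y) ∧
    ∀ k : Fin d, HasLineDerivAt ℝ (potentialS f) (∫ y, gradE k.castSucc (x - y) X * f y) (pt x X)
      (EuclideanSpace.single k.castSucc 1) := by
  obtain ⟨K, hK, h1, h2⟩ := laplace_decay hd hX
  have hmE : Measurable fun p : Space d × Space d => laplaceKernel (pt p.1 X) :=
    (measurable_laplaceKernel_pt X).comp measurable_fst
  have hmg : ∀ i, Measurable fun p : Space d × Space d => gradE i p.1 X := fun i =>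
    (measurable_gradE_left i X).comp measurable_fst
  simp only [pt_sub_boundary]
  refine ⟨integrable_potential (k := fun w _ => laplaceKernel (pt w X)) measurable_id hf hmE hK
    (ae_of_all _ fun _ => h1) x, fun i => integrable_potential (k := fun w _ => gradE i w X)
    measurable_id hf (hmg i) hK (ae_of_all _ fun _ => h2 i) x, fun k => ?_⟩
  refine hasLineDerivAt_castSucc ?_
  unfold potentialS
  simp only [pt_sub_boundary]
  exact hasDerivAt_potential (k := fun w _ => laplaceKernel (pt w X))
    (k' := fun w _ => gradE k.castSucc w X) measurable_id hf hmE (hmg _) hK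
    (ae_of_all _ fun _ => h1) (ae_of_all _ fun _ => h2 _) k
    (ae_of_all _ fun _ w h => hasDerivAt_laplaceKernel_line hd w hX k h) x

/-- The kernel `κ` equals `normalFactor * convLaplace` only for positive times, hence the identities
hold almost everywhere on the lateral boundary. The derivative found is the same expression as the
non-integrable part of `K_kn`. -/
lemma potentialT_properties (hd : 2 ≤ d) {X t : ℝ} (hX : 0 < X) (ht : 0 < t) (x : Space d)
    {f : Space d × ℝ → ℝ} (hf : Integrable (fun q => f q / (1 + ‖q.1‖) ^ (d - 1)) (lateral d t)) :
    Integrable (fun q => kappa (pt x X - pt q.1 0) (t - q.2) * f q) (lateral d t) ∧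
    ∀ k : Fin d,
      Integrable (fun q => normalFactor (t - q.2) X * convLaplaceDeriv k (t - q.2) (x - q.1) * f q)
        (lateral d t) ∧
      HasLineDerivAt ℝ (fun w => potentialT f w t)
        (4 * ∫ q, normalFactor (t - q.2) X * convLaplaceDeriv k (t - q.2) (x - q.1) * f q
          ∂(lateral d t)) (pt x X) (EuclideanSpace.single k.castSucc 1) := by
  obtain ⟨K, hK, hb⟩ := kappa_decay hd hX ht
  have hmN : Measurable fun p : Space d × (Space d × ℝ) => normalFactor (t - p.2.2) X := by
    have h : Measurable fun p : Space d × (Space d × ℝ) => (t - p.2.2, X) := by fun_prop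
    simpa only [Function.comp_def] using measurable_normalFactor.comp h
  have hm2 : Measurable fun p : Space d × (Space d × ℝ) => (t - p.2.2, p.1) := by fun_prop
  have hmk : Measurable fun p : Space d × (Space d × ℝ) =>
      normalFactor (t - p.2.2) X * convLaplace (t - p.2.2) p.1 := by
    have h := measurable_convLaplace.comp hm2
    simp only [Function.comp_def] at h
    exact hmN.mul h
  have hmk' : ∀ k, Measurable fun p : Space d × (Space d × ℝ) =>
      normalFactor (t - p.2.2) X * convLaplaceDeriv k (t - p.2.2) p.1 := fun k => by
    have h := (measurable_convLaplaceDeriv k).comp hm2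
    simp only [Function.comp_def] at h
    exact hmN.mul h
  have hb1 : ∀ᵐ q ∂(lateral d t), ∀ w : Space d,
      |normalFactor (t - q.2) X * convLaplace (t - q.2) w| ≤ K / (1 + ‖w‖) ^ (d - 1) := by
    filter_upwards [ae_lateral_mem t] with q hq w
    exact (hb _ (sub_pos.2 hq.2) (by linarith [hq.1]) w).1
  have hb2 : ∀ k, ∀ᵐ q ∂(lateral d t), ∀ w : Space d,
      |normalFactor (t - q.2) X * convLaplaceDeriv k (t - q.2) w| ≤ K / (1 + ‖w‖) ^ (d - 1) := by
    intro k
    filter_upwards [ae_lateral_mem t] with q hq w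
    exact (hb _ (sub_pos.2 hq.2) (by linarith [hq.1]) w).2 k
  have hκ : ∀ x : Space d, (fun q : Space d × ℝ =>
      normalFactor (t - q.2) X * convLaplace (t - q.2) (x - q.1) * f q)
      =ᵐ[lateral d t] fun q => kappa (pt x X - pt q.1 0) (t - q.2) * f q := by
    intro x
    filter_upwards [ae_lateral_mem t] with q hq
    rw [pt_sub_boundary, kappa_pt (sub_pos.2 hq.2)]
  have hint : ∀ x : Space d,
      Integrable (fun q => kappa (pt x X - pt q.1 0) (t - q.2) * f q) (lateral d t) := by
    intro x
    refine Integrable.congr ?_ (hκ x)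
    exact integrable_potential (y := fun q : Space d × ℝ => q.1)
      (k := fun w q => normalFactor (t - q.2) X * convLaplace (t - q.2) w)
      measurable_fst hf hmk hK hb1 x
  refine ⟨hint x, fun k => ⟨integrable_potential (y := fun q : Space d × ℝ => q.1)
    (k := fun w q => normalFactor (t - q.2) X * convLaplaceDeriv k (t - q.2) w)
    measurable_fst hf (hmk' k) hK (hb2 k) x, ?_⟩⟩
  refine hasLineDerivAt_castSucc ?_
  have hT : ∀ x : Space d, potentialT f (pt x X) t
      = 4 * ∫ q, normalFactor (t - q.2) X * convLaplace (t - q.2) (x - q.1) * f q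
        ∂(lateral d t) := fun x => by
    unfold potentialT
    rw [integral_congr_ae (hκ x), ← integral_lateral (hint x)]
  simp only [hT]
  refine HasDerivAt.const_mul _ (hasDerivAt_potential (y := fun q : Space d × ℝ => q.1)
    (k := fun w q => normalFactor (t - q.2) X * convLaplace (t - q.2) w)
    (k' := fun w q => normalFactor (t - q.2) X * convLaplaceDeriv k (t - q.2) w)
    measurable_fst hf hmk (hmk' k) hK hb1 (hb2 k) k ?_ x)
  filter_upwards [ae_lateral_mem t] with q hq w h
  exact (hasDerivAt_convLaplace hd (sub_pos.2 hq.2) k w h).const_mul _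

/-! ### The velocity -/

lemma tangential_castSucc (v : Space (d + 1)) (k : Fin d) :
    tangential v k.castSucc = v k.castSucc := by
  simp [tangential, outwardNormal, (Fin.castSucc_lt_last k).ne]

lemma tangential_last (v : Space (d + 1)) : tangential v (Fin.last d) = 0 := by
  simp [tangential, outwardNormal, EuclideanSpace.inner_single_right]

lemma norm_le_of_forall_abs_le {m : ℕ} {v : Space m} {B : ℝ} (hB : 0 ≤ B) (h : ∀ i, |v i| ≤ B) :
    ‖v‖ ≤ m * B := by
  refine le_of_sq_le_sq ?_ (by positivity)
  rw [EuclideanSpace.real_norm_sq_eq]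
  calc ∑ i, v i ^ 2 ≤ ∑ _i : Fin m, B ^ 2 := Finset.sum_le_sum fun i _ => by
        rw [← sq_abs]; exact pow_le_pow_left₀ (abs_nonneg _) (h i) 2
    _ = m * B ^ 2 := by simp
    _ ≤ (m * B) ^ 2 := by
        rw [mul_pow]
        gcongr
        rcases Nat.eq_zero_or_pos m with rfl | hm
        · simp
        · have : (1 : ℝ) ≤ m := by exact_mod_cast hm
          nlinarith

section Velocity

variable {g : Space d × ℝ → Space (d + 1)} {t X M : ℝ}

/-- All kernels in the last row are `L¹`, including the Dirac contribution, which explains why part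
(b) needs no weighted integrability. -/
lemma normal_velocity (hd : 2 ≤ d) (hX : 0 < X) (hM0 : 0 ≤ M) (x : Space d) (c : ℝ)
    (hg : ∀ j, AEStronglyMeasurable (fun q => g q j) (lateral d t))
    (hM : ∀ j, ∀ᵐ q ∂(lateral d t), |g q j| ≤ M)
    (hg' : AEStronglyMeasurable fun y => g (y, t) (Fin.last d))
    (hM' : ∀ᵐ y, |g (y, t) (Fin.last d)| ≤ M) :
    VelocityConverges g (Fin.last d) (pt x X) t ∧
      |velocity c g (pt x X) t (Fin.last d)|
        ≤ (((d + 1 : ℕ) : ℝ) * kernelConst d + |c| * layerMass d) * M := by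
  have hK : ∀ j, Integrable (fun q : Space d × ℝ =>
      kernelK (Fin.last d) j (pt x X - pt q.1 0) (t - q.2) * g q j) (lateral d t) ∧
      |∫ s in Ioo 0 t, ∫ y : Space d,
        kernelK (Fin.last d) j (pt x X - pt y 0) (t - s) * g (y, s) j| ≤ kernelConst d * M := by
    intro j
    obtain ⟨F, hF, hF'⟩ : ∃ F : ℝ → Space d → ℝ, IsBoundedKernel (kernelConst d) F ∧
        ∀ t x, 0 < t → kernelK (Fin.last d) j (pt x X) t = F t x := by
      refine Fin.lastCases ?_ (fun k => ?_) j
      · exact kernelK_last_last_eq hd hX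
      · exact kernelK_castSucc_eq hd hX _ k
    refine bounded_potential (G := fun q => kernelK (Fin.last d) j (pt x X - pt q.1 0) (t - q.2))
      hF kernelConst_nonneg hM0 x (hg j) (hM j) fun q hq => ?_
    rw [pt_sub_boundary, hF' _ _ (sub_pos.2 hq.2)]
  have hL := gradE_layer_last hX x hg' hM'
  refine ⟨⟨fun j => (hK j).1, ?_⟩, ?_⟩
  · simp only [pt_sub_boundary, pd_laplaceKernel hd _ _ hX]
    exact hL.1
  · simp only [velocity, pt_sub_boundary, pd_laplaceKernel hd _ _ hX]
    simp only [pt_sub_boundary] at hK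
    rw [add_mul]
    refine (abs_add_le _ _).trans (add_le_add ?_ ?_)
    · refine (Finset.abs_sum_le_sum_abs _ _).trans
        ((Finset.sum_le_sum fun j _ => (hK j).2).trans_eq ?_)
      rw [Finset.sum_const, Finset.card_univ, Fintype.card_fin, nsmul_eq_mul]
      ring
    · rw [abs_mul, mul_assoc]
      exact mul_le_mul_of_nonneg_left hL.2 (abs_nonneg _)

/-- The explicit part of `K_in` integrates to `D_i T` and the Dirac term to `c D_i S`; both cancel
exactly, and what remains is a sum of `d + 1` bounded potentials. -/
lemma tangential_velocity (hd : 2 ≤ d) (hX : 0 < X) (ht : 0 < t) (hM0 : 0 ≤ M) (x : Space d)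
    (c : ℝ) (hg : ∀ j, AEStronglyMeasurable (fun q => g q j) (lateral d t))
    (hM : ∀ j, ∀ᵐ q ∂(lateral d t), |g q j| ≤ M)
    (hw : Integrable (fun q => g q (Fin.last d) / (1 + ‖q.1‖) ^ (d - 1)) (lateral d t))
    (hw' : Integrable fun y => g (y, t) (Fin.last d) / (1 + ‖y‖) ^ (d - 1)) (i : Fin d) :
    VelocityConverges g i.castSucc (pt x X) t ∧
      |velocity c g (pt x X) t i.castSucc
        - c * pd i.castSucc (potentialS fun y => g (y, t) (Fin.last d)) (pt x X)
        - pd i.castSucc (fun w => potentialT (fun q => g q (Fin.last d)) w t) (pt x X)|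
        ≤ ((d + 1 : ℕ) : ℝ) * kernelConst d * M := by
  obtain ⟨-, hS2, hS3⟩ := potentialS_properties hd hX x hw'
  obtain ⟨-, hT2⟩ := potentialT_properties hd hX ht x hw
  have hK : ∀ j : Fin d, Integrable (fun q : Space d × ℝ =>
      kernelK i.castSucc j.castSucc (pt x X - pt q.1 0) (t - q.2) * g q j.castSucc) (lateral d t) ∧
      |∫ s in Ioo 0 t, ∫ y : Space d,
        kernelK i.castSucc j.castSucc (pt x X - pt y 0) (t - s) * g (y, s) j.castSucc|
        ≤ kernelConst d * M := by
    intro j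
    obtain ⟨F, hF, hF'⟩ := kernelK_castSucc_eq hd hX i.castSucc j
    refine bounded_potential
      (G := fun q => kernelK i.castSucc j.castSucc (pt x X - pt q.1 0) (t - q.2))
      hF kernelConst_nonneg hM0 x (hg _) (hM _) fun q hq => ?_
    rw [pt_sub_boundary, hF' _ _ (sub_pos.2 hq.2)]
  obtain ⟨F, hF, hF'⟩ := kernelK_castSucc_last_eq hd hX i
  have hFi := hF.integrable_mul x (hg (Fin.last d)) (hM (Fin.last d))
  have hFb := hF.abs_integral_mul_le kernelConst_nonneg hM0 x (hM (Fin.last d))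
  have hlast : (fun q : Space d × ℝ => F (t - q.2) (x - q.1) * g q (Fin.last d)
        + 4 * (normalFactor (t - q.2) X * convLaplaceDeriv i (t - q.2) (x - q.1)
          * g q (Fin.last d)))
      =ᵐ[lateral d t] fun q =>
        kernelK i.castSucc (Fin.last d) (pt x X - pt q.1 0) (t - q.2) * g q (Fin.last d) := by
    filter_upwards [ae_lateral_mem t] with q hq
    rw [pt_sub_boundary, hF' _ _ (sub_pos.2 hq.2)]
    ring
  have hlint := (hFi.add ((hT2 i).1.const_mul 4)).congr hlast
  have hlval : ∫ s in Ioo 0 t, ∫ y : Space d,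
      kernelK i.castSucc (Fin.last d) (pt x X - pt y 0) (t - s) * g (y, s) (Fin.last d)
      = (∫ q, F (t - q.2) (x - q.1) * g q (Fin.last d) ∂(lateral d t))
        + 4 * ∫ q, normalFactor (t - q.2) X * convLaplaceDeriv i (t - q.2) (x - q.1)
          * g q (Fin.last d) ∂(lateral d t) := by
    rw [integral_lateral hlint, ← integral_congr_ae hlast,
      integral_add hFi ((hT2 i).1.const_mul 4), integral_const_mul]
  refine ⟨⟨fun j => ?_, ?_⟩, ?_⟩
  · refine Fin.lastCases ?_ (fun k => ?_) j
    · exact hlint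
    · exact (hK k).1
  · simp only [pt_sub_boundary, pd_laplaceKernel hd _ _ hX]
    exact hS2 _
  · have hv : velocity c g (pt x X) t i.castSucc
        = (∑ j, ∫ s in Ioo 0 t, ∫ y : Space d,
            kernelK i.castSucc j (pt x X - pt y 0) (t - s) * g (y, s) j)
          + c * ∫ y, gradE i.castSucc (x - y) X * g (y, t) (Fin.last d) := by
      simp only [velocity, pt_sub_boundary, pd_laplaceKernel hd _ _ hX]
    rw [show pd i.castSucc (potentialS fun y => g (y, t) (Fin.last d)) (pt x X) = _ from
        (hS3 i).lineDeriv,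
      show pd i.castSucc (fun w => potentialT (fun q => g q (Fin.last d)) w t) (pt x X) = _ from
        (hT2 i).2.lineDeriv, hv, Fin.sum_univ_castSucc, hlval]
    set A := ∑ j : Fin d, ∫ s in Ioo 0 t, ∫ y : Space d,
      kernelK i.castSucc j.castSucc (pt x X - pt y 0) (t - s) * g (y, s) j.castSucc with hA
    have hAb : |A| ≤ d * (kernelConst d * M) := by
      refine (Finset.abs_sum_le_sum_abs _ _).trans
        ((Finset.sum_le_sum fun j _ => (hK j).2).trans_eq ?_)
      rw [Finset.sum_const, Finset.card_univ, Fintype.card_fin, nsmul_eq_mul]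
    have hsum := (abs_add_le A _).trans (add_le_add hAb hFb)
    refine le_trans (le_of_eq ?_) (hsum.trans_eq ?_)
    · congr 1; ring
    · push_cast; ring

end Velocity

/-! ### Fibres of the boundary datum -/

/-- The Dirac term uses the slice `g (·, t)`, about which an almost everywhere statement on the
lateral boundary gives information only for almost every `t`. -/
lemma ae_ae_lateral {T : ℝ} {p : Space d × ℝ → Prop} (h : ∀ᵐ q ∂(lateral d T), p q) :
    ∀ᵐ t ∂(volume.restrict (Ioo 0 T)), ∀ᵐ y : Space d, p (y, t) := by
  rw [lateral_eq_prod] at h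
  exact Measure.ae_ae_of_ae_prod
    ((Measure.measurePreserving_swap (μ := volume.restrict (Ioo 0 T))
      (ν := (volume : Measure (Space d)))).quasiMeasurePreserving.ae h)

lemma ae_aestronglyMeasurable_fibre {T : ℝ} {f : Space d × ℝ → ℝ}
    (h : AEStronglyMeasurable f (lateral d T)) :
    ∀ᵐ t ∂(volume.restrict (Ioo 0 T)), AEStronglyMeasurable fun y : Space d => f (y, t) := by
  rw [lateral_eq_prod] at h
  exact h.prod_swap.prodMk_left

lemma ae_integrable_fibre {T : ℝ} {f : Space d × ℝ → ℝ} (h : Integrable f (lateral d T)) :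
    ∀ᵐ t ∂(volume.restrict (Ioo 0 T)), Integrable fun y : Space d => f (y, t) := by
  rw [lateral_eq_prod] at h
  exact h.prod_left_ae

lemma measurableSet_halfSpace : MeasurableSet (halfSpace d) :=
  measurableSet_lt measurable_const (by fun_prop)

end HalfSpaceStokes

end

/-! ### Assembly of the theorem -/

open HalfSpaceStokes in
theorem theorem3p2 (d : ℕ) (hd : 2 ≤ d) (c : ℝ) :
    ∃ C : ℝ, 0 < C ∧ ∀ T : ℝ, 0 < T → ∀ g : Space d × ℝ → Space (d + 1),
      MemLp g ⊤ (lateral d T) →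
      -- tangential part, whenever the potentials of the normal datum converge
      (Integrable (fun q : Space d × ℝ => g q (Fin.last d) / (1 + ‖q.1‖) ^ (d - 1))
          (lateral d T) →
        (∀ᵐ t ∂(volume.restrict (Ioo 0 T)), ∀ x ∈ halfSpace d,
          (∀ i, VelocityConverges g i x t) ∧
          PotentialsConverge (fun q => g q (Fin.last d)) x t) ∧
        eLpNorm (fun p : Space (d + 1) × ℝ =>
            tangential (velocity c g p.1 p.2)
              - c • tangential (grad (potentialS fun y => g (y, p.2) (Fin.last d)) p.1)
              - tangential
                  (grad (fun w => potentialT (fun q => g q (Fin.last d)) w p.2) p.1))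
            ⊤ (volume.restrict (halfSpace d ×ˢ Ioo 0 T))
          ≤ ENNReal.ofReal C * eLpNorm g ⊤ (lateral d T)) ∧
      -- normal part
      (∀ᵐ t ∂(volume.restrict (Ioo 0 T)), ∀ x ∈ halfSpace d,
        VelocityConverges g (Fin.last d) x t ∧
        |velocity c g x t (Fin.last d)| ≤ C * (eLpNorm g ⊤ (lateral d T)).toReal) := by
  have hk0 := kernelConst_nonneg (d := d)
  have hm0 := layerMass_nonneg (d := d)
  -- `A` bounds each component, the summand `1` ensuring positivity. The further factor `d + 1` in
  -- the witness pays for passing from components to the Euclidean norm.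
  set A : ℝ := ((d + 1 : ℕ) : ℝ) * kernelConst d + |c| * layerMass d + 1 with hA
  have hA0 : 0 < A := by positivity
  have hd1 : (1 : ℝ) ≤ ((d + 1 : ℕ) : ℝ) := by exact_mod_cast Nat.le_add_left 1 d
  refine ⟨((d + 1 : ℕ) : ℝ) * A, by positivity, fun T hT g hg => ?_⟩
  set M : ℝ := (eLpNorm g ⊤ (lateral d T)).toReal with hM
  have hM0 : 0 ≤ M := ENNReal.toReal_nonneg
  have hMe : ENNReal.ofReal M = eLpNorm g ⊤ (lateral d T) := ENNReal.ofReal_toReal hg.2.ne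
  have hmeas : ∀ j, AEStronglyMeasurable (fun q => g q j) (lateral d T) := fun j =>
    (by fun_prop : Continuous fun v : Space (d + 1) => v j).comp_aestronglyMeasurable hg.1
  have hbd : ∀ j, ∀ᵐ q ∂(lateral d T), |g q j| ≤ M := fun j => by
    have h := ae_le_eLpNormEssSup (f := g) (μ := lateral d T)
    filter_upwards [h] with q hq
    rw [← eLpNorm_exponent_top, ← hMe, ← ofReal_norm,
      ENNReal.ofReal_le_ofReal_iff hM0] at hq
    exact (PiLp.norm_apply_le (g q) j).trans hq
  have hmeas' : ∀ t, t ≤ T → ∀ j, AEStronglyMeasurable (fun q => g q j) (lateral d t) :=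
    fun t ht j => (hmeas j).mono_measure (lateral_mono ht)
  have hbd' : ∀ t, t ≤ T → ∀ j, ∀ᵐ q ∂(lateral d t), |g q j| ≤ M := fun t ht j =>
    ae_mono (lateral_mono ht) (hbd j)
  have hnormal : ∀ᵐ t ∂(volume.restrict (Ioo 0 T)), ∀ x ∈ halfSpace d,
      VelocityConverges g (Fin.last d) x t ∧
      |velocity c g x t (Fin.last d)| ≤ ((d + 1 : ℕ) : ℝ) * A * M := by
    filter_upwards [ae_restrict_mem measurableSet_Ioo, ae_ae_lateral (hbd (Fin.last d)),
      ae_aestronglyMeasurable_fibre (hmeas (Fin.last d))] with t ht hb hm x hx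
    have h := normal_velocity hd hx hM0 (bdry x) c (hmeas' t ht.2.le) (hbd' t ht.2.le) hm hb
    rw [pt_bdry] at h
    refine ⟨h.1, h.2.trans (mul_le_mul_of_nonneg_right ?_ hM0)⟩
    exact le_trans (by linarith) (le_mul_of_one_le_left hA0.le hd1)
  refine ⟨fun hw => ?_, hnormal⟩
  have hgood : ∀ᵐ t ∂(volume.restrict (Ioo 0 T)),
      t ∈ Ioo 0 T ∧ Integrable fun y : Space d => g (y, t) (Fin.last d) / (1 + ‖y‖) ^ (d - 1) := by
    filter_upwards [ae_restrict_mem measurableSet_Ioo, ae_integrable_fibre hw] with t ht h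
    exact ⟨ht, h⟩
  have hw' : ∀ t, t ≤ T → Integrable (fun q : Space d × ℝ =>
      g q (Fin.last d) / (1 + ‖q.1‖) ^ (d - 1)) (lateral d t) := fun t ht =>
    hw.mono_measure (lateral_mono ht)
  constructor
  · filter_upwards [hgood, hnormal] with t ⟨ht, hf⟩ hn x hx
    have hv := tangential_velocity hd hx ht.1 hM0 (bdry x) c (hmeas' t ht.2.le) (hbd' t ht.2.le)
      (hw' t ht.2.le) hf
    have hS := potentialS_properties hd hx (bdry x) hf
    have hT := potentialT_properties hd hx ht.1 (bdry x) (hw' t ht.2.le)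
    rw [pt_bdry] at hS hT
    simp only [pt_bdry] at hv
    refine ⟨fun i => Fin.lastCases (hn x hx).1 (fun k => (hv k).1) i, hS.1, hT.1, fun i =>
      ⟨(hS.2.2 i).lineDifferentiableAt, (hT.2 i).2.lineDifferentiableAt⟩⟩
  · rw [← hMe, ← ENNReal.ofReal_mul (by positivity), eLpNorm_exponent_top]
    -- An almost everywhere pointwise bound suffices for the essential supremum; no measurability of
    -- the velocity or of the gradients has to be established.
    refine eLpNormEssSup_le_of_ae_bound ?_
    rw [Measure.volume_eq_prod, ← Measure.prod_restrict]
    have hx : ∀ᵐ p ∂((volume.restrict (halfSpace d)).prod (volume.restrict (Ioo 0 T))),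
        p.1 ∈ halfSpace d :=
      Measure.quasiMeasurePreserving_fst.ae (ae_restrict_mem measurableSet_halfSpace)
    filter_upwards [hx, Measure.quasiMeasurePreserving_snd.ae hgood] with p hp ⟨ht, hf⟩
    have hv := tangential_velocity hd hp ht.1 hM0 (bdry p.1) c (hmeas' p.2 ht.2.le)
      (hbd' p.2 ht.2.le) (hw' p.2 ht.2.le) hf
    simp only [pt_bdry] at hv
    rw [mul_assoc]
    refine norm_le_of_forall_abs_le (by positivity) fun i => ?_
    refine Fin.lastCases ?_ (fun k => ?_) i
    · simp only [PiLp.sub_apply, PiLp.smul_apply, tangential_last]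
      simpa using (by positivity : 0 ≤ A * M)
    · simp only [PiLp.sub_apply, PiLp.smul_apply, tangential_castSucc, smul_eq_mul, grad]
      refine (hv k).2.trans (mul_le_mul_of_nonneg_right ?_ hM0)
      have : 0 ≤ |c| * layerMass d := by positivity
      linarith
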